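/- Let $t\ge 1$ be an integer. Graphs are finite, undirected and without multiple edges; graphs $F$ may have loops. A $(t,t)$-bilabelled graph $\boldsymbol F=(F,\boldsymbol u,\boldsymbol v)$ is a graph $F$ with tuples $\boldsymbol u,\boldsymbol v\in V(F)^t$ of in-labels and out-labels; it is atomic if every vertex of $F$ occurs in $\boldsymbol u$ or $\boldsymbol v$, and $\mathcal A_t$ is the set of atomic graphs. The parallel composition of $\boldsymbol F$ and $\boldsymbol F'$ glues $\boldsymbol u_i$ to $\boldsymbol u'_i$ and $\boldsymbol v_i$ to $\boldsymbol v'_i$ for all $i$ (labels $\boldsymbol u,\boldsymbol v$); the series composition glues $\boldsymbol v_i$ to $\boldsymbol u'_i$ for all $i$ (labels $\boldsymbol u,\boldsymbol v'$); multiple edges are merged. The symmetric group $\mathfrak S_{2t}$ acts by permuting the $2t$ labels. Up to isomorphism, $\mathcal L_t^+$ is the class of bilabelled graphs generated by $\mathcal A_t$ under parallel composition, series composition and the action of $\mathfrak S_{2t}$, and $\mathcal L_t$ is the class generated by $\mathcal A_t$ under parallel composition with elements of $\mathcal A_t$, series composition and the action of $\mathfrak S_{2t}$. The homomorphism tensor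 of $\boldsymbol F$ for a simple graph $G$ is the matrix $\boldsymbol F_G\in\mathbb C^{V(G)^t\times V(G)^t}$ whose $(\boldsymbol x,\boldsymbol y)$ entry is the number of homomorphisms $h\colon F\to G$ with $h(\boldsymbol u_i)=\boldsymbol x_i$ and $h(\boldsymbol v_i)=\boldsymbol y_i$ for all $i$. For $X\in\mathbb C^{V(G)^t\times V(G)^t}$ let $X^\sigma$ be obtained by permuting the $2t$ coordinates by $\sigma\in\mathfrak S_{2t}$; $\odot$ is the entry-wise product, $I$ the identity matrix and $J$ an all-ones matrix. A matrix is doubly non-negative (DNN) if it is positive semidefinite and entry-wise non-negative. Then $\mathcal L_t\subseteq\mathcal L_t^+$, the class of graphs underlying the elements of $\mathcal L_t^+$ is closed under taking minors (with at least one vertex), and all its members have treewidth at most $3t-1$. Moreover, for all finite simple graphs $G$ and $H$, the following are equivalent. 1. The level-$t$ Lasserre relaxation for graph isomorphism with non-negativity constraints is feasible: there are real numbers $y_I\ge 0$, for $I\subseteq V(G)\times V(H)$ with $|I|\le 2t$, such that $(y_{I\cup J})_{|I|,|J|\le t}\succeq 0$; $\sum_{h'\in V(H)}y_{I\cup\{gh'\}}=y_I=\sum_{g'\in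 V(G)}y_{I\cup\{g'h\}}$ for all $|I|\le 2t-2$, $g\in V(G)$, $h\in V(H)$; $y_I=0$ if $I$ is not a partial isomorphism (i.e. unless $g=g'\Leftrightarrow h=h'$ and $gg'\in E(G)\Leftrightarrow hh'\in E(H)$ for all $gh,g'h'\in I$); and $y_\emptyset=1$. (Each of the two summation identities is imposed separately.) 2. $G$ and $H$ are level-$t$ DNN-isomorphic: there is a real DNN matrix $M$ with rows and columns indexed by $(V(G)\times V(H))^t$ such that, writing $M(\boldsymbol g,\boldsymbol h)$ for the entry $M_{g_1h_1\dots g_th_t,\;g_{t+1}h_{t+1}\dots g_{2t}h_{2t}}$: for all $i\in[2t]$, $\boldsymbol g\in V(G)^{2t}$ and $\boldsymbol h\in V(H)^{2t}$, the sum of $M$ over the $i$-th entry of $\boldsymbol g$ equals the sum of $M$ over the $i$-th entry of $\boldsymbol h$; $\sum_{\boldsymbol h'\in V(H)^{2t}}M(\boldsymbol g,\boldsymbol h')=1$ for all $\boldsymbol g\in V(G)^{2t}$ and $\sum_{\boldsymbol g'\in V(G)^{2t}}M(\boldsymbol g',\boldsymbol h)=1$ for all $\boldsymbol h\in V(H)^{2t}$;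 $M(\boldsymbol g,\boldsymbol h)=0$ unless $g_i=g_j\Leftrightarrow h_i=h_j$ and $g_ig_j\in E(G)\Leftrightarrow h_ih_j\in E(H)$ for all $i,j$; and $M(\boldsymbol g,\boldsymbol h)=M(\boldsymbol g\circ\sigma,\boldsymbol h\circ\sigma)$ for all $\sigma\in\mathfrak S_{2t}$. 3. There is a level-$t$ DNN-isomorphism map from $G$ to $H$: a linear map $\Phi\colon\mathbb C^{V(G)^t\times V(G)^t}\to\mathbb C^{V(H)^t\times V(H)^t}$ such that $\mathrm{id}_r\otimes\Phi$ maps DNN matrices to DNN matrices for all $r\in\mathbb N$; $\Phi(\boldsymbol A_G\odot X)=\boldsymbol A_H\odot\Phi(X)$ for all $\boldsymbol A\in\mathcal A_t$ and all $X$; $\Phi(J)=J=\Phi^*(J)$, where $\Phi^*$ is the adjoint with respect to $\langle A,B\rangle=\operatorname{tr}(AB^*)$; and $\Phi(X^\sigma)=\Phi(X)^\sigma$ for all $\sigma\in\mathfrak S_{2t}$ and all $X$. 4. $G$ and $H$ are $t$-equivalent: $|V(G)|=|V(H)|$ and there is a vector space isomorphism $\phi\colon\mathcal A_G^t\to\mathcal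 A_H^t$ such that $\phi(M^*)=\phi(M)^*$, $\phi(MN)=\phi(M)\phi(N)$, $\phi(M\odot N)=\phi(M)\odot\phi(N)$, $\phi(M^\sigma)=\phi(M)^\sigma$ for all $M,N\in\mathcal A^t_G$ and $\sigma\in\mathfrak S_{2t}$, $\phi(I)=I$, $\phi(J)=J$, and $\phi(\boldsymbol A_G)=\boldsymbol A_H$ for all $\boldsymbol A\in\mathcal A_t$. Here the $t$-adjacency algebra $\mathcal A_G^t\subseteq\mathbb C^{V(G)^t\times V(G)^t}$ is the smallest subalgebra that contains $I$, $J$ and $\boldsymbol A_G$ for all $\boldsymbol A\in\mathcal A_t$ and is closed under conjugate transposition, entry-wise products and the action of $\mathfrak S_{2t}$. 5. $G$ and $H$ are homomorphism indistinguishable over $\mathcal L_t^+$: $\hom(F,G)=\hom(F,H)$ for every graph $F$ underlying an element of $\mathcal L_t^+$. -/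

import Mathlib

namespace LasserreGI

open scoped Matrix ComplexOrder

/-! ## Finite graphs, possibly with loops; minors; treewidth; homomorphism counts -/

/-- A finite undirected graph without multiple edges, in which loops are allowed. -/
structure FinGraph where
  V : Type
  [finite : Finite V]
  Adj : V → V → Prop
  symm : ∀ {a b : V}, Adj a b → Adj b a

attribute [instance] FinGraph.finite

/-- The simple graph obtained by deleting all loops. -/
def FinGraph.toSimple (F : FinGraph) : SimpleGraph F.V where
  Adj a b := F.Adj a b ∧ a ≠ b
  symm := ⟨fun _ _ h => ⟨F.symm h.1, h.2.symm⟩⟩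
  loopless := ⟨fun _ h => h.2 rfl⟩

/-- `F` and `F'` are isomorphic graphs. -/
def FinGraph.IsIso (F F' : FinGraph) : Prop :=
  ∃ e : F.V ≃ F'.V, ∀ a b, F.Adj a b ↔ F'.Adj (e a) (e b)

/-- `M` is (isomorphic to) a minor of `F`: it arises from `F` by deleting vertices, deleting edges
and contracting edges. The branch set of `x` is `f ⁻¹' {some x}`, the vertices that are contracted
to `x`; the vertices in `f ⁻¹' {none}` are deleted. Parallel edges that arise from a contraction are
merged and a contracted edge leaves no loop, so that a loop of `M` comes from a loop of `F`. -/
def FinGraph.IsMinor (M F : FinGraph) : Prop :=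
  ∃ f : F.V → Option M.V,
    (∀ x : M.V, (F.toSimple.induce {a | f a = some x}).Connected) ∧
    ∀ x y : M.V, M.Adj x y →
      ∃ a b : F.V, f a = some x ∧ f b = some y ∧ F.Adj a b ∧ (x = y → a = b)

/-- A class of graphs is minor-closed if every minor (with at least one vertex) of a member is
a member. -/
def MinorClosed (C : Set FinGraph) : Prop :=
  ∀ F ∈ C, ∀ M : FinGraph, Nonempty M.V → M.IsMinor F → M ∈ C

/-- `F` has a tree decomposition of width at most `k`, i.e. with bags of size at most `k + 1`. -/
def FinGraph.TreewidthLE (F : FinGraph) (k : ℕ) : Prop :=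
  ∃ (N : Type) (_ : Finite N) (T : SimpleGraph N) (β : N → Set F.V),
    T.IsTree ∧
    (⋃ s, β s) = Set.univ ∧
    (∀ a b, F.Adj a b → ∃ s, a ∈ β s ∧ b ∈ β s) ∧
    (∀ a, (T.induce {s | a ∈ β s}).Connected) ∧
    ∀ s, (β s).ncard ≤ k + 1

/-- The number of homomorphisms from `F` to the simple graph `G`. -/
noncomputable def homCount (F : FinGraph) {V : Type*} (G : SimpleGraph V) : ℕ :=
  Nat.card {h : F.V → V // ∀ a b, F.Adj a b → G.Adj (h a) (h b)}

/-- Homomorphism indistinguishability over the class `C`. -/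
def HomIndist (C : Set FinGraph) {V W : Type*} (G : SimpleGraph V) (H : SimpleGraph W) : Prop :=
  ∀ F ∈ C, homCount F G = homCount F H

/-! ## Bilabelled graphs -/

/-- The set of the `2t` label positions: `Sum.inl i` is the `i`-th in-label and `Sum.inr i` is the
`i`-th out-label. -/
abbrev Pos (t : ℕ) : Type := Fin t ⊕ Fin t

/-- A `(t,t)`-bilabelled graph; the tuple of in-labels is `lab ∘ Sum.inl` and that of out-labels
is `lab ∘ Sum.inr`. -/
structure BiGraph (t : ℕ) extends FinGraph where
  lab : Pos t → V

namespace BiGraph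

variable {t : ℕ}

/-- Isomorphism of bilabelled graphs. -/
def IsIso (F F' : BiGraph t) : Prop :=
  ∃ e : F.V ≃ F'.V, (∀ a b, F.Adj a b ↔ F'.Adj (e a) (e b)) ∧ ∀ k, e (F.lab k) = F'.lab k

/-- A bilabelled graph is atomic if all its vertices are labelled. -/
def Atomic (F : BiGraph t) : Prop := Function.Surjective F.lab

/-- Adjacency in the disjoint union of two graphs. -/
def unionAdj (F F' : FinGraph) : F.V ⊕ F'.V → F.V ⊕ F'.V → Prop
  | .inl a, .inl b => F.Adj a b
  | .inr a, .inr b => F'.Adj a b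
  | _, _ => False

/-- The graph obtained from the disjoint union of `F` and `F'` by identifying vertices along the
equivalence relation generated by `r`. -/
def glue (F F' : FinGraph) (r : F.V ⊕ F'.V → F.V ⊕ F'.V → Prop) : FinGraph where
  V := Quot r
  Adj p q := ∃ a b, Quot.mk r a = p ∧ Quot.mk r b = q ∧ unionAdj F F' a b
  symm := by
    rintro _ _ ⟨a, b, rfl, rfl, h⟩
    refine ⟨b, a, rfl, rfl, ?_⟩
    cases a <;> cases b <;> first | exact h.elim | exact FinGraph.symm _ h

/-- For series composition, the `i`-th out-label of `F` is identified with the `i`-th in-label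
of `F'`. -/
def seriesRel (F F' : BiGraph t) (a b : F.V ⊕ F'.V) : Prop :=
  ∃ i : Fin t, a = .inl (F.lab (.inr i)) ∧ b = .inr (F'.lab (.inl i))

/-- For parallel composition, every label of `F` is identified with the same label of `F'`. -/
def parallelRel (F F' : BiGraph t) (a b : F.V ⊕ F'.V) : Prop :=
  ∃ k : Pos t, a = .inl (F.lab k) ∧ b = .inr (F'.lab k)

/-- Series composition `F · F'`. -/
def series (F F' : BiGraph t) : BiGraph t where
  toFinGraph := glue F.toFinGraph F'.toFinGraph (seriesRel F F')
  lab := Sum.elim (fun i => Quot.mk _ (.inl (F.lab (.inl i))))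
    (fun i => Quot.mk _ (.inr (F'.lab (.inr i))))

/-- Parallel composition `F ⊙ F'`. -/
def parallel (F F' : BiGraph t) : BiGraph t where
  toFinGraph := glue F.toFinGraph F'.toFinGraph (parallelRel F F')
  lab k := Quot.mk _ (.inl (F.lab k))

/-- The action of the symmetric group on the labels. -/
def perm (σ : Equiv.Perm (Pos t)) (F : BiGraph t) : BiGraph t where
  toFinGraph := F.toFinGraph
  lab k := F.lab (σ k)

end BiGraph

/-- The class of bilabelled graphs generated by the atomic graphs under parallel
composition, series composition and permutation of the labels (up to isomorphism). -/
inductive LPlus (t : ℕ) : BiGraph t → Prop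
  | atomic {F : BiGraph t} : F.Atomic → LPlus t F
  | parallel {F F' : BiGraph t} : LPlus t F → LPlus t F' → LPlus t (F.parallel F')
  | series {F F' : BiGraph t} : LPlus t F → LPlus t F' → LPlus t (F.series F')
  | perm (σ : Equiv.Perm (Pos t)) {F : BiGraph t} : LPlus t F → LPlus t (F.perm σ)
  | iso {F F' : BiGraph t} : F.IsIso F' → LPlus t F → LPlus t F'

/-- The class of bilabelled graphs generated by the atomic graphs under parallel
composition with atomic graphs, series composition and permutation of the labels (up to
isomorphism). -/
inductive LClass (t : ℕ) : BiGraph t → Prop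
  | atomic {F : BiGraph t} : F.Atomic → LClass t F
  | parallel {A F : BiGraph t} : A.Atomic → LClass t F → LClass t (A.parallel F)
  | series {F F' : BiGraph t} : LClass t F → LClass t F' → LClass t (F.series F')
  | perm (σ : Equiv.Perm (Pos t)) {F : BiGraph t} : LClass t F → LClass t (F.perm σ)
  | iso {F F' : BiGraph t} : F.IsIso F' → LClass t F → LClass t F'

/-- The graphs underlying the elements of a class of bilabelled graphs. -/
def underlying {t : ℕ} (C : BiGraph t → Prop) : Set FinGraph :=
  {F | ∃ B : BiGraph t, C B ∧ B.toFinGraph.IsIso F}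

/-! ## Tensors -/

section Tensors

variable {t : ℕ} {V W : Type*}

/-- Tensors over `V`: matrices with rows and columns indexed by `V ^ t`. -/
abbrev Tensor (t : ℕ) (V : Type*) : Type _ := Matrix (Fin t → V) (Fin t → V) ℂ

/-- The homomorphism tensor of `F` for `G`. -/
noncomputable def homTensor (F : BiGraph t) (G : SimpleGraph V) : Tensor t V :=
  Matrix.of fun x y =>
    ((Nat.card {h : F.V → V //
      (∀ a b, F.Adj a b → G.Adj (h a) (h b)) ∧ ∀ k, h (F.lab k) = Sum.elim x y k} : ℕ) : ℂ)

/-- The action of the symmetric group on tensors by permuting the `2t` coordinates. -/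
def permTensor (σ : Equiv.Perm (Pos t)) (X : Tensor t V) : Tensor t V :=
  Matrix.of fun x y =>
    X (fun i => Sum.elim x y (σ⁻¹ (.inl i))) (fun i => Sum.elim x y (σ⁻¹ (.inr i)))

/-- The all-ones matrix. -/
def allOnes (n : Type*) : Matrix n n ℂ := Matrix.of fun _ _ => 1

/-- Doubly non-negative matrices: positive semidefinite and entry-wise non-negative. -/
def IsDNN {n R : Type*} [Ring R] [PartialOrder R] [StarRing R] (M : Matrix n n R) : Prop :=
  M.PosSemidef ∧ ∀ i j, 0 ≤ M i j

/-- `rel_G(g) = rel_H(h)`: the map sending each `g k` to `h k` preserves and reflects equality,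
adjacency and non-adjacency. -/
def SameType {κ : Type*} (G : SimpleGraph V) (H : SimpleGraph W) (g : κ → V) (h : κ → W) : Prop :=
  ∀ i j, (g i = g j ↔ h i = h j) ∧ (G.Adj (g i) (g j) ↔ H.Adj (h i) (h j))

end Tensors

/-! ## The Lasserre relaxation with non-negativity constraints -/

section Lasserre

variable {V W : Type*} [Fintype V] [Fintype W] [DecidableEq V] [DecidableEq W]

/-- The set `I` of pairs of vertices is a partial isomorphism from `G` to `H`. -/
def PartialIso (G : SimpleGraph V) (H : SimpleGraph W) (I : Finset (V × W)) : Prop :=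
  ∀ p ∈ I, ∀ q ∈ I, (p.1 = q.1 ↔ p.2 = q.2) ∧ (G.Adj p.1 q.1 ↔ H.Adj p.2 q.2)

/-- `y` is a solution of the level-`t` Lasserre relaxation for graph isomorphism with
non-negativity constraints. Only the values `y I` with `I.card ≤ 2 * t` are variables of the
system; the other values occur in no constraint. -/
structure IsLasserrePlusSolution (t : ℕ) (G : SimpleGraph V) (H : SimpleGraph W)
    (y : Finset (V × W) → ℝ) : Prop where
  psd : (Matrix.of fun I J : {I : Finset (V × W) // I.card ≤ t} =>
    y (I.1 ∪ J.1)).PosSemidef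
  sum_right : ∀ I : Finset (V × W), I.card + 2 ≤ 2 * t → ∀ g : V,
    ∑ h : W, y (I ∪ {(g, h)}) = y I
  sum_left : ∀ I : Finset (V × W), I.card + 2 ≤ 2 * t → ∀ h : W,
    ∑ g : V, y (I ∪ {(g, h)}) = y I
  not_partialIso : ∀ I : Finset (V × W), I.card ≤ 2 * t → ¬ PartialIso G H I → y I = 0
  empty : y ∅ = 1
  nonneg : ∀ I : Finset (V × W), I.card ≤ 2 * t → 0 ≤ y I

/-- Feasibility of the level-`t` Lasserre relaxation with non-negativity constraints. -/
def LasserrePlusFeasible (t : ℕ) (G : SimpleGraph V) (H : SimpleGraph W) : Prop :=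
  ∃ y : Finset (V × W) → ℝ, IsLasserrePlusSolution t G H y

/-! ## Level-`t` DNN-isomorphism -/

/-- The entry of `M` whose row is `g₁h₁ … g_t h_t` and whose column is
`g_{t+1}h_{t+1} … g_{2t}h_{2t}`. -/
def pairEntry {t : ℕ} (M : Matrix (Fin t → V × W) (Fin t → V × W) ℝ)
    (g : Pos t → V) (h : Pos t → W) : ℝ :=
  M (fun i => (g (.inl i), h (.inl i))) (fun i => (g (.inr i), h (.inr i)))

/-- The matrix `M` witnesses that `G` and `H` are level-`t` DNN-isomorphic. -/
structure IsDNNIsoMatrix (t : ℕ) (G : SimpleGraph V) (H : SimpleGraph W)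
    (M : Matrix (Fin t → V × W) (Fin t → V × W) ℝ) : Prop where
  dnn : IsDNN M
  sum_coord : ∀ (k : Pos t) (g : Pos t → V) (h : Pos t → W),
    ∑ x : V, pairEntry M (Function.update g k x) h =
      ∑ z : W, pairEntry M g (Function.update h k z)
  sum_right : ∀ g : Pos t → V, ∑ h : Pos t → W, pairEntry M g h = 1
  sum_left : ∀ h : Pos t → W, ∑ g : Pos t → V, pairEntry M g h = 1
  zero : ∀ (g : Pos t → V) (h : Pos t → W), ¬ SameType G H g h → pairEntry M g h = 0
  symm : ∀ (σ : Equiv.Perm (Pos t)) (g : Pos t → V) (h : Pos t → W),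
    pairEntry M g h = pairEntry M (fun k => g (σ k)) (fun k => h (σ k))

/-- `G` and `H` are level-`t` DNN-isomorphic. -/
def DNNIsomorphic (t : ℕ) (G : SimpleGraph V) (H : SimpleGraph W) : Prop :=
  ∃ M : Matrix (Fin t → V × W) (Fin t → V × W) ℝ, IsDNNIsoMatrix t G H M

end Lasserre

/-! ## Level-`t` DNN-isomorphism maps -/

section Maps

/-- The map `id_r ⊗ Φ`, which applies `Φ` to each block of an `r × r` block matrix. -/
def ampliation {m n : Type*} (r : ℕ) (Φ : Matrix m m ℂ →ₗ[ℂ] Matrix n n ℂ)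
    (X : Matrix (Fin r × m) (Fin r × m) ℂ) : Matrix (Fin r × n) (Fin r × n) ℂ :=
  Matrix.of fun p q => Φ (Matrix.of fun a b => X (p.1, a) (q.1, b)) p.2 q.2

/-- `Φ` is completely DNN-preserving. -/
def CompletelyDNNPreserving {m n : Type*} (Φ : Matrix m m ℂ →ₗ[ℂ] Matrix n n ℂ) : Prop :=
  ∀ (r : ℕ) (X : Matrix (Fin r × m) (Fin r × m) ℂ), IsDNN X → IsDNN (ampliation r Φ X)

/-- The adjoint of `Φ` with respect to the inner products `⟨A, B⟩ = tr (A B*)`. -/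
noncomputable def adjointMap {m n : Type*} [DecidableEq m] [Fintype n]
    (Φ : Matrix m m ℂ →ₗ[ℂ] Matrix n n ℂ) (Y : Matrix n n ℂ) : Matrix m m ℂ :=
  Matrix.of fun a b => ∑ c, ∑ d, star (Φ (Matrix.single a b 1) c d) * Y c d

theorem trace_adjointMap {m n : Type*} [DecidableEq m] [Fintype m] [Fintype n]
    (Φ : Matrix m m ℂ →ₗ[ℂ] Matrix n n ℂ) (X : Matrix m m ℂ) (Y : Matrix n n ℂ) :
    (Φ X * Yᴴ).trace = (X * (adjointMap Φ Y)ᴴ).trace := by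
  have h : Φ X = ∑ a, ∑ b, X a b • Φ (Matrix.single a b 1) := by
    conv_lhs => rw [Matrix.matrix_eq_sum_single X]
    simp only [map_sum]
    refine Finset.sum_congr rfl fun a _ => Finset.sum_congr rfl fun b _ => ?_
    rw [← map_smul, Matrix.smul_single, smul_eq_mul, mul_one]
  rw [h]
  simp only [Finset.sum_mul, Matrix.trace_sum, Matrix.smul_mul, Matrix.trace_smul]
  simp only [Matrix.trace, Matrix.diag_apply, Matrix.mul_apply, Matrix.conjTranspose_apply,
    adjointMap, Matrix.of_apply, star_sum, star_mul', star_star, smul_eq_mul]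

variable {V W : Type*} [Fintype V] [Fintype W] [DecidableEq V] [DecidableEq W]

/-- `Φ` is a level-`t` DNN-isomorphism map from `G` to `H`. -/
structure IsDNNIsoMap (t : ℕ) (G : SimpleGraph V) (H : SimpleGraph W)
    (Φ : Tensor t V →ₗ[ℂ] Tensor t W) : Prop where
  dnn : CompletelyDNNPreserving Φ
  atomic : ∀ A : BiGraph t, A.Atomic → ∀ X : Tensor t V,
    Φ (homTensor A G ⊙ X) = homTensor A H ⊙ Φ X
  map_allOnes : Φ (allOnes _) = allOnes _
  adjoint_allOnes : adjointMap Φ (allOnes _) = allOnes _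
  perm : ∀ (σ : Equiv.Perm (Pos t)) (X : Tensor t V), Φ (permTensor σ X) = permTensor σ (Φ X)

end Maps

/-! ## The `t`-adjacency algebra and `t`-equivalence -/

section Algebras

variable {V W : Type*} [Fintype V] [Fintype W] [DecidableEq V] [DecidableEq W]

/-- A (unital, self-adjoint) matrix algebra is coherent if it contains the all-ones matrix and is
closed under Schur products. It is self-symmetrical if it is closed under the action of the
symmetric group on the coordinates. -/
structure IsSelfSymmCoherent {t : ℕ} (A : StarSubalgebra ℂ (Tensor t V)) : Prop where
  allOnes_mem : allOnes _ ∈ A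
  hadamard_mem : ∀ M ∈ A, ∀ N ∈ A, M ⊙ N ∈ A
  perm_mem : ∀ (σ : Equiv.Perm (Pos t)), ∀ M ∈ A, permTensor σ M ∈ A

/-- The `t`-adjacency algebra of `G`: the smallest self-symmetrical coherent algebra that contains
the homomorphism tensors of all atomic graphs. -/
noncomputable def adjAlgebra (t : ℕ) (G : SimpleGraph V) : StarSubalgebra ℂ (Tensor t V) :=
  sInf {A | IsSelfSymmCoherent A ∧ ∀ B : BiGraph t, B.Atomic → homTensor B G ∈ A}

theorem adjAlgebra_coherent (t : ℕ) (G : SimpleGraph V) :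
    IsSelfSymmCoherent (adjAlgebra t G) where
  allOnes_mem := StarSubalgebra.mem_sInf.2 fun _ hA => hA.1.allOnes_mem
  hadamard_mem M hM N hN := StarSubalgebra.mem_sInf.2 fun A hA =>
    hA.1.hadamard_mem M (StarSubalgebra.mem_sInf.1 hM A hA) N (StarSubalgebra.mem_sInf.1 hN A hA)
  perm_mem σ M hM := StarSubalgebra.mem_sInf.2 fun A hA =>
    hA.1.perm_mem σ M (StarSubalgebra.mem_sInf.1 hM A hA)

theorem homTensor_mem_adjAlgebra {t : ℕ} (G : SimpleGraph V) {B : BiGraph t} (hB : B.Atomic) :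
    homTensor B G ∈ adjAlgebra t G :=
  StarSubalgebra.mem_sInf.2 fun _ hA => hA.2 B hB

/-- The vector space isomorphism `φ` between the `t`-adjacency algebras is a `t`-equivalence. -/
structure IsTEquivalence (t : ℕ) (G : SimpleGraph V) (H : SimpleGraph W)
    (φ : adjAlgebra t G ≃ₗ[ℂ] adjAlgebra t H) : Prop where
  map_star : ∀ M, φ (star M) = star (φ M)
  map_mul : ∀ M N, φ (M * N) = φ M * φ N
  map_one : φ 1 = 1
  map_atomic : ∀ (A : BiGraph t) (hA : A.Atomic),
    φ ⟨homTensor A G, homTensor_mem_adjAlgebra G hA⟩ =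
      ⟨homTensor A H, homTensor_mem_adjAlgebra H hA⟩
  map_allOnes : φ ⟨allOnes _, (adjAlgebra_coherent t G).allOnes_mem⟩ =
    ⟨allOnes _, (adjAlgebra_coherent t H).allOnes_mem⟩
  map_hadamard : ∀ M N : adjAlgebra t G,
    φ ⟨M.1 ⊙ N.1, (adjAlgebra_coherent t G).hadamard_mem _ M.2 _ N.2⟩ =
      ⟨(φ M).1 ⊙ (φ N).1, (adjAlgebra_coherent t H).hadamard_mem _ (φ M).2 _ (φ N).2⟩
  map_perm : ∀ (σ : Equiv.Perm (Pos t)) (M : adjAlgebra t G),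
    φ ⟨permTensor σ M.1, (adjAlgebra_coherent t G).perm_mem σ _ M.2⟩ =
      ⟨permTensor σ (φ M).1, (adjAlgebra_coherent t H).perm_mem σ _ (φ M).2⟩

/-- `G` and `H` have the same number of vertices and are `t`-equivalent. -/
def TEquivalent (t : ℕ) (G : SimpleGraph V) (H : SimpleGraph W) : Prop :=
  Fintype.card V = Fintype.card W ∧
    ∃ φ : adjAlgebra t G ≃ₗ[ℂ] adjAlgebra t H, IsTEquivalence t G H φ

end Algebras

end LasserreGI

/-! The equivalences close up as 1 ⇔ 2 ⇒ 3 ⇒ 4 ⇒ 5 ⇒ 2. The recurring tool is that a vector on which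
a positive semidefinite form vanishes lies in its kernel (`sum_eq_zero_of_posSemidef`).

1 ⇔ 2: the entry of `M` at two tuples of pairs is `y` at the set of pairs that occur in them. The
summation identities are given for `|I| ≤ 2t - 2` but needed for `|I| ≤ 2t - 1`; the kernel argument
supplies the missing size (`lasserre_sum_extend`). Conversely, an entry of `M` depends only on the
set of pairs: a repeated pair can be overwritten by any other pair present, because such an entry
equals a sum over that position (`IsDNNIsoMatrix.tupleEntry_move`, `eq_of_range_eq`).

2 ⇒ 3 ⇒ 4: `M` is the Choi matrix of `Φ`, and complete positivity is the Schur product theorem.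
Conversely, a map as in 3 has a doubly non-negative Choi matrix `N` whose blocks sum to one. Two
tensors are compatible if their entries agree on the support of `N`; this amounts to `Φ X = X'` and
`Φ* X' = X`. The point is that compatibility survives matrix multiplication (`Compat.mul`), again by
the kernel argument. The tensors compatible with members of the adjacency algebra of `H` therefore
form a self-symmetrical coherent algebra, which contains that of `G` by minimality, and `Φ`
restricts to the equivalence.

4 ⇒ 5: gluing of bilabelled graphs turns into algebra operations on homomorphism tensors, and the
count is recovered from `J F_G J = hom(F, G) J`.

5 ⇒ 2: the label-wise homomorphism counts of `LPlus` span an algebra of functions on `V^2t ⊔ W^2t`.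
Its atoms have indicator functions in the algebra, so each atom has equally many tuples over `V` and
over `W`. The matrix is `M(g, h) = 1 / |atom|` if `g` and `h` share an atom and `0` otherwise.
Counting triangles over atoms gives `M² = (K ⊗ 1) M` with a Gram matrix `K`, and this rules out
negative eigenvalues of the symmetric matrix `M` (`Matrix.IsHermitian.posSemidef_of_mul_self`).

Minors: contraction and edge deletion commute with gluing. Vertex deletion may destroy labelled
vertices, whose labels must be moved to surviving ones; edgeless atomic factors allow this
(`LPlus.move`). If no glued vertex survives, a disjoint union remains (`LPlus.disjUnion`).

Treewidth: the labelled vertices are kept in the root bag. A gluing receives a new root whose bag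
holds the labels of both factors, at most `3t` vertices in a series composition
(`RootedDecomp.glue`). -/

namespace LasserreGI

open scoped Matrix ComplexOrder

/-! ## Counting homomorphisms of labelled graphs -/

section LabelledCounts

variable {t : ℕ} {V : Type*}

/-- The number of homomorphisms from `F` to `G` that send the labels to the prescribed vertices. -/
noncomputable def labHomCount (F : BiGraph t) (G : SimpleGraph V) (g : Pos t → V) : ℕ :=
  Nat.card {h : F.V → V // (∀ a b, F.Adj a b → G.Adj (h a) (h b)) ∧ ∀ k, h (F.lab k) = g k}

theorem homTensor_apply (F : BiGraph t) (G : SimpleGraph V) (x y : Fin t → V) :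
    homTensor F G x y = (labHomCount F G (Sum.elim x y) : ℂ) := rfl

theorem labHomCount_iso {F F' : BiGraph t} (e : F.IsIso F') (G : SimpleGraph V) (g : Pos t → V) :
    labHomCount F G g = labHomCount F' G g := by
  obtain ⟨e, hadj, hlab⟩ := e
  refine Nat.card_congr ((e.arrowCongr (Equiv.refl V)).subtypeEquiv fun h => ?_)
  refine and_congr ⟨fun H a b hab => ?_, fun H a b hab => ?_⟩ (forall_congr' fun k => ?_)
  · exact H _ _ ((hadj _ _).2 (by simpa using hab))
  · simpa using H (e a) (e b) ((hadj _ _).1 hab)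
  · simp [← hlab]

theorem labHomCount_perm (σ : Equiv.Perm (Pos t)) (F : BiGraph t) (G : SimpleGraph V)
    (g : Pos t → V) : labHomCount (F.perm σ) G g = labHomCount F G (fun k => g (σ⁻¹ k)) := by
  refine Nat.card_congr (Equiv.subtypeEquivRight fun h => ?_)
  refine and_congr Iff.rfl ⟨fun H k => ?_, fun H k => ?_⟩
  · simpa [BiGraph.perm] using H (σ⁻¹ k)
  · exact (H (σ k)).trans (by simp)

theorem glue_isHom_iff {F F' : FinGraph} {r : F.V ⊕ F'.V → F.V ⊕ F'.V → Prop} {G : SimpleGraph V}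
    {h : (BiGraph.glue F F' r).V → V} :
    (∀ p q, (BiGraph.glue F F' r).Adj p q → G.Adj (h p) (h q)) ↔
      (∀ a b, F.Adj a b → G.Adj (h (Quot.mk r (.inl a))) (h (Quot.mk r (.inl b)))) ∧
      ∀ a b, F'.Adj a b → G.Adj (h (Quot.mk r (.inr a))) (h (Quot.mk r (.inr b))) := by
  constructor
  · exact fun H => ⟨fun a b hab => H _ _ ⟨_, _, rfl, rfl, hab⟩,
      fun a b hab => H _ _ ⟨_, _, rfl, rfl, hab⟩⟩
  · rintro ⟨h1, h2⟩ _ _ ⟨a | a, b | b, rfl, rfl, hab⟩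
    exacts [h1 _ _ hab, hab.elim, hab.elim, h2 _ _ hab]

/-- A homomorphism from a gluing is a pair of homomorphisms that agree on the glued vertices. Here
all of these are labelled, so agreement is automatic and the counts multiply. -/
theorem labHomCount_parallel (F F' : BiGraph t) (G : SimpleGraph V) (g : Pos t → V) :
    labHomCount (F.parallel F') G g = labHomCount F G g * labHomCount F' G g := by
  unfold labHomCount
  rw [← Nat.card_prod]
  refine Nat.card_congr
    { toFun := fun h => (⟨fun a => h.1 (Quot.mk _ (.inl a)), (glue_isHom_iff.1 h.2.1).1, h.2.2⟩,
        ⟨fun a => h.1 (Quot.mk _ (.inr a)), (glue_isHom_iff.1 h.2.1).2, fun k => ?_⟩)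
      invFun := fun h => ⟨Quot.lift (Sum.elim h.1.1 h.2.1) ?_,
        glue_isHom_iff.2 ⟨h.1.2.1, h.2.2.1⟩, h.1.2.2⟩
      left_inv := fun h => Subtype.ext (funext fun a => ?_)
      right_inv := fun h => rfl }
  · rw [← h.2.2 k]
    exact congrArg h.1 (Quot.sound ⟨k, rfl, rfl⟩).symm
  · rintro _ _ ⟨k, rfl, rfl⟩
    exact (h.1.2.2 k).trans (h.2.2.2 k).symm
  · rcases a with ⟨a | a⟩ <;> rfl

theorem labHomCount_series [Fintype V] [DecidableEq V] (F F' : BiGraph t) (G : SimpleGraph V)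
    (x z : Fin t → V) : labHomCount (F.series F') G (Sum.elim x z) =
      ∑ y, labHomCount F G (Sum.elim x y) * labHomCount F' G (Sum.elim y z) := by
  unfold labHomCount
  simp_rw [← Nat.card_prod]
  rw [← Nat.card_sigma]
  refine Nat.card_congr
    { toFun := fun h => ⟨fun i => h.1 (Quot.mk _ (.inl (F.lab (.inr i)))),
        ⟨fun a => h.1 (Quot.mk _ (.inl a)), (glue_isHom_iff.1 h.2.1).1, ?_⟩,
        ⟨fun a => h.1 (Quot.mk _ (.inr a)), (glue_isHom_iff.1 h.2.1).2, ?_⟩⟩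
      invFun := fun h => ⟨Quot.lift (Sum.elim h.2.1.1 h.2.2.1) ?_,
        glue_isHom_iff.2 ⟨h.2.1.2.1, h.2.2.2.1⟩, ?_⟩
      left_inv := fun h => Subtype.ext (funext fun a => ?_)
      right_inv := fun h => ?_ }
  · rintro (i | i)
    exacts [h.2.2 (.inl i), rfl]
  · rintro (i | i)
    exacts [congrArg h.1 (Quot.sound ⟨i, rfl, rfl⟩).symm, h.2.2 (.inr i)]
  · rintro _ _ ⟨i, rfl, rfl⟩
    exact (h.2.1.2.2 (.inr i)).trans (h.2.2.2.2 (.inl i)).symm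
  · rintro (i | i)
    exacts [h.2.1.2.2 (.inl i), h.2.2.2.2 (.inr i)]
  · rcases a with ⟨a | a⟩ <;> rfl
  · obtain ⟨y, ⟨h1, h1'⟩, h2⟩ := h
    obtain rfl : y = fun i => h1 (F.lab (.inr i)) := funext fun i => (h1'.2 (.inr i)).symm
    rfl

theorem sum_labHomCount [Fintype V] [DecidableEq V] (F : BiGraph t) (G : SimpleGraph V) :
    ∑ g, labHomCount F G g = homCount F.toFinGraph G := by
  unfold labHomCount homCount
  rw [← Nat.card_sigma]
  exact Nat.card_congr
    { toFun := fun h => ⟨h.2.1, h.2.2.1⟩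
      invFun := fun h => ⟨fun k => h.1 (F.lab k), h.1, h.2, fun _ => rfl⟩
      left_inv := fun ⟨g, h, h1, h2⟩ => by
        obtain rfl : g = fun k => h (F.lab k) := funext fun k => (h2 k).symm
        rfl
      right_inv := fun _ => rfl }

theorem homCount_iso {F F' : FinGraph} (e : F.IsIso F') (G : SimpleGraph V) :
    homCount F G = homCount F' G := by
  obtain ⟨e, hadj⟩ := e
  refine Nat.card_congr ((e.arrowCongr (Equiv.refl V)).subtypeEquiv fun h => ?_)
  refine ⟨fun H a b hab => ?_, fun H a b hab => ?_⟩
  · exact H _ _ ((hadj _ _).2 (by simpa using hab))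
  · simpa using H (e a) (e b) ((hadj _ _).1 hab)

open Classical in
-- The labels determine the whole map, so an atomic graph only tests equalities and adjacencies
-- among the labels.
theorem labHomCount_atomic {A : BiGraph t} (hA : A.Atomic) (G : SimpleGraph V) (g : Pos t → V) :
    labHomCount A G g = if (∀ k l, A.lab k = A.lab l → g k = g l) ∧
      (∀ k l, A.Adj (A.lab k) (A.lab l) → G.Adj (g k) (g l)) then 1 else 0 := by
  have hsub : Subsingleton {h : A.V → V //
      (∀ a b, A.Adj a b → G.Adj (h a) (h b)) ∧ ∀ k, h (A.lab k) = g k} :=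
    ⟨fun h h' => Subtype.ext (funext fun a => by
      obtain ⟨k, rfl⟩ := hA a
      rw [h.2.2, h'.2.2])⟩
  unfold labHomCount
  split_ifs with hg
  · rw [Nat.card_eq_one_iff_unique]
    have hs : Function.Surjective A.lab := hA
    have hinv := Function.surjInv_eq hs
    refine ⟨hsub, ⟨fun a => g (Function.surjInv hs a), fun a b hab => hg.2 _ _ ?_,
      fun k => hg.1 _ _ (hinv _)⟩⟩
    rwa [hinv, hinv]
  · rw [Nat.card_eq_zero]
    refine Or.inl ⟨fun h => hg ⟨fun k l hkl => ?_, fun k l hkl => ?_⟩⟩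
    · rw [← h.2.2, ← h.2.2, hkl]
    · rw [← h.2.2, ← h.2.2]
      exact h.2.1 _ _ hkl

theorem labHomCount_atomic_eq {W : Type*} {A : BiGraph t} (hA : A.Atomic) {G : SimpleGraph V}
    {H : SimpleGraph W} {g : Pos t → V} {h : Pos t → W} (hgh : SameType G H g h) :
    labHomCount A G g = labHomCount A H h := by
  classical
  rw [labHomCount_atomic hA, labHomCount_atomic hA]
  simp only [fun i j => (hgh i j).1, fun i j => (hgh i j).2]

end LabelledCounts

/-! ## Closure properties of the class `LPlus` -/

section Closure

variable {t : ℕ}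

/-- A recognition principle for gluings. Injectivity is required only up to `Quot.mk r`, so the
equivalence relation generated by `r` never has to be described explicitly. -/
theorem glue_exists_equiv {F F' M : FinGraph} {r : F.V ⊕ F'.V → F.V ⊕ F'.V → Prop}
    (m : F.V ⊕ F'.V → M.V) (hr : ∀ a b, r a b → m a = m b)
    (hinj : ∀ a b, m a = m b → Quot.mk r a = Quot.mk r b) (hsurj : Function.Surjective m)
    (hadj : ∀ x y, M.Adj x y ↔ ∃ a b, m a = x ∧ m b = y ∧ BiGraph.unionAdj F F' a b) :
    ∃ e : (BiGraph.glue F F' r).V ≃ M.V,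
      (∀ a b, (BiGraph.glue F F' r).Adj a b ↔ M.Adj (e a) (e b)) ∧
      ∀ a, e (Quot.mk r a) = m a := by
  have hbij : Function.Bijective (Quot.lift m hr) := by
    refine ⟨?_, fun x => ?_⟩
    · rintro ⟨a⟩ ⟨b⟩ h
      exact hinj a b h
    · obtain ⟨a, rfl⟩ := hsurj x
      exact ⟨Quot.mk r a, rfl⟩
  refine ⟨Equiv.ofBijective _ hbij, ?_, fun _ => rfl⟩
  rintro ⟨a⟩ ⟨b⟩
  refine Iff.trans ?_ (hadj _ _).symm
  constructor
  · rintro ⟨c, d, hc, hd, h⟩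
    exact ⟨c, d, congrArg (Quot.lift m hr) hc, congrArg (Quot.lift m hr) hd, h⟩
  · rintro ⟨c, d, hc, hd, h⟩
    exact ⟨c, d, hinj _ _ hc, hinj _ _ hd, h⟩

theorem LPlus.of_parallel {F F' M : BiGraph t} (hF : LPlus t F) (hF' : LPlus t F')
    (m : F.V ⊕ F'.V → M.V) (hr : ∀ k, m (.inl (F.lab k)) = m (.inr (F'.lab k)))
    (hinj : ∀ a b, m a = m b →
      Quot.mk (BiGraph.parallelRel F F') a = Quot.mk (BiGraph.parallelRel F F') b)
    (hsurj : Function.Surjective m)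
    (hadj : ∀ x y, M.Adj x y ↔
      ∃ a b, m a = x ∧ m b = y ∧ BiGraph.unionAdj F.toFinGraph F'.toFinGraph a b)
    (hlab : ∀ k, M.lab k = m (.inl (F.lab k))) : LPlus t M := by
  obtain ⟨e, he, he'⟩ := glue_exists_equiv (r := BiGraph.parallelRel F F') m
    (by rintro _ _ ⟨k, rfl, rfl⟩; exact hr k) hinj hsurj hadj
  exact .iso ⟨e, he, fun k => (he' _).trans (hlab k).symm⟩ (.parallel hF hF')

theorem LPlus.of_series {F F' M : BiGraph t} (hF : LPlus t F) (hF' : LPlus t F')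
    (m : F.V ⊕ F'.V → M.V)
    (hr : ∀ i, m (.inl (F.lab (.inr i))) = m (.inr (F'.lab (.inl i))))
    (hinj : ∀ a b, m a = m b →
      Quot.mk (BiGraph.seriesRel F F') a = Quot.mk (BiGraph.seriesRel F F') b)
    (hsurj : Function.Surjective m)
    (hadj : ∀ x y, M.Adj x y ↔
      ∃ a b, m a = x ∧ m b = y ∧ BiGraph.unionAdj F.toFinGraph F'.toFinGraph a b)
    (hin : ∀ i, M.lab (.inl i) = m (.inl (F.lab (.inl i))))
    (hout : ∀ i, M.lab (.inr i) = m (.inr (F'.lab (.inr i)))) : LPlus t M := by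
  obtain ⟨e, he, he'⟩ := glue_exists_equiv (r := BiGraph.seriesRel F F') m
    (by rintro _ _ ⟨k, rfl, rfl⟩; exact hr k) hinj hsurj hadj
  refine .iso ⟨e, he, ?_⟩ (.series hF hF')
  rintro (i | i)
  exacts [(he' _).trans (hin i).symm, (he' _).trans (hout i).symm]

/-- The graph without edges. -/
def FinGraph.edgeless (α : Type) [Finite α] : FinGraph where
  V := α
  Adj _ _ := False
  symm := id

/-- The edgeless atomic graph whose vertices are the values of `l`. -/
def edgelessAtomic {α : Type} (l : Pos t → α) : BiGraph t :=
  ⟨.edgeless (Set.range l), Set.rangeFactorization l⟩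

theorem LPlus.edgelessAtomic {α : Type} (l : Pos t → α) : LPlus t (edgelessAtomic l) :=
  .atomic Set.rangeFactorization_surjective

/-- Labelled vertices may be identified with each other. -/
theorem LPlus.identify {F M : BiGraph t} (hF : LPlus t F) (m : F.V → M.V)
    (hsurj : Function.Surjective m)
    (hinj : ∀ a b, m a = m b → a = b ∨ ∃ k l, a = F.lab k ∧ b = F.lab l)
    (hadj : ∀ x y, M.Adj x y ↔ ∃ a b, m a = x ∧ m b = y ∧ F.Adj a b)
    (hlab : ∀ k, M.lab k = m (F.lab k)) : LPlus t M := by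
  -- `M` is the parallel composition of `F` with the edgeless graph on the labelled vertices of `M`.
  -- Each vertex of the latter is glued to all its preimages under `m`, which carry labels by
  -- `hinj`.
  have key : ∀ (c : Set.range M.lab) (b : F.V), c = m b →
      Quot.mk (BiGraph.parallelRel (LasserreGI.edgelessAtomic M.lab) F) (.inl c) =
        Quot.mk _ (.inr b) := by
    rintro ⟨_, k, rfl⟩ b hc
    have hb : ∃ l, b = F.lab l := by
      rcases hinj _ _ ((hlab k).symm.trans hc) with h | ⟨_, l, _, h⟩
      exacts [⟨k, h.symm⟩, ⟨l, h⟩]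
    obtain ⟨l, rfl⟩ := hb
    refine Quot.sound ⟨l, ?_, rfl⟩
    exact congrArg Sum.inl (Subtype.ext (hc.trans (hlab l).symm))
  refine LPlus.of_parallel (LPlus.edgelessAtomic M.lab) hF (Sum.elim Subtype.val m) hlab ?_
    (fun x => ?_) (fun x y => (hadj x y).trans ⟨?_, ?_⟩) (fun _ => rfl)
  · rintro (c | a) (d | b) h
    · exact congrArg _ (congrArg _ (Subtype.ext h))
    · exact key c b h
    · exact (key d a h.symm).symm
    · rcases hinj a b h with rfl | ⟨k, l, rfl, rfl⟩
      · rfl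
      · rw [← key ⟨_, k, rfl⟩ (F.lab k) (hlab k), ← key ⟨_, l, rfl⟩ (F.lab l) (hlab l)]
        refine congrArg _ (congrArg _ (Subtype.ext ?_))
        exact (hlab k).trans (h.trans (hlab l).symm)
  · obtain ⟨a, rfl⟩ := hsurj x
    exact ⟨.inr a, rfl⟩
  · rintro ⟨a, b, ha, hb, h⟩
    exact ⟨.inr a, .inr b, ha, hb, h⟩
  · rintro ⟨a | a, b | b, ha, hb, h⟩
    exacts [h.elim, h.elim, h.elim, ⟨a, b, ha, hb, h⟩]

/-- Out-labels may be moved to other out-labelled vertices or to new isolated vertices. -/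
theorem LPlus.relabel_out {F M : BiGraph t} (hF : LPlus t F) (m : F.V → M.V)
    (hinj : Function.Injective m)
    (hadj : ∀ x y, M.Adj x y ↔ ∃ a b, m a = x ∧ m b = y ∧ F.Adj a b)
    (hin : ∀ i, M.lab (.inl i) = m (F.lab (.inl i)))
    (hout : ∀ j a, M.lab (.inr j) = m a → ∃ i, a = F.lab (.inr i))
    (hsurj : ∀ x, (∃ a, m a = x) ∨ ∃ j, x = M.lab (.inr j)) : LPlus t M := by
  -- The edgeless second factor takes the old out-labelled vertices as in-labels and the new ones as
  -- out-labels.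
  let l : Pos t → M.V := Sum.elim (fun i => m (F.lab (.inr i))) (fun j => M.lab (.inr j))
  have key : ∀ (c : Set.range l) (b : F.V), m b = c →
      Quot.mk (BiGraph.seriesRel F (LasserreGI.edgelessAtomic l)) (.inl b) =
        Quot.mk _ (.inr c) := by
    rintro ⟨_, k, rfl⟩ b hc
    have hb : ∃ i, b = F.lab (.inr i) := by
      rcases k with i | j
      exacts [⟨i, hinj hc⟩, hout j b hc.symm]
    obtain ⟨i, rfl⟩ := hb
    exact Quot.sound ⟨i, rfl, congrArg Sum.inr (Subtype.ext hc.symm)⟩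
  refine LPlus.of_series hF (LPlus.edgelessAtomic l) (Sum.elim m Subtype.val) (fun _ => rfl) ?_
    (fun x => ?_) (fun x y => (hadj x y).trans ⟨?_, ?_⟩) hin (fun _ => rfl)
  · rintro (a | c) (b | d) h
    · exact congrArg _ (congrArg _ (hinj h))
    · exact key d a h
    · exact (key c b h.symm).symm
    · exact congrArg _ (congrArg _ (Subtype.ext h))
  · rcases hsurj x with ⟨a, rfl⟩ | ⟨j, rfl⟩
    exacts [⟨.inl a, rfl⟩, ⟨.inr ⟨_, .inr j, rfl⟩, rfl⟩]
  · rintro ⟨a, b, ha, hb, h⟩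
    exact ⟨.inl a, .inl b, ha, hb, h⟩
  · rintro ⟨a | a, b | b, ha, hb, h⟩
    exacts [⟨a, b, ha, hb, h⟩, h.elim, h.elim, h.elim]

/-- The out-labels in `D` may be moved to the vertex of a label outside of `D`. -/
theorem LPlus.move_out {F : FinGraph} {l : Pos t → F.V} (hF : LPlus t ⟨F, l⟩) (D : Set (Fin t))
    (k₀ : Pos t) (hk₀ : ∀ i ∈ D, k₀ ≠ .inr i) (l' : Pos t → F.V)
    (hin : ∀ i, l' (.inl i) = l (.inl i)) (hD : ∀ i ∈ D, l' (.inr i) = l k₀)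
    (hout : ∀ i ∉ D, l' (.inr i) = l (.inr i)) : LPlus t ⟨F, l'⟩ := by
  classical
  -- The labels in `D` are detached onto fresh isolated vertices, which are subsequently identified
  -- with the vertex of `k₀`.
  let F₁ : BiGraph t :=
    { V := F.V ⊕ D
      Adj := fun x y => ∃ a b, .inl a = x ∧ .inl b = y ∧ F.Adj a b
      symm := by rintro _ _ ⟨a, b, ha, hb, h⟩; exact ⟨b, a, hb, ha, F.symm h⟩
      lab := Sum.elim (fun i => .inl (l (.inl i)))
        (fun i => if h : i ∈ D then .inr ⟨i, h⟩ else .inl (l (.inr i))) }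
  have h₁ : LPlus t F₁ := by
    refine hF.relabel_out (M := F₁) Sum.inl Sum.inl_injective (fun _ _ => Iff.rfl)
      (fun _ => rfl) (fun j a h => ?_) ?_
    · by_cases hj : j ∈ D
      · simp [F₁, hj] at h
      · simp only [F₁, Sum.elim_inr, hj, dif_neg, not_false_eq_true, Sum.inl.injEq] at h
        exact ⟨j, h.symm⟩
    · rintro (a | ⟨i, hi⟩)
      · exact .inl ⟨a, rfl⟩
      · refine .inr ⟨i, ?_⟩
        simp [F₁, hi]
  have hk₁ : F₁.lab k₀ = .inl (l k₀) := by
    rcases k₀ with i | i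
    · rfl
    · have : i ∉ D := fun hi => hk₀ i hi rfl
      simp [F₁, this]
  refine h₁.identify (M := ⟨F, l'⟩) (Sum.elim id fun _ => l k₀) (fun a => ⟨.inl a, rfl⟩)
    ?_ (fun x y => ⟨fun h => ⟨.inl x, .inl y, rfl, rfl, x, y, rfl, rfl, h⟩, ?_⟩) ?_
  · have hlabD : ∀ i : D, F₁.lab (.inr i) = .inr i := fun i => by simp [F₁]
    rintro (a | i) (b | j) h
    · exact .inl (congrArg _ h)
    · obtain rfl : a = l k₀ := h
      exact .inr ⟨k₀, .inr j, hk₁.symm, (hlabD j).symm⟩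
    · obtain rfl : l k₀ = b := h
      exact .inr ⟨.inr i, k₀, (hlabD i).symm, hk₁.symm⟩
    · exact .inr ⟨.inr i, .inr j, (hlabD i).symm, (hlabD j).symm⟩
  · rintro ⟨_, _, rfl, rfl, a, b, rfl, rfl, h⟩
    exact h
  · rintro (i | i)
    · exact hin i
    · by_cases hi : i ∈ D
      · simp [F₁, hi, hD]
      · simp [F₁, hi, hout]

/-- The labels outside of `S` may be moved to the vertex of a label in `S`. -/
theorem LPlus.move {F : FinGraph} {l : Pos t → F.V} (hF : LPlus t ⟨F, l⟩) (S : Set (Pos t))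
    {k₀ : Pos t} (hk₀ : k₀ ∈ S) (l' : Pos t → F.V) (hS : ∀ k ∈ S, l' k = l k)
    (hS' : ∀ k ∉ S, l' k = l k₀) : LPlus t ⟨F, l'⟩ := by
  have swap : ∀ {l : Pos t → F.V}, LPlus t ⟨F, l⟩ → LPlus t ⟨F, l ∘ Sum.swap⟩ :=
    fun h => h.perm (Equiv.sumComm _ _)
  -- Only the out-labels are moved in `l₁`; the in-labels follow by the same argument after
  -- exchanging the two sides.
  let l₁ : Pos t → F.V := Sum.elim (fun i => l (.inl i)) (fun i => l' (.inr i))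
  have h₁ : LPlus t ⟨F, l₁⟩ :=
    hF.move_out {i | Sum.inr i ∉ S} k₀ (fun i hi h => hi (h ▸ hk₀)) l₁ (fun _ => rfl)
      (fun i hi => hS' (.inr i) hi) (fun i hi => hS (.inr i) (not_not.1 hi))
  have hl₁ : l₁ k₀ = l k₀ := by
    rcases k₀ with i | i
    exacts [rfl, hS _ hk₀]
  have h₂ : LPlus t ⟨F, l' ∘ Sum.swap⟩ := by
    refine (swap h₁).move_out {i | Sum.inl i ∉ S} k₀.swap ?_ _ (fun _ => rfl) ?_ ?_
    · rintro i hi h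
      have : k₀ = .inl i := by simpa using congrArg Sum.swap h
      exact hi (this ▸ hk₀)
    · intro i hi
      simpa [hl₁] using hS' _ hi
    · intro i hi
      exact hS _ (not_not.1 hi)
  have h₃ := swap h₂
  rwa [Function.comp_assoc, Sum.swap_swap_eq, Function.comp_id] at h₃

/-- The disjoint union of two graphs. -/
def FinGraph.disjUnion (F F' : FinGraph) : FinGraph where
  V := F.V ⊕ F'.V
  Adj := BiGraph.unionAdj F F'
  symm := by
    rintro (a | a) (b | b) h
    exacts [F.symm h, h, h, F'.symm h]

/-- The out-labels of `F` are put on fresh isolated vertices. Series composition glues these, and no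
vertex of `F` itself, to the in-labelled vertices of `F'`. -/
theorem LPlus.disjUnion {F F' : BiGraph t} (hF : LPlus t F) (hF' : LPlus t F') :
    LPlus t ⟨F.toFinGraph.disjUnion F'.toFinGraph,
      Sum.elim (fun i => .inl (F.lab (.inl i))) (fun i => .inr (F'.lab (.inr i)))⟩ := by
  let F₁ : BiGraph t :=
    { V := F.V ⊕ Fin t
      Adj := fun x y => ∃ a b, .inl a = x ∧ .inl b = y ∧ F.Adj a b
      symm := by rintro _ _ ⟨a, b, ha, hb, h⟩; exact ⟨b, a, hb, ha, F.symm h⟩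
      lab := Sum.elim (fun i => .inl (F.lab (.inl i))) (fun i => .inr i) }
  have h₁ : LPlus t F₁ := by
    refine hF.relabel_out (M := F₁) Sum.inl Sum.inl_injective (fun _ _ => Iff.rfl)
      (fun _ => rfl) (fun j a h => (Sum.inr_ne_inl h).elim) ?_
    rintro (a | i)
    exacts [.inl ⟨a, rfl⟩, .inr ⟨i, rfl⟩]
  let m : F₁.V ⊕ F'.V → F.V ⊕ F'.V := Sum.elim (Sum.elim .inl fun i => .inr (F'.lab (.inl i))) .inr
  -- `s` recovers the glued class of a vertex from its image under `m`, so vertices with equal image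
  -- were glued.
  let s : F.V ⊕ F'.V → Quot (BiGraph.seriesRel F₁ F') :=
    Sum.elim (fun a => Quot.mk _ (.inl (.inl a))) (fun b => Quot.mk _ (.inr b))
  have hs : ∀ x, s (m x) = Quot.mk _ x := by
    rintro ((a | i) | b)
    exacts [rfl, (Quot.sound ⟨i, rfl, rfl⟩ : _ = _).symm, rfl]
  refine h₁.of_series hF' m (fun _ => rfl)
    (fun a b h => (hs a).symm.trans ((congrArg s h).trans (hs b))) ?_ ?_
    (fun _ => rfl) (fun _ => rfl)
  · rintro (a | b)
    exacts [⟨.inl (.inl a), rfl⟩, ⟨.inr b, rfl⟩]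
  · intro x y
    constructor
    · rcases x with x | x <;> rcases y with y | y <;> intro h
      · exact ⟨.inl (.inl x), .inl (.inl y), rfl, rfl, x, y, rfl, rfl, h⟩
      · exact h.elim
      · exact h.elim
      · exact ⟨.inr x, .inr y, rfl, rfl, h⟩
    · rintro ⟨a | a, b | b, rfl, rfl, h⟩
      · obtain ⟨a, b, rfl, rfl, h⟩ := h
        exact h
      · exact h.elim
      · exact h.elim
      · exact h

end Closure

/-! ## Minors -/

section Minors

variable {t : ℕ}

/-- The graph obtained from `F` by identifying vertices along the equivalence relation generated by
`R` and keeping only the edges in `E`. -/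
def FinGraph.contract (F : FinGraph) (R E : F.V → F.V → Prop) (hE : ∀ a b, E a b → E b a) :
    FinGraph where
  V := Quot R
  Adj p q := ∃ a b, Quot.mk R a = p ∧ Quot.mk R b = q ∧ E a b
  symm := by
    rintro _ _ ⟨a, b, rfl, rfl, h⟩
    exact ⟨b, a, rfl, rfl, hE a b h⟩

/-- Contraction commutes with gluing: every pair in `R` is an edge of the gluing and hence comes
from an edge of one side, so both sides can be contracted separately. The conclusion has the shape
that `LPlus.of_parallel` and `LPlus.of_series` ask for. -/
theorem exists_contract_glue {F F' : FinGraph} {r : F.V ⊕ F'.V → F.V ⊕ F'.V → Prop}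
    {R E : Quot r → Quot r → Prop} (hE : ∀ a b, E a b → E b a)
    (hR : ∀ a b, R a b → (BiGraph.glue F F' r).Adj a b)
    (hEF : ∀ a b, E a b → (BiGraph.glue F F' r).Adj a b)
    {R₁ E₁ : F.V → F.V → Prop} {R₂ E₂ : F'.V → F'.V → Prop}
    (hE₁ : ∀ a b, E₁ a b → E₁ b a) (hE₂ : ∀ a b, E₂ a b → E₂ b a)
    (hR₁ : ∀ a b, R₁ a b ↔ F.Adj a b ∧ R (Quot.mk r (.inl a)) (Quot.mk r (.inl b)))
    (hR₂ : ∀ a b, R₂ a b ↔ F'.Adj a b ∧ R (Quot.mk r (.inr a)) (Quot.mk r (.inr b)))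
    (hE₁' : ∀ a b, E₁ a b ↔ F.Adj a b ∧ E (Quot.mk r (.inl a)) (Quot.mk r (.inl b)))
    (hE₂' : ∀ a b, E₂ a b ↔ F'.Adj a b ∧ E (Quot.mk r (.inr a)) (Quot.mk r (.inr b)))
    (r' : Quot R₁ ⊕ Quot R₂ → Quot R₁ ⊕ Quot R₂ → Prop)
    (hr' : ∀ a b, r a b →
      r' (Sum.map (Quot.mk R₁) (Quot.mk R₂) a) (Sum.map (Quot.mk R₁) (Quot.mk R₂) b)) :
    ∃ m : Quot R₁ ⊕ Quot R₂ → Quot R,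
      (∀ a, m (Sum.map (Quot.mk R₁) (Quot.mk R₂) a) = Quot.mk R (Quot.mk r a)) ∧
      (∀ a b, m a = m b → Quot.mk r' a = Quot.mk r' b) ∧
      Function.Surjective m ∧
      ∀ x y, (FinGraph.contract (BiGraph.glue F F' r) R E hE).Adj x y ↔
        ∃ a b, m a = x ∧ m b = y ∧
          BiGraph.unionAdj (F.contract R₁ E₁ hE₁) (F'.contract R₂ E₂ hE₂) a b := by
  let m : Quot R₁ ⊕ Quot R₂ → Quot R :=
    Sum.elim (Quot.map (fun a => Quot.mk r (.inl a)) fun a b h => ((hR₁ a b).1 h).2)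
      (Quot.map (fun a => Quot.mk r (.inr a)) fun a b h => ((hR₂ a b).1 h).2)
  let s₀ : Quot r → Quot r' :=
    Quot.lift (fun a => Quot.mk r' (Sum.map (Quot.mk R₁) (Quot.mk R₂) a))
      fun a b h => Quot.sound (hr' a b h)
  let s : Quot R → Quot r' := Quot.lift s₀ (by
    intro p q h
    obtain ⟨a | a, b | b, rfl, rfl, hab⟩ := hR p q h
    · exact congrArg (fun x => Quot.mk r' (.inl x)) (Quot.sound ((hR₁ a b).2 ⟨hab, h⟩))
    · exact hab.elim
    · exact hab.elim
    · exact congrArg (fun x => Quot.mk r' (.inr x)) (Quot.sound ((hR₂ a b).2 ⟨hab, h⟩)))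
  have hs : ∀ x, s (m x) = Quot.mk r' x := by
    rintro (a | a) <;> induction a using Quot.ind <;> rfl
  refine ⟨m, ?_, fun a b h => (hs a).symm.trans ((congrArg s h).trans (hs b)), ?_, ?_⟩
  · rintro (a | a) <;> rfl
  · rintro ⟨⟨a | a⟩⟩
    exacts [⟨.inl (Quot.mk _ a), rfl⟩, ⟨.inr (Quot.mk _ a), rfl⟩]
  · intro x y
    constructor
    · rintro ⟨p, q, rfl, rfl, h⟩
      obtain ⟨a | a, b | b, rfl, rfl, hab⟩ := hEF p q h
      · exact ⟨.inl (Quot.mk _ a), .inl (Quot.mk _ b), rfl, rfl, a, b, rfl, rfl,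
          (hE₁' a b).2 ⟨hab, h⟩⟩
      · exact hab.elim
      · exact hab.elim
      · exact ⟨.inr (Quot.mk _ a), .inr (Quot.mk _ b), rfl, rfl, a, b, rfl, rfl,
          (hE₂' a b).2 ⟨hab, h⟩⟩
    · rintro ⟨a | a, b | b, rfl, rfl, h⟩
      · obtain ⟨a, b, rfl, rfl, h⟩ := h
        exact ⟨_, _, rfl, rfl, ((hE₁' a b).1 h).2⟩
      · exact h.elim
      · exact h.elim
      · obtain ⟨a, b, rfl, rfl, h⟩ := h
        exact ⟨_, _, rfl, rfl, ((hE₂' a b).1 h).2⟩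

/-- Edges may be contracted and deleted. -/
theorem LPlus.contract {F : BiGraph t} (hF : LPlus t F) : ∀ (R E : F.V → F.V → Prop)
    (hE : ∀ a b, E a b → E b a), (∀ a b, R a b → F.Adj a b) → (∀ a b, E a b → F.Adj a b) →
    LPlus t ⟨F.toFinGraph.contract R E hE, fun k => Quot.mk R (F.lab k)⟩ := by
  induction hF with
  | atomic hA =>
    intro R E hE _ _
    refine .atomic ?_
    rintro ⟨a⟩
    obtain ⟨k, rfl⟩ := hA a
    exact ⟨k, rfl⟩
  | @parallel F F' _ _ ih ih' =>
    intro R E hE hR hEF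
    have hE₁ : ∀ a b, (F.Adj a b ∧ E (Quot.mk _ (.inl a)) (Quot.mk _ (.inl b))) →
        (F.Adj b a ∧ E (Quot.mk _ (.inl b)) (Quot.mk _ (.inl a))) :=
      fun a b h => ⟨F.symm h.1, hE _ _ h.2⟩
    have hE₂ : ∀ a b, (F'.Adj a b ∧ E (Quot.mk _ (.inr a)) (Quot.mk _ (.inr b))) →
        (F'.Adj b a ∧ E (Quot.mk _ (.inr b)) (Quot.mk _ (.inr a))) :=
      fun a b h => ⟨F'.symm h.1, hE _ _ h.2⟩
    let B₁ : BiGraph t := ⟨F.contract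
      (fun a b => F.Adj a b ∧ R (Quot.mk _ (.inl a)) (Quot.mk _ (.inl b))) _ hE₁,
      fun k => Quot.mk _ (F.lab k)⟩
    let B₂ : BiGraph t := ⟨F'.contract
      (fun a b => F'.Adj a b ∧ R (Quot.mk _ (.inr a)) (Quot.mk _ (.inr b))) _ hE₂,
      fun k => Quot.mk _ (F'.lab k)⟩
    have h₁ : LPlus t B₁ := ih _ _ hE₁ (fun _ _ h => h.1) (fun _ _ h => h.1)
    have h₂ : LPlus t B₂ := ih' _ _ hE₂ (fun _ _ h => h.1) (fun _ _ h => h.1)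
    obtain ⟨m, hm, hinj, hsurj, hadj⟩ := exists_contract_glue hE hR hEF hE₁ hE₂
      (fun _ _ => Iff.rfl) (fun _ _ => Iff.rfl) (fun _ _ => Iff.rfl) (fun _ _ => Iff.rfl)
      (BiGraph.parallelRel B₁ B₂)
      (by rintro _ _ ⟨k, rfl, rfl⟩; exact ⟨k, rfl, rfl⟩)
    refine LPlus.of_parallel h₁ h₂ m (fun k => ?_) hinj hsurj hadj fun k => (hm (.inl _)).symm
    refine (hm (.inl _)).trans (Eq.trans ?_ (hm (.inr _)).symm)
    exact congrArg _ (Quot.sound ⟨k, rfl, rfl⟩)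
  | @series F F' _ _ ih ih' =>
    intro R E hE hR hEF
    have hE₁ : ∀ a b, (F.Adj a b ∧ E (Quot.mk _ (.inl a)) (Quot.mk _ (.inl b))) →
        (F.Adj b a ∧ E (Quot.mk _ (.inl b)) (Quot.mk _ (.inl a))) :=
      fun a b h => ⟨F.symm h.1, hE _ _ h.2⟩
    have hE₂ : ∀ a b, (F'.Adj a b ∧ E (Quot.mk _ (.inr a)) (Quot.mk _ (.inr b))) →
        (F'.Adj b a ∧ E (Quot.mk _ (.inr b)) (Quot.mk _ (.inr a))) :=
      fun a b h => ⟨F'.symm h.1, hE _ _ h.2⟩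
    let B₁ : BiGraph t := ⟨F.contract
      (fun a b => F.Adj a b ∧ R (Quot.mk _ (.inl a)) (Quot.mk _ (.inl b))) _ hE₁,
      fun k => Quot.mk _ (F.lab k)⟩
    let B₂ : BiGraph t := ⟨F'.contract
      (fun a b => F'.Adj a b ∧ R (Quot.mk _ (.inr a)) (Quot.mk _ (.inr b))) _ hE₂,
      fun k => Quot.mk _ (F'.lab k)⟩
    have h₁ : LPlus t B₁ := ih _ _ hE₁ (fun _ _ h => h.1) (fun _ _ h => h.1)
    have h₂ : LPlus t B₂ := ih' _ _ hE₂ (fun _ _ h => h.1) (fun _ _ h => h.1)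
    obtain ⟨m, hm, hinj, hsurj, hadj⟩ := exists_contract_glue hE hR hEF hE₁ hE₂
      (fun _ _ => Iff.rfl) (fun _ _ => Iff.rfl) (fun _ _ => Iff.rfl) (fun _ _ => Iff.rfl)
      (BiGraph.seriesRel B₁ B₂)
      (by rintro _ _ ⟨k, rfl, rfl⟩; exact ⟨k, rfl, rfl⟩)
    refine LPlus.of_series h₁ h₂ m (fun i => ?_) hinj hsurj hadj (fun i => (hm (.inl _)).symm)
      (fun i => (hm (.inr _)).symm)
    refine (hm (.inl _)).trans (Eq.trans ?_ (hm (.inr _)).symm)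
    exact congrArg _ (Quot.sound ⟨i, rfl, rfl⟩)
  | perm σ _ ih =>
    intro R E hE hR hEF
    exact (ih R E hE hR hEF).perm σ
  | @iso F F' e _ ih =>
    intro R E hE hR hEF
    obtain ⟨e, he, hlab⟩ := e
    refine .iso ⟨Quot.congr e fun _ _ => Iff.rfl, ?_, fun k => congrArg (Quot.mk R) (hlab k)⟩
      (ih (fun a b => R (e a) (e b)) (fun a b => E (e a) (e b)) (fun a b => hE _ _)
        (fun a b h => (he a b).2 (hR _ _ h)) (fun a b h => (he a b).2 (hEF _ _ h)))
    rintro ⟨a⟩ ⟨b⟩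
    constructor
    · rintro ⟨c, d, hc, hd, h⟩
      refine ⟨e c, e d, ?_, ?_, h⟩
      · exact congrArg (Quot.congr (rb := R) e fun _ _ => Iff.rfl) hc
      · exact congrArg (Quot.congr (rb := R) e fun _ _ => Iff.rfl) hd
    · rintro ⟨c, d, hc, hd, h⟩
      refine ⟨e.symm c, e.symm d, ?_, ?_, by simpa using h⟩
      · apply (Quot.congr (rb := R) e fun _ _ => Iff.rfl).injective
        refine Eq.trans ?_ hc
        exact congrArg (Quot.mk R) (e.apply_symm_apply c)
      · apply (Quot.congr (rb := R) e fun _ _ => Iff.rfl).injective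
        refine Eq.trans ?_ hd
        exact congrArg (Quot.mk R) (e.apply_symm_apply d)

/-- The subgraph of `F` induced by `U`. -/
def FinGraph.induce (F : FinGraph) (U : Set F.V) : FinGraph where
  V := U
  Adj a b := F.Adj a b
  symm := F.symm

end Minors

/-! ### Deletion of vertices -/

section VertexDeletion

variable {t : ℕ}

/-- A vertex and its glued partner survive or are deleted together, so deletion can be carried out
before gluing. The map `q` is the quotient map of the gluing of the restrictions, or the identity if
nothing glued survives. -/
theorem exists_induce_glue {F F' : FinGraph} {r : F.V ⊕ F'.V → F.V ⊕ F'.V → Prop}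
    (hr : ∀ a b, r a b → ∃ a' b', a = .inl a' ∧ b = .inr b') (U : Set (Quot r)) {Q : Type*}
    (q : {a : F.V | Quot.mk r (.inl a) ∈ U} ⊕ {a : F'.V | Quot.mk r (.inr a) ∈ U} → Q)
    (hq : ∀ a b ha hb, r (.inl a) (.inr b) → q (.inl ⟨a, ha⟩) = q (.inr ⟨b, hb⟩)) :
    ∃ m : {a : F.V | Quot.mk r (.inl a) ∈ U} ⊕ {a : F'.V | Quot.mk r (.inr a) ∈ U} → U,
      (∀ a, (m (.inl a) : Quot r) = Quot.mk r (.inl a)) ∧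
      (∀ a, (m (.inr a) : Quot r) = Quot.mk r (.inr a)) ∧
      (∀ a b, m a = m b → q a = q b) ∧
      Function.Surjective m ∧
      ∀ x y, ((BiGraph.glue F F' r).induce U).Adj x y ↔ ∃ a b, m a = x ∧ m b = y ∧
        BiGraph.unionAdj (F.induce {a | Quot.mk r (.inl a) ∈ U})
          (F'.induce {a | Quot.mk r (.inr a) ∈ U}) a b := by
  classical
  let m : {a : F.V | Quot.mk r (.inl a) ∈ U} ⊕ {a : F'.V | Quot.mk r (.inr a) ∈ U} → U :=
    Sum.elim (fun a => ⟨_, a.2⟩) (fun a => ⟨_, a.2⟩)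
  -- Deleted vertices take the value `none`, which lets the function descend to the whole gluing and
  -- not only to `U`.
  let o : F.V ⊕ F'.V → Option Q := Sum.elim
    (fun a => if h : Quot.mk r (.inl a) ∈ U then some (q (.inl ⟨a, h⟩)) else none)
    (fun a => if h : Quot.mk r (.inr a) ∈ U then some (q (.inr ⟨a, h⟩)) else none)
  let s : Quot r → Option Q := Quot.lift o (by
    intro a b hab
    obtain ⟨a, b, rfl, rfl⟩ := hr a b hab
    have he : Quot.mk r (.inl a) = Quot.mk r (.inr b) := Quot.sound hab
    by_cases h : Quot.mk r (.inl a) ∈ U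
    · have h' : Quot.mk r (.inr b) ∈ U := he ▸ h
      simp only [o, Sum.elim_inl, Sum.elim_inr, dif_pos h, dif_pos h']
      exact congrArg _ (hq a b h h' hab)
    · have h' : Quot.mk r (.inr b) ∉ U := he ▸ h
      simp only [o, Sum.elim_inl, Sum.elim_inr, dif_neg h, dif_neg h'])
  have hs : ∀ x, s (m x) = some (q x) := by
    rintro (a | a)
    exacts [dif_pos a.2, dif_pos a.2]
  refine ⟨m, fun _ => rfl, fun _ => rfl, fun a b h => ?_, ?_, ?_⟩
  · exact Option.some_injective _ ((hs a).symm.trans ((congrArg (fun x : U => s x) h).trans (hs b)))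
  · rintro ⟨⟨a | a⟩, ha⟩
    exacts [⟨.inl ⟨a, ha⟩, rfl⟩, ⟨.inr ⟨a, ha⟩, rfl⟩]
  · rintro ⟨x, hx⟩ ⟨y, hy⟩
    constructor
    · rintro ⟨a | a, b | b, rfl, rfl, hab⟩
      · exact ⟨.inl ⟨a, hx⟩, .inl ⟨b, hy⟩, rfl, rfl, hab⟩
      · exact hab.elim
      · exact hab.elim
      · exact ⟨.inr ⟨a, hx⟩, .inr ⟨b, hy⟩, rfl, rfl, hab⟩
    · rintro ⟨a | a, b | b, ha, hb, h⟩
      · exact ⟨_, _, congrArg Subtype.val ha, congrArg Subtype.val hb, h⟩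
      · exact h.elim
      · exact h.elim
      · exact ⟨_, _, congrArg Subtype.val ha, congrArg Subtype.val hb, h⟩

/-- Deletion of vertices in a gluing of two graphs for which no identified vertex survives. -/
theorem LPlus.exists_induce_glue_of_disjoint {F F' : BiGraph t}
    {r : F.V ⊕ F'.V → F.V ⊕ F'.V → Prop} (U : Set (Quot r)) (hU : U.Nonempty)
    (hr : ∀ a b, r a b → ∃ a' b', a = .inl a' ∧ b = .inr b' ∧ Quot.mk r (.inl a') ∉ U)
    (h₁ : ∀ U : Set F.V, U.Nonempty → ∃ l : Pos t → U,
      (∀ k, F.lab k ∈ U → (l k : F.V) = F.lab k) ∧ LPlus t ⟨F.induce U, l⟩)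
    (h₂ : ∀ U : Set F'.V, U.Nonempty → ∃ l : Pos t → U,
      (∀ k, F'.lab k ∈ U → (l k : F'.V) = F'.lab k) ∧ LPlus t ⟨F'.induce U, l⟩) :
    ∃ l : Pos t → U,
      (∀ i, Quot.mk r (.inl (F.lab (.inl i))) ∈ U →
        (l (.inl i) : Quot r) = Quot.mk r (.inl (F.lab (.inl i)))) ∧
      (∀ i, Quot.mk r (.inr (F'.lab (.inr i))) ∈ U →
        (l (.inr i) : Quot r) = Quot.mk r (.inr (F'.lab (.inr i)))) ∧
      LPlus t ⟨(BiGraph.glue F.toFinGraph F'.toFinGraph r).induce U, l⟩ := by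
  obtain ⟨m, hm₁, hm₂, hinj, hsurj, hadj⟩ := exists_induce_glue (F := F.toFinGraph)
    (F' := F'.toFinGraph) (fun a b h => (hr a b h).imp fun _ h => h.imp fun _ h => ⟨h.1, h.2.1⟩)
    U id (fun a b ha hb hab => by
      obtain ⟨_, _, h, -, h'⟩ := hr _ _ hab
      cases h
      exact (h' ha).elim)
  have hinj : Function.Injective m := hinj
  -- The hypotheses on the factors need a surviving vertex, so the cases in which one factor
  -- disappears are treated separately.
  rcases Set.eq_empty_or_nonempty {a : F.V | Quot.mk r (.inl a) ∈ U} with hU₁ | hU₁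
  · have hU₁' : ∀ a, Quot.mk r (.inl a) ∉ U := fun a ha => (hU₁ ▸ ha : a ∈ (∅ : Set F.V))
    have hsurj' : Function.Surjective (m ∘ .inr) := by
      intro x
      obtain ⟨a | a, rfl⟩ := hsurj x
      exacts [(hU₁' _ a.2).elim, ⟨a, rfl⟩]
    have hU₂ : {a : F'.V | Quot.mk r (.inr a) ∈ U}.Nonempty := by
      obtain ⟨x, hx⟩ := hU
      obtain ⟨a, -⟩ := hsurj' ⟨x, hx⟩
      exact ⟨a, a.2⟩
    obtain ⟨l, hl, hlF⟩ := h₂ _ hU₂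
    refine ⟨fun k => m (.inr (l k)), fun i hi => (hU₁' _ hi).elim,
      fun i hi => (hm₂ _).trans (by rw [hl _ hi]), .iso ⟨Equiv.ofBijective (m ∘ .inr)
        ⟨hinj.comp Sum.inr_injective, hsurj'⟩, fun a b => ?_, fun k => rfl⟩ hlF⟩
    refine Iff.trans ?_ (hadj _ _).symm
    constructor
    · exact fun h => ⟨.inr a, .inr b, rfl, rfl, h⟩
    · rintro ⟨c, d, hc, hd, h⟩
      obtain rfl := hinj hc
      obtain rfl := hinj hd
      exact h
  rcases Set.eq_empty_or_nonempty {a : F'.V | Quot.mk r (.inr a) ∈ U} with hU₂ | hU₂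
  · have hU₂' : ∀ a, Quot.mk r (.inr a) ∉ U := fun a ha => (hU₂ ▸ ha : a ∈ (∅ : Set F'.V))
    have hsurj' : Function.Surjective (m ∘ .inl) := by
      intro x
      obtain ⟨a | a, rfl⟩ := hsurj x
      exacts [⟨a, rfl⟩, (hU₂' _ a.2).elim]
    obtain ⟨l, hl, hlF⟩ := h₁ _ hU₁
    refine ⟨fun k => m (.inl (l k)), fun i hi => (hm₁ _).trans (by rw [hl _ hi]),
      fun i hi => (hU₂' _ hi).elim, .iso ⟨Equiv.ofBijective (m ∘ .inl)
        ⟨hinj.comp Sum.inl_injective, hsurj'⟩, fun a b => ?_, fun k => rfl⟩ hlF⟩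
    refine Iff.trans ?_ (hadj _ _).symm
    constructor
    · exact fun h => ⟨.inl a, .inl b, rfl, rfl, h⟩
    · rintro ⟨c, d, hc, hd, h⟩
      obtain rfl := hinj hc
      obtain rfl := hinj hd
      exact h
  obtain ⟨l₁, hl₁, hlF₁⟩ := h₁ _ hU₁
  obtain ⟨l₂, hl₂, hlF₂⟩ := h₂ _ hU₂
  refine ⟨Sum.elim (fun i => m (.inl (l₁ (.inl i)))) (fun i => m (.inr (l₂ (.inr i)))),
    fun i hi => (hm₁ _).trans (by rw [hl₁ _ hi]), fun i hi => (hm₂ _).trans (by rw [hl₂ _ hi]),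
    .iso ⟨Equiv.ofBijective m ⟨hinj, hsurj⟩, fun a b => ?_, ?_⟩ (hlF₁.disjUnion hlF₂)⟩
  · refine Iff.trans ?_ (hadj _ _).symm
    constructor
    · exact fun h => ⟨a, b, rfl, rfl, h⟩
    · rintro ⟨c, d, hc, hd, h⟩
      obtain rfl := hinj hc
      obtain rfl := hinj hd
      exact h
  · rintro (i | i) <;> rfl

/-- Vertices may be deleted, provided that one vertex survives. -/
theorem LPlus.exists_induce {F : BiGraph t} (hF : LPlus t F) : ∀ U : Set F.V, U.Nonempty →
    ∃ l : Pos t → U, (∀ k, F.lab k ∈ U → (l k : F.V) = F.lab k) ∧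
      LPlus t ⟨F.toFinGraph.induce U, l⟩ := by
  classical
  induction hF with
  | @atomic F hA =>
    rintro U ⟨u, hu⟩
    have hl : ∀ k (hk : F.lab k ∈ U),
        (if h : F.lab k ∈ U then (⟨F.lab k, h⟩ : U) else ⟨u, hu⟩) = ⟨F.lab k, hk⟩ :=
      fun k hk => dif_pos hk
    refine ⟨fun k => if h : F.lab k ∈ U then ⟨F.lab k, h⟩ else ⟨u, hu⟩,
      fun k hk => congrArg Subtype.val (hl k hk), .atomic ?_⟩
    rintro ⟨a, ha⟩
    obtain ⟨k, rfl⟩ := hA a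
    exact ⟨k, hl k ha⟩
  | @parallel F F' _ _ ih ih' =>
    intro U hU
    have hglue : ∀ k, Quot.mk (BiGraph.parallelRel F F') (.inl (F.lab k)) =
        Quot.mk _ (.inr (F'.lab k)) := fun k => Quot.sound ⟨k, rfl, rfl⟩
    by_cases hk : ∃ k₀, Quot.mk (BiGraph.parallelRel F F') (.inl (F.lab k₀)) ∈ U
    · obtain ⟨k₀, hk₀⟩ := hk
      have hk₀' : Quot.mk (BiGraph.parallelRel F F') (.inr (F'.lab k₀)) ∈ U := hglue k₀ ▸ hk₀
      obtain ⟨l₁, hl₁, hlF₁⟩ := ih {a | Quot.mk _ (.inl a) ∈ U} ⟨_, hk₀⟩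
      obtain ⟨l₂, hl₂, hlF₂⟩ := ih' {a | Quot.mk _ (.inr a) ∈ U} ⟨_, hk₀'⟩
      -- Deleted labels take the place of the surviving label `k₀` in both factors. Gluing along
      -- them then repeats an identification that is made anyway.
      let j : Pos t → Pos t := fun k =>
        if Quot.mk (BiGraph.parallelRel F F') (.inl (F.lab k)) ∈ U then k else k₀
      have hj : ∀ k, Quot.mk (BiGraph.parallelRel F F') (.inl (F.lab k)) ∈ U → j k = k :=
        fun k hk => if_pos hk
      have hj' : ∀ k, Quot.mk (BiGraph.parallelRel F F') (.inl (F.lab k)) ∉ U → j k = k₀ :=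
        fun k hk => if_neg hk
      have hjU : ∀ k, Quot.mk (BiGraph.parallelRel F F') (.inl (F.lab (j k))) ∈ U := by
        intro k
        by_cases hk : Quot.mk (BiGraph.parallelRel F F') (.inl (F.lab k)) ∈ U
        · rwa [hj k hk]
        · rwa [hj' k hk]
      have H₁ := hlF₁.move {k | Quot.mk (BiGraph.parallelRel F F') (.inl (F.lab k)) ∈ U} hk₀
        (fun k => l₁ (j k)) (fun k hk => by rw [hj k hk]) (fun k hk => by rw [hj' k hk])
      have H₂ := hlF₂.move {k | Quot.mk (BiGraph.parallelRel F F') (.inl (F.lab k)) ∈ U} hk₀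
        (fun k => l₂ (j k)) (fun k hk => by rw [hj k hk]) (fun k hk => by rw [hj' k hk])
      let B₁ : BiGraph t :=
        ⟨F.induce {a | Quot.mk (BiGraph.parallelRel F F') (.inl a) ∈ U}, fun k => l₁ (j k)⟩
      let B₂ : BiGraph t :=
        ⟨F'.induce {a | Quot.mk (BiGraph.parallelRel F F') (.inr a) ∈ U}, fun k => l₂ (j k)⟩
      obtain ⟨m, hm₁, hm₂, hinj, hsurj, hadj⟩ := exists_induce_glue
        (r := BiGraph.parallelRel F F')
        (fun a b h => by obtain ⟨k, rfl, rfl⟩ := h; exact ⟨_, _, rfl, rfl⟩) U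
        (Quot.mk (BiGraph.parallelRel B₁ B₂)) (by
          rintro a b ha hb ⟨k, h, h'⟩
          cases h
          cases h'
          have hk := hj k ha
          refine Quot.sound ⟨k, congrArg Sum.inl (Subtype.ext ?_),
            congrArg Sum.inr (Subtype.ext ?_)⟩
          · exact ((congrArg (fun x => (l₁ x : F.V)) hk).trans (hl₁ k ha)).symm
          · exact ((congrArg (fun x => (l₂ x : F'.V)) hk).trans (hl₂ k hb)).symm)
      refine ⟨fun k => m (.inl (l₁ (j k))), fun k hk => ?_,
        H₁.of_parallel H₂ m (fun k => Subtype.ext ?_) hinj hsurj hadj fun _ => rfl⟩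
      · refine (hm₁ _).trans ?_
        rw [hj k hk, hl₁ k hk]
        rfl
      · refine (hm₁ _).trans (Eq.trans ?_ (hm₂ _).symm)
        rw [hl₁ _ (hjU k), hl₂ _ (show Quot.mk _ (.inr _) ∈ U from hglue (j k) ▸ hjU k)]
        exact hglue _
    · obtain ⟨l, hl₁, hl₂, hl⟩ := LPlus.exists_induce_glue_of_disjoint
        (r := BiGraph.parallelRel F F') U hU
        (by rintro _ _ ⟨k, rfl, rfl⟩; exact ⟨_, _, rfl, rfl, fun h => hk ⟨k, h⟩⟩) ih ih'
      exact ⟨l, fun k h => (hk ⟨k, h⟩).elim, hl⟩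
  | @series F F' _ _ ih ih' =>
    intro U hU
    have hglue : ∀ i, Quot.mk (BiGraph.seriesRel F F') (.inl (F.lab (.inr i))) =
        Quot.mk _ (.inr (F'.lab (.inl i))) := fun k => Quot.sound ⟨k, rfl, rfl⟩
    by_cases hi : ∃ i₀, Quot.mk (BiGraph.seriesRel F F') (.inl (F.lab (.inr i₀))) ∈ U
    · obtain ⟨i₀, hi₀⟩ := hi
      have hi₀' : Quot.mk (BiGraph.seriesRel F F') (.inr (F'.lab (.inl i₀))) ∈ U := hglue i₀ ▸ hi₀
      obtain ⟨l₁, hl₁, hlF₁⟩ := ih {a | Quot.mk _ (.inl a) ∈ U} ⟨_, hi₀⟩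
      obtain ⟨l₂, hl₂, hlF₂⟩ := ih' {a | Quot.mk _ (.inr a) ∈ U} ⟨_, hi₀'⟩
      -- All deleted labels of `F` move to its `i₀`-th out-label and those of `F'` to its `i₀`-th
      -- in-label; these two vertices are glued to each other.
      let j₁ : Pos t → Pos t := fun k =>
        if Quot.mk (BiGraph.seriesRel F F') (.inl (F.lab k)) ∈ U then k else .inr i₀
      let j₂ : Pos t → Pos t := fun k =>
        if Quot.mk (BiGraph.seriesRel F F') (.inr (F'.lab k)) ∈ U then k else .inl i₀
      have hj₁ : ∀ k, Quot.mk (BiGraph.seriesRel F F') (.inl (F.lab k)) ∈ U → j₁ k = k :=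
        fun k hk => if_pos hk
      have hj₁' : ∀ k, Quot.mk (BiGraph.seriesRel F F') (.inl (F.lab k)) ∉ U → j₁ k = .inr i₀ :=
        fun k hk => if_neg hk
      have hj₂ : ∀ k, Quot.mk (BiGraph.seriesRel F F') (.inr (F'.lab k)) ∈ U → j₂ k = k :=
        fun k hk => if_pos hk
      have hj₂' : ∀ k, Quot.mk (BiGraph.seriesRel F F') (.inr (F'.lab k)) ∉ U → j₂ k = .inl i₀ :=
        fun k hk => if_neg hk
      have H₁ := hlF₁.move {k | Quot.mk (BiGraph.seriesRel F F') (.inl (F.lab k)) ∈ U} hi₀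
        (fun k => l₁ (j₁ k)) (fun k hk => by rw [hj₁ k hk]) (fun k hk => by rw [hj₁' k hk])
      have H₂ := hlF₂.move {k | Quot.mk (BiGraph.seriesRel F F') (.inr (F'.lab k)) ∈ U} hi₀'
        (fun k => l₂ (j₂ k)) (fun k hk => by rw [hj₂ k hk]) (fun k hk => by rw [hj₂' k hk])
      let B₁ : BiGraph t :=
        ⟨F.induce {a | Quot.mk (BiGraph.seriesRel F F') (.inl a) ∈ U}, fun k => l₁ (j₁ k)⟩
      let B₂ : BiGraph t :=
        ⟨F'.induce {a | Quot.mk (BiGraph.seriesRel F F') (.inr a) ∈ U}, fun k => l₂ (j₂ k)⟩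
      obtain ⟨m, hm₁, hm₂, hinj, hsurj, hadj⟩ := exists_induce_glue
        (r := BiGraph.seriesRel F F')
        (fun a b h => by obtain ⟨k, rfl, rfl⟩ := h; exact ⟨_, _, rfl, rfl⟩) U
        (Quot.mk (BiGraph.seriesRel B₁ B₂)) (by
          rintro a b ha hb ⟨k, h, h'⟩
          cases h
          cases h'
          refine Quot.sound ⟨k, congrArg Sum.inl (Subtype.ext ?_),
            congrArg Sum.inr (Subtype.ext ?_)⟩
          · exact ((congrArg (fun x => (l₁ x : F.V)) (hj₁ _ ha)).trans (hl₁ _ ha)).symm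
          · exact ((congrArg (fun x => (l₂ x : F'.V)) (hj₂ _ hb)).trans (hl₂ _ hb)).symm)
      refine ⟨Sum.elim (fun i => m (.inl (l₁ (j₁ (.inl i))))) fun i => m (.inr (l₂ (j₂ (.inr i)))),
        ?_, H₁.of_series H₂ m (fun i => Subtype.ext ?_) hinj hsurj hadj (fun _ => rfl)
          fun _ => rfl⟩
      · rintro (i | i) hi
        · refine (hm₁ _).trans ?_
          rw [hj₁ _ hi, hl₁ _ hi]
          rfl
        · refine (hm₂ _).trans ?_
          rw [hj₂ _ hi, hl₂ _ hi]
          rfl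
      · refine (hm₁ _).trans (Eq.trans ?_ (hm₂ _).symm)
        change Quot.mk (BiGraph.seriesRel F F') (.inl (l₁ (j₁ (.inr i))).1) =
          Quot.mk _ (.inr (l₂ (j₂ (.inl i))).1)
        by_cases hi : Quot.mk (BiGraph.seriesRel F F') (.inl (F.lab (.inr i))) ∈ U
        · have hi' : Quot.mk (BiGraph.seriesRel F F') (.inr (F'.lab (.inl i))) ∈ U := hglue i ▸ hi
          rw [hj₁ _ hi, hj₂ _ hi', hl₁ _ hi, hl₂ _ hi']
          exact hglue i
        · have hi' : Quot.mk (BiGraph.seriesRel F F') (.inr (F'.lab (.inl i))) ∉ U := hglue i ▸ hi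
          rw [hj₁' _ hi, hj₂' _ hi', hl₁ _ hi₀, hl₂ _ hi₀']
          exact hglue i₀
    · obtain ⟨l, hl₁, hl₂, hl⟩ := LPlus.exists_induce_glue_of_disjoint
        (r := BiGraph.seriesRel F F') U hU
        (by rintro _ _ ⟨k, rfl, rfl⟩; exact ⟨_, _, rfl, rfl, fun h => hi ⟨k, h⟩⟩) ih ih'
      refine ⟨l, ?_, hl⟩
      rintro (i | i) h
      exacts [hl₁ i h, hl₂ i h]
  | perm σ _ ih =>
    intro U hU
    obtain ⟨l, hl, hlF⟩ := ih U hU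
    exact ⟨fun k => l (σ k), fun k hk => hl _ hk, hlF.perm σ⟩
  | @iso F F' e _ ih =>
    intro U hU
    obtain ⟨e, he, hlab⟩ := e
    obtain ⟨u, hu⟩ := hU
    obtain ⟨l, hl, hlF⟩ := ih {a | e a ∈ U} ⟨e.symm u, by simpa using hu⟩
    let e' : {a | e a ∈ U} ≃ U := e.subtypeEquiv fun _ => Iff.rfl
    refine ⟨fun k => ⟨e (l k), (l k).2⟩, fun k hk => ?_,
      .iso (F := ⟨F.induce {a | e a ∈ U}, l⟩) ⟨e', fun a b => he a.1 b.1, fun _ => rfl⟩ hlF⟩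
    have := hl k (show e (F.lab k) ∈ U by rwa [hlab])
    simp [this, hlab]

end VertexDeletion

/-- Vertices outside the branch sets are deleted, edges inside branch sets contracted, and
superfluous edges deleted. Connectedness makes the contraction classes exactly the branch sets; the
resulting labels are irrelevant. -/
theorem minorClosed_underlying_LPlus (t : ℕ) : MinorClosed (underlying (LPlus t)) := by
  rintro F ⟨B, hB, e, he⟩ M hM ⟨f, hf, hMF⟩
  let U : Set B.V := {a | ∃ x, f (e a) = some x}
  have hne : ∀ x, ∃ a : B.V, f (e a) = some x := by
    intro x
    obtain ⟨a⟩ := (hf x).nonempty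
    exact ⟨e.symm a, (congrArg f (e.apply_symm_apply a)).trans a.2⟩
  have hU : U.Nonempty := by
    obtain ⟨x⟩ := hM
    obtain ⟨a, ha⟩ := hne x
    exact ⟨a, x, ha⟩
  obtain ⟨l, -, hl⟩ := hB.exists_induce U hU
  let R : U → U → Prop := fun a b => B.Adj a b ∧ f (e a) = f (e b)
  -- The last clause prevents an edge inside a branch set from becoming a loop, unless it is a loop
  -- already.
  let E : U → U → Prop := fun a b => B.Adj a b ∧
    (∃ x y, f (e a) = some x ∧ f (e b) = some y ∧ M.Adj x y ∧ (x = y → a = b))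
  have hE : ∀ a b, E a b → E b a := by
    rintro a b ⟨h, x, y, hx, hy, hxy, hab⟩
    exact ⟨B.symm h, y, x, hy, hx, M.symm hxy, fun h => (hab h.symm).symm⟩
  have hc := hl.contract R E hE (fun _ _ h => h.1) (fun _ _ h => h.1)
  refine ⟨_, hc, ?_⟩
  choose g hg using fun a : U => a.2
  have hgR : ∀ a b, R a b → g a = g b := fun a b h =>
    Option.some_injective _ ((hg a).symm.trans (h.2.trans (hg b)))
  have hconn : ∀ a b, g a = g b → Quot.mk R a = Quot.mk R b := by
    intro a b hab
    have hreach := (hf (g a)).preconnected ⟨e a, hg a⟩ ⟨e b, hab ▸ hg b⟩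
    have key : ∀ u v, (F.toSimple.induce {c | f c = some (g a)}).Reachable u v →
        Quot.mk R ⟨e.symm u, g a, (congrArg f (e.apply_symm_apply u)).trans u.2⟩ =
          Quot.mk R ⟨e.symm v, g a, (congrArg f (e.apply_symm_apply v)).trans v.2⟩ := by
      rintro u v ⟨w⟩
      induction w with
      | nil => rfl
      | @cons u v w h _ ih =>
        refine Eq.trans (Quot.sound ⟨?_, ?_⟩) ih
        · have : F.Adj u v := h.1
          exact (he _ _).2 (by simpa using this)
        · have hu : f u = some (g a) := u.2
          have hv : f v = some (g a) := v.2
          simp [hu, hv]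
    simpa using key _ _ hreach
  refine ⟨Equiv.ofBijective (Quot.lift g hgR) ⟨?_, fun x => ?_⟩, ?_⟩
  · rintro ⟨a⟩ ⟨b⟩ h
    exact hconn a b h
  · obtain ⟨a, ha⟩ := hne x
    exact ⟨Quot.mk R ⟨a, x, ha⟩, Option.some_injective _ ((hg _).symm.trans ha)⟩
  · rintro ⟨a⟩ ⟨b⟩
    constructor
    · rintro ⟨c, d, hc, hd, h, x, y, hx, hy, hxy, -⟩
      have hc' : g c = g a := congrArg (Quot.lift g hgR) hc
      have hd' : g d = g b := congrArg (Quot.lift g hgR) hd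
      have hx' : g c = x := Option.some_injective _ ((hg _).symm.trans hx)
      have hy' : g d = y := Option.some_injective _ ((hg _).symm.trans hy)
      change M.Adj (g a) (g b)
      rwa [← hc', ← hd', hx', hy']
    · intro h
      obtain ⟨c, d, hc, hd, hcd, hcd'⟩ := hMF _ _ h
      have hc' : f (e (e.symm c)) = some (g a) :=
        (congrArg f (e.apply_symm_apply c)).trans hc
      have hd' : f (e (e.symm d)) = some (g b) :=
        (congrArg f (e.apply_symm_apply d)).trans hd
      refine ⟨⟨e.symm c, _, hc'⟩, ⟨e.symm d, _, hd'⟩, hconn _ _ ?_, hconn _ _ ?_, ?_,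
        g a, g b, hc', hd', h, fun h => Subtype.ext (congrArg e.symm (hcd' h))⟩
      · exact Option.some_injective _ ((hg _).symm.trans hc')
      · exact Option.some_injective _ ((hg _).symm.trans hd')
      · exact (he _ _).2 (by simpa using hcd)

/-! ## Treewidth -/

section Treewidth

variable {t : ℕ}

/-- The graph in which every node is joined to its parent. -/
def parentGraph {N : Type} (p : N → N) : SimpleGraph N where
  Adj a b := a ≠ b ∧ (p a = b ∨ p b = a)
  symm := ⟨fun _ _ h => ⟨h.1.symm, h.2.symm⟩⟩
  loopless := ⟨fun _ h => h.1 rfl⟩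

theorem parentGraph_adj {N : Type} {p : N → N} {d : N → ℕ} {r : N}
    (hd : ∀ n, n ≠ r → d (p n) < d n) {n : N} (hn : n ≠ r) : (parentGraph p).Adj n (p n) :=
  ⟨fun h => (hd n hn).ne (congrArg d h).symm, .inl rfl⟩

/-- Passing to parents lowers the depth and stays inside `S`, so from every node of `S` it must end
at `s`. -/
theorem parentGraph_induce_connected {N : Type} {p : N → N} {d : N → ℕ} {r : N}
    (hd : ∀ n, n ≠ r → d (p n) < d n) (S : Set N) {s : N} (hs : s ∈ S)
    (hS : ∀ n ∈ S, n ≠ s → n ≠ r ∧ p n ∈ S) : ((parentGraph p).induce S).Connected := by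
  have key : ∀ k : ℕ, ∀ n (hn : n ∈ S), d n = k →
      ((parentGraph p).induce S).Reachable ⟨n, hn⟩ ⟨s, hs⟩ := by
    intro k
    induction k using Nat.strong_induction_on with
    | _ k ih =>
      intro n hn hk
      by_cases h : n = s
      · subst h
        rfl
      · obtain ⟨hr, hp⟩ := hS n hn h
        have hadj : ((parentGraph p).induce S).Adj ⟨n, hn⟩ ⟨p n, hp⟩ := parentGraph_adj hd hr
        exact hadj.reachable.trans (ih _ (hk ▸ hd n hr) _ hp rfl)
  have : Nonempty S := ⟨⟨s, hs⟩⟩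
  exact ⟨fun a b => (key _ a a.2 rfl).trans (key _ b b.2 rfl).symm⟩

/-- The graph is connected, and joining each non-root node to its parent enumerates the edges
without repetition, because two nodes cannot be each other's parents. -/
theorem parentGraph_isTree {N : Type} [Finite N] {p : N → N} {d : N → ℕ} {r : N}
    (hr : p r = r) (hd : ∀ n, n ≠ r → d (p n) < d n) : (parentGraph p).IsTree := by
  classical
  rw [SimpleGraph.isTree_iff_connected_and_card]
  constructor
  · have h := parentGraph_induce_connected hd Set.univ (Set.mem_univ r)
      (fun n _ h => ⟨h, Set.mem_univ _⟩)
    exact (SimpleGraph.induceUnivIso _).connected_iff.1 h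
  · have hbij : Function.Bijective fun n : {n // n ≠ r} =>
        (⟨s(n.1, p n), parentGraph_adj hd n.2⟩ : (parentGraph p).edgeSet) := by
      constructor
      · rintro ⟨a, ha⟩ ⟨b, hb⟩ h
        have h' : s(a, p a) = s(b, p b) := congrArg Subtype.val h
        rw [Sym2.eq_iff] at h'
        rcases h' with ⟨h, -⟩ | ⟨h₁, h₂⟩
        · exact Subtype.ext h
        · have h1 := hd a ha
          have h2 := hd b hb
          rw [h₂] at h1
          rw [← h₁] at h2
          omega
      · rintro ⟨e, he⟩
        induction e using Sym2.ind with
        | _ a b =>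
          have hab : a ≠ b ∧ (p a = b ∨ p b = a) := he
          rcases hab with ⟨hab, rfl | rfl⟩
          · exact ⟨⟨a, by rintro rfl; exact hab hr.symm⟩, rfl⟩
          · exact ⟨⟨b, by rintro rfl; exact hab hr⟩, Subtype.ext Sym2.eq_swap⟩
    rw [← Nat.card_congr (Equiv.ofBijective _ hbij), ← Finite.card_option,
      Nat.card_congr (Equiv.optionSubtypeNe r)]

/-- `F` has a tree decomposition with bags of size at most `w`, given by parents and depths of the
nodes, for which `L` is contained in the bag of the root. -/
def RootedDecomp (F : FinGraph) (L : Set F.V) (w : ℕ) : Prop :=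
  ∃ (N : Type) (_ : Finite N) (r : N) (p : N → N) (d : N → ℕ) (β : N → Set F.V),
    p r = r ∧ (∀ n, n ≠ r → d (p n) < d n) ∧ L ⊆ β r ∧
    (∀ a, ∃ s, a ∈ β s ∧ ∀ n, a ∈ β n → n ≠ s → n ≠ r ∧ a ∈ β (p n)) ∧
    (∀ a b, F.Adj a b → ∃ s, a ∈ β s ∧ b ∈ β s) ∧
    ∀ s, (β s).ncard ≤ w

theorem RootedDecomp.treewidthLE {F : FinGraph} {L : Set F.V} {k : ℕ}
    (h : RootedDecomp F L (k + 1)) : F.TreewidthLE k := by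
  obtain ⟨N, hN, r, p, d, β, hr, hd, -, htop, hadj, hw⟩ := h
  refine ⟨N, hN, parentGraph p, β, parentGraph_isTree hr hd, ?_, hadj, fun a => ?_, hw⟩
  · refine Set.eq_univ_of_forall fun a => ?_
    obtain ⟨s, hs, -⟩ := htop a
    exact Set.mem_iUnion.2 ⟨s, hs⟩
  · obtain ⟨s, hs, h⟩ := htop a
    exact parentGraph_induce_connected hd _ hs h

theorem RootedDecomp.mono {F : FinGraph} {L L' : Set F.V} {w : ℕ} (h : RootedDecomp F L w)
    (hL : L' ⊆ L) : RootedDecomp F L' w := by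
  obtain ⟨N, hN, r, p, d, β, hr, hd, hLr, h⟩ := h
  exact ⟨N, hN, r, p, d, β, hr, hd, hL.trans hLr, h⟩

theorem RootedDecomp.iso {F F' : FinGraph} {L : Set F.V} {w : ℕ} (h : RootedDecomp F L w)
    (e : F.V ≃ F'.V) (he : ∀ a b, F.Adj a b ↔ F'.Adj (e a) (e b)) :
    RootedDecomp F' (e '' L) w := by
  obtain ⟨N, hN, r, p, d, β, hr, hd, hLr, htop, hadj, hw⟩ := h
  refine ⟨N, hN, r, p, d, fun s => e '' β s, hr, hd, Set.image_mono hLr, fun a => ?_,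
    fun a b h => ?_, fun s => (Set.ncard_image_of_injective _ e.injective).trans_le (hw s)⟩
  · obtain ⟨a, rfl⟩ := e.surjective a
    simpa [e.injective.mem_set_image] using htop a
  · obtain ⟨a, rfl⟩ := e.surjective a
    obtain ⟨b, rfl⟩ := e.surjective b
    simpa [e.injective.mem_set_image] using hadj a b ((he a b).2 h)

/-- A new root with the vertices of `Z` as its bag is placed above both old roots. Every vertex of
`Z` lies in its old root bag, so the subtrees of identified vertices are joined through the new
root. -/
theorem RootedDecomp.glue {F F' : FinGraph} {L : Set F.V} {L' : Set F'.V} {w : ℕ}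
    (h : RootedDecomp F L w) (h' : RootedDecomp F' L' w)
    (r : F.V ⊕ F'.V → F.V ⊕ F'.V → Prop) (Z : Set (F.V ⊕ F'.V))
    (hr : ∀ a b, r a b → a ∈ Z ∧ b ∈ Z) (hZL : ∀ a, .inl a ∈ Z → a ∈ L)
    (hZL' : ∀ a, .inr a ∈ Z → a ∈ L') (hw : (Quot.mk r '' Z).ncard ≤ w) :
    RootedDecomp (BiGraph.glue F F' r) (Quot.mk r '' Z) w := by
  have hmk : ∀ x y, Quot.mk r x = Quot.mk r y → x = y ∨ x ∈ Z := by
    intro x y hxy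
    by_cases hx : x ∈ Z
    · exact .inr hx
    · let s : Quot r → Prop := Quot.lift (fun z => x = z) fun a b hab =>
        propext ⟨fun h => (hx (h ▸ (hr a b hab).1)).elim, fun h => (hx (h ▸ (hr a b hab).2)).elim⟩
      have : s (Quot.mk r y) := hxy ▸ (rfl : s (Quot.mk r x))
      exact .inl this
  have hZ : ∀ x, Quot.mk r x ∈ Quot.mk r '' Z → x ∈ Z := by
    rintro x ⟨z, hz, hzx⟩
    rcases hmk x z hzx.symm with rfl | h
    exacts [hz, h]
  obtain ⟨N, hN, o, p, d, β, ho, hd, hL, htop, hadj, hβ⟩ := h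
  obtain ⟨N', hN', o', p', d', β', ho', hd', hL', htop', hadj', hβ'⟩ := h'
  classical
  let P : Option (N ⊕ N') → Option (N ⊕ N') := fun n => n.elim none
    (Sum.elim (fun n => if n = o then none else some (.inl (p n)))
      (fun n => if n = o' then none else some (.inr (p' n))))
  have hP : ∀ n, n ≠ o → P (some (.inl n)) = some (.inl (p n)) := fun n hn => if_neg hn
  have hP' : ∀ n, n ≠ o' → P (some (.inr n)) = some (.inr (p' n)) := fun n hn => if_neg hn
  have hPo : P (some (.inl o)) = none := if_pos rfl
  have hPo' : P (some (.inr o')) = none := if_pos rfl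
  let B : Option (N ⊕ N') → Set (Quot r) := fun n => n.elim (Quot.mk r '' Z)
    (Sum.elim (fun n => (fun a => Quot.mk r (.inl a)) '' β n)
      (fun n => (fun a => Quot.mk r (.inr a)) '' β' n))
  let D : Option (N ⊕ N') → ℕ := fun n => n.elim 0
    (Sum.elim (fun n => d n + 1) (fun n => d' n + 1))
  refine ⟨Option (N ⊕ N'), inferInstance, none, P, D, B, rfl, ?_, subset_rfl, ?_, ?_, ?_⟩
  · rintro (_ | n | n) hn
    · exact (hn rfl).elim
    · by_cases h : n = o
      · rw [h, hPo]
        exact Nat.succ_pos _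
      · rw [hP n h]
        exact Nat.succ_lt_succ (hd n h)
    · by_cases h : n = o'
      · rw [h, hPo']
        exact Nat.succ_pos _
      · rw [hP' n h]
        exact Nat.succ_lt_succ (hd' n h)
  · intro x
    by_cases hx : x ∈ Quot.mk r '' Z
    · refine ⟨none, hx, ?_⟩
      rintro (_ | n | n) hn hne
      · exact (hne rfl).elim
      · refine ⟨hne, ?_⟩
        obtain ⟨a, ha, rfl⟩ := hn
        by_cases hno : n = o
        · rw [hno, hPo]
          exact hx
        · obtain ⟨s, hs, hs'⟩ := htop a
          -- Since `a` lies in the bag of the old root `o`, its topmost node `s` is `o` itself.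
          have hns : n ≠ s := by
            rintro rfl
            exact (hs' o (hL (hZL a (hZ _ hx))) (Ne.symm hno)).1 rfl
          rw [hP n hno]
          exact ⟨a, (hs' n ha hns).2, rfl⟩
      · refine ⟨hne, ?_⟩
        obtain ⟨a, ha, rfl⟩ := hn
        by_cases hno : n = o'
        · rw [hno, hPo']
          exact hx
        · obtain ⟨s, hs, hs'⟩ := htop' a
          have hns : n ≠ s := by
            rintro rfl
            exact (hs' o' (hL' (hZL' a (hZ _ hx))) (Ne.symm hno)).1 rfl
          rw [hP' n hno]
          exact ⟨a, (hs' n ha hns).2, rfl⟩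
    · obtain ⟨x⟩ := x
      have hxZ : x ∉ Z := fun h => hx ⟨x, h, rfl⟩
      have heq : ∀ y, Quot.mk r y = Quot.mk r x → x = y := fun y hy =>
        (hmk x y hy.symm).resolve_right hxZ
      rcases x with a | a
      · obtain ⟨s, hs, hs'⟩ := htop a
        refine ⟨some (.inl s), ⟨a, hs, rfl⟩, ?_⟩
        rintro (_ | n | n) hn hne
        · exact (hx hn).elim
        · obtain ⟨b, hb, hba⟩ := hn
          obtain rfl := Sum.inl_injective (heq _ hba)
          obtain ⟨h1, h2⟩ := hs' n hb fun h => hne (by rw [h])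
          refine ⟨by simp, ?_⟩
          rw [hP n h1]
          exact ⟨a, h2, rfl⟩
        · obtain ⟨b, hb, hba⟩ := hn
          exact (Sum.inl_ne_inr (heq _ hba)).elim
      · obtain ⟨s, hs, hs'⟩ := htop' a
        refine ⟨some (.inr s), ⟨a, hs, rfl⟩, ?_⟩
        rintro (_ | n | n) hn hne
        · exact (hx hn).elim
        · obtain ⟨b, hb, hba⟩ := hn
          exact (Sum.inr_ne_inl (heq _ hba)).elim
        · obtain ⟨b, hb, hba⟩ := hn
          obtain rfl := Sum.inr_injective (heq _ hba)
          obtain ⟨h1, h2⟩ := hs' n hb fun h => hne (by rw [h])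
          refine ⟨by simp, ?_⟩
          rw [hP' n h1]
          exact ⟨a, h2, rfl⟩
  · rintro _ _ ⟨a | a, b | b, rfl, rfl, hab⟩
    · obtain ⟨s, ha, hb⟩ := hadj a b hab
      exact ⟨some (.inl s), ⟨a, ha, rfl⟩, ⟨b, hb, rfl⟩⟩
    · exact hab.elim
    · exact hab.elim
    · obtain ⟨s, ha, hb⟩ := hadj' a b hab
      exact ⟨some (.inr s), ⟨a, ha, rfl⟩, ⟨b, hb, rfl⟩⟩
  · rintro (_ | n | n)
    · exact hw
    · exact (Set.ncard_image_le (Set.toFinite _)).trans (hβ n)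
    · exact (Set.ncard_image_le (Set.toFinite _)).trans (hβ' n)

theorem ncard_range_le {α β : Type*} [Finite α] (f : α → β) :
    (Set.range f).ncard ≤ Nat.card α := by
  rw [← Set.image_univ, ← Set.ncard_univ]
  exact Set.ncard_image_le (Set.toFinite _)

/-- The new root bags have at most `2t` vertices for parallel composition and at most `3t` for
series composition: in-labels, glued labels and out-labels. -/
theorem LPlus.rootedDecomp {F : BiGraph t} (hF : LPlus t F) :
    RootedDecomp F.toFinGraph (Set.range F.lab) (3 * t) := by
  induction hF with
  | @atomic F hA =>
    refine ⟨Unit, inferInstance, (), id, fun _ => 0, fun _ => Set.univ, rfl, fun _ h => (h rfl).elim,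
      Set.subset_univ _, fun a => ⟨(), trivial, fun _ _ h => (h rfl).elim⟩,
      fun a b _ => ⟨(), trivial, trivial⟩, fun _ => ?_⟩
    rw [← Set.range_eq_univ.2 hA]
    refine (ncard_range_le _).trans ?_
    rw [Nat.card_eq_fintype_card, Fintype.card_sum, Fintype.card_fin]
    omega
  | @parallel F F' _ _ ih ih' =>
    refine RootedDecomp.mono (ih.glue ih' (BiGraph.parallelRel F F')
      (Set.range (Sum.map F.lab F'.lab)) ?_ ?_ ?_ ?_) ?_
    · rintro _ _ ⟨k, rfl, rfl⟩
      exact ⟨⟨.inl k, rfl⟩, ⟨.inr k, rfl⟩⟩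
    · rintro a ⟨k | k, hk⟩
      · exact ⟨k, Sum.inl_injective hk⟩
      · exact (Sum.inr_ne_inl hk).elim
    · rintro a ⟨k | k, hk⟩
      · exact (Sum.inl_ne_inr hk).elim
      · exact ⟨k, Sum.inr_injective hk⟩
    · refine (Set.ncard_le_ncard (t := Set.range fun k => Quot.mk (BiGraph.parallelRel F F')
        (.inl (F.lab k))) ?_ (Set.toFinite _)).trans ((ncard_range_le _).trans ?_)
      · rintro _ ⟨_, ⟨k | k, rfl⟩, rfl⟩
        exacts [⟨k, rfl⟩, ⟨k, Quot.sound ⟨k, rfl, rfl⟩⟩]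
      · rw [Nat.card_eq_fintype_card, Fintype.card_sum, Fintype.card_fin]
        omega
    · rintro _ ⟨k, rfl⟩
      exact ⟨_, ⟨.inl k, rfl⟩, rfl⟩
  | @series F F' _ _ ih ih' =>
    refine RootedDecomp.mono (ih.glue ih' (BiGraph.seriesRel F F')
      (Set.range (Sum.map F.lab F'.lab)) ?_ ?_ ?_ ?_) ?_
    · rintro _ _ ⟨k, rfl, rfl⟩
      exact ⟨⟨.inl (.inr k), rfl⟩, ⟨.inr (.inl k), rfl⟩⟩
    · rintro a ⟨k | k, hk⟩
      · exact ⟨k, Sum.inl_injective hk⟩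
      · exact (Sum.inr_ne_inl hk).elim
    · rintro a ⟨k | k, hk⟩
      · exact (Sum.inl_ne_inr hk).elim
      · exact ⟨k, Sum.inr_injective hk⟩
    · refine (Set.ncard_le_ncard (t := Set.range (Sum.elim
        (fun k => Quot.mk (BiGraph.seriesRel F F') (.inl (F.lab k)))
        (fun i => Quot.mk (BiGraph.seriesRel F F') (.inr (F'.lab (.inr i)))))) ?_
        (Set.toFinite _)).trans ((ncard_range_le _).trans ?_)
      · rintro _ ⟨_, ⟨k | k | k, rfl⟩, rfl⟩
        exacts [⟨.inl k, rfl⟩, ⟨.inl (.inr k), Quot.sound ⟨k, rfl, rfl⟩⟩, ⟨.inr k, rfl⟩]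
      · rw [Nat.card_eq_fintype_card, Fintype.card_sum, Fintype.card_sum, Fintype.card_fin]
        omega
    · rintro _ ⟨k | k, rfl⟩
      exacts [⟨_, ⟨.inl (.inl k), rfl⟩, rfl⟩, ⟨_, ⟨.inr (.inr k), rfl⟩, rfl⟩]
  | perm σ _ ih =>
    refine ih.mono ?_
    rintro _ ⟨k, rfl⟩
    exact ⟨σ k, rfl⟩
  | @iso F F' e _ ih =>
    obtain ⟨e, he, hlab⟩ := e
    refine (ih.iso e he).mono ?_
    rintro _ ⟨k, rfl⟩
    exact ⟨_, ⟨k, rfl⟩, hlab k⟩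

end Treewidth

theorem treewidthLE_of_mem_underlying_LPlus {t : ℕ} (ht : 1 ≤ t) {F : FinGraph}
    (hF : F ∈ underlying (LPlus t)) : F.TreewidthLE (3 * t - 1) := by
  obtain ⟨B, hB, e, he⟩ := hF
  have h := hB.rootedDecomp.iso e he
  rw [show 3 * t = (3 * t - 1) + 1 by omega] at h
  exact h.treewidthLE

theorem LClass.lPlus {t : ℕ} {B : BiGraph t} (hB : LClass t B) : LPlus t B := by
  induction hB with
  | atomic h => exact .atomic h
  | parallel hA _ ih => exact .parallel (.atomic hA) ih
  | series _ _ ih ih' => exact .series ih ih'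
  | perm σ _ ih => exact .perm σ ih
  | iso e _ ih => exact .iso e ih

/-! ## Positive semidefinite matrices -/

section PosSemidef

/-- This is the congruence `Cᴴ M C`, where the `i`-th column of `C` is the combination of the basis
vectors `e i k` with coefficients `c i k`. -/
theorem posSemidef_comb {𝕜 : Type*} [RCLike 𝕜] {n ι κ : Type*} [Fintype ι] [Fintype κ]
    {M : Matrix n n 𝕜} (hM : M.PosSemidef) (e : ι → κ → n) (c : ι → κ → 𝕜) :
    (Matrix.of fun i j => ∑ k, ∑ l, star (c i k) * M (e i k) (e j l) * c j l).PosSemidef := by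
  classical
  have h := (hM.submatrix fun p : ι × κ => e p.1 p.2).conjTranspose_mul_mul_same
    (Matrix.of fun (p : ι × κ) i => if p.1 = i then c i p.2 else 0)
  convert h using 1
  ext i j
  simp only [Matrix.of_apply, Matrix.mul_apply, Matrix.conjTranspose_apply, Fintype.sum_prod_type,
    Matrix.submatrix_apply, apply_ite star, star_zero, ite_mul, zero_mul, mul_ite, mul_zero,
    Finset.sum_mul]
  rw [Finset.sum_comm]
  rw [Finset.sum_eq_single j (by intro b _ hb; simp [hb]) (by simp)]
  simp only [if_true]
  refine Finset.sum_congr rfl fun l _ => ?_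
  rw [Finset.sum_comm]
  refine Finset.sum_congr rfl fun k _ => ?_
  simp

theorem posSemidef_of_eq_comb {𝕜 : Type*} [RCLike 𝕜] {n ι κ : Type*} [Fintype ι] [Fintype κ]
    {M : Matrix n n 𝕜} (hM : M.PosSemidef) (e : ι → κ → n) (c : ι → κ → 𝕜) {N : Matrix ι ι 𝕜}
    (hN : ∀ i j, N i j = ∑ k, ∑ l, star (c i k) * M (e i k) (e j l) * c j l) : N.PosSemidef := by
  rw [show N = Matrix.of _ from Matrix.ext hN]
  exact posSemidef_comb hM e c

/-- A vector with vanishing quadratic form lies in the kernel. The row `a` need not be among the `p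
i`, so it is adjoined as one more index with coefficient `0`. -/
theorem sum_eq_zero_of_posSemidef {𝕜 : Type*} [RCLike 𝕜] {n ι : Type*} [Fintype ι]
    {M : Matrix n n 𝕜} (hM : M.PosSemidef) (p : ι → n) (c : ι → 𝕜)
    (h : ∑ i, ∑ j, star (c i) * (M (p i) (p j) * c j) = 0) (a : n) : ∑ j, M a (p j) * c j = 0 := by
  have hN := hM.submatrix fun i : Option ι => i.elim a p
  have h0 := (hN.dotProduct_mulVec_zero_iff fun i => i.elim 0 c).1 (by
    simpa [dotProduct, Matrix.mulVec, Fintype.sum_option, Finset.mul_sum] using h)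
  simpa [dotProduct, Matrix.mulVec, Fintype.sum_option] using congrFun h0 none

end PosSemidef

/-! ## From the Lasserre relaxation to DNN matrices -/

theorem partialIso_image_iff {κ V W : Type*} [Fintype κ] [DecidableEq V] [DecidableEq W]
    {G : SimpleGraph V} {H : SimpleGraph W} (g : κ → V) (h : κ → W) :
    PartialIso G H (Finset.univ.image fun k => (g k, h k)) ↔ SameType G H g h := by
  simp [PartialIso, SameType]

section LasserreToDNN

/-- For `B` with at most `t - 1` elements, the vector `∑ k, e_{B ∪ {p k}} - e_B` has quadratic form
`y B - 2 y B + y B = 0`, since distinct `p k`, `p l` never occur together. It is thus in the kernel,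
and its product with the row `I \ B` is the identity for `I`. -/
theorem lasserre_sum_extend {X κ : Type*} [DecidableEq X] [Fintype κ] {t : ℕ} (ht : 1 ≤ t) {y : Finset X → ℝ}
    (psd : (Matrix.of fun I J : {I : Finset X // I.card ≤ t} => y (I.1 ∪ J.1)).PosSemidef)
    (p : κ → X) (hsum : ∀ I : Finset X, I.card + 2 ≤ 2 * t → ∑ k, y (I ∪ {p k}) = y I)
    (hzero : ∀ I : Finset X, I.card ≤ 2 * t → ∀ k l, k ≠ l → p k ∈ I → p l ∈ I → y I = 0)
    (I : Finset X) (hI : I.card + 1 ≤ 2 * t) : ∑ k, y (I ∪ {p k}) = y I := by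
  classical
  -- This size leaves room for `p k` next to `B` within the index bound `t`, while `I \ B` has at
  -- most `t` elements because `I` has at most `2t - 1`.
  obtain ⟨B, hBI, hB⟩ := Finset.exists_subset_card_eq (s := I) (n := min I.card (t - 1))
    (min_le_left _ _)
  have hBt : B.card + 1 ≤ t := by omega
  have hA : (I \ B).card ≤ t := by
    have := Finset.card_sdiff_add_card_eq_card hBI
    omega
  have hBk : ∀ k, (B ∪ {p k}).card ≤ t := fun k =>
    (Finset.card_union_le _ _).trans (by simpa using hBt)
  have hoff : ∀ k l, k ≠ l → y ((B ∪ {p k}) ∪ (B ∪ {p l})) = 0 := fun k l hkl =>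
    hzero _ ((Finset.card_union_le _ _).trans (by have := hBk k; have := hBk l; omega)) k l hkl
      (by simp) (by simp)
  have hdiag : ∀ k, ∑ l, y ((B ∪ {p k}) ∪ (B ∪ {p l})) = y (B ∪ {p k}) := by
    intro k
    rw [Finset.sum_eq_single k (fun l _ hl => hoff k l hl.symm) (by simp), Finset.union_self]
  have hBsum := hsum B (by omega)
  have h := sum_eq_zero_of_posSemidef psd
    (fun o : Option κ => o.elim ⟨B, by omega⟩ fun k => ⟨B ∪ {p k}, hBk k⟩)
    (fun o => o.elim (-1) fun _ => 1) (by
      simp only [Fintype.sum_option, Option.elim_none, Option.elim_some, Matrix.of_apply,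
        star_trivial, Finset.union_self, Finset.sum_add_distrib, mul_one, one_mul, hdiag]
      simp only [← Finset.union_assoc, Finset.union_self, hBsum]
      simp only [Finset.union_right_comm B _ B, Finset.union_self, mul_neg, mul_one,
        Finset.sum_neg_distrib, hBsum]
      rw [← Finset.mul_sum, hBsum]
      ring) ⟨I \ B, hA⟩
  simp only [Fintype.sum_option, Option.elim_none, Option.elim_some, Matrix.of_apply,
    ← Finset.union_assoc, Finset.sdiff_union_of_subset hBI] at h
  simp only [mul_one] at h
  linarith

theorem sum_image_eq_one {X : Type*} [DecidableEq X] {W : Type*} [Fintype W] {N : ℕ} {y : Finset X → ℝ} (hy : y ∅ = 1)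
    {n : ℕ} (hn : n ≤ N) (p : Fin n → W → X)
    (hsum : ∀ i, ∀ I : Finset X, I.card + 1 ≤ N → ∑ w, y (I ∪ {p i w}) = y I) :
    ∑ h : Fin n → W, y (Finset.univ.image fun i => p i (h i)) = 1 := by
  induction n with
  | zero => simpa using hy
  | succ n ih =>
    rw [← (Fin.consEquiv fun _ : Fin (n + 1) => W).sum_comp, Fintype.sum_prod_type_right,
      ← ih (by omega) (fun i => p i.succ) (fun i => hsum _)]
    refine Finset.sum_congr rfl fun h _ => ?_
    rw [← hsum 0 _ (by
      have := Finset.card_image_le (s := Finset.univ) (f := fun i : Fin n => p i.succ (h i))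
      simp only [Finset.card_univ, Fintype.card_fin] at this
      omega)]
    refine Finset.sum_congr rfl fun w _ => congrArg y ?_
    ext x
    simp only [Finset.union_singleton, Finset.mem_insert, Finset.mem_image, Finset.mem_univ,
      true_and, Fin.exists_fin_succ, Fin.consEquiv, Equiv.coe_fn_mk, Fin.cons_zero, Fin.cons_succ]
    exact or_congr_left eq_comm

theorem image_update {X κ : Type*} [DecidableEq X] [Fintype κ] [DecidableEq κ]
    (P : κ → X) (k : κ) (p : X) :
    Finset.univ.image (Function.update P k p) = (Finset.univ.erase k).image P ∪ {p} := by
  ext x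
  simp only [Finset.mem_image, Finset.mem_univ, true_and, Finset.mem_union, Finset.mem_erase,
    Finset.mem_singleton, and_true]
  constructor
  · rintro ⟨a, rfl⟩
    by_cases ha : a = k
    · subst ha
      simp
    · exact .inl ⟨a, ha, by simp [ha]⟩
  · rintro (⟨a, ha, rfl⟩ | rfl)
    · exact ⟨a, by simp [ha]⟩
    · exact ⟨k, by simp⟩

variable {V W : Type*} [Fintype V] [Fintype W] [DecidableEq V] [DecidableEq W]

theorem LasserrePlusFeasible.dnnIsomorphic {t : ℕ} (ht : 1 ≤ t) {G : SimpleGraph V}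
    {H : SimpleGraph W} (hf : LasserrePlusFeasible t G H) : DNNIsomorphic t G H := by
  obtain ⟨y, hy⟩ := hf
  have hright : ∀ g, ∀ I : Finset (V × W), I.card + 1 ≤ 2 * t →
      ∑ h : W, y (I ∪ {(g, h)}) = y I := fun g =>
    lasserre_sum_extend ht hy.psd (fun h => (g, h)) (fun I hI => hy.sum_right I hI g)
      fun I hI k l hkl hk hl => hy.not_partialIso I hI fun hp => hkl ((hp _ hk _ hl).1.1 rfl)
  have hleft : ∀ h, ∀ I : Finset (V × W), I.card + 1 ≤ 2 * t →
      ∑ g : V, y (I ∪ {(g, h)}) = y I := fun h =>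
    lasserre_sum_extend ht hy.psd (fun g => (g, h)) (fun I hI => hy.sum_left I hI h)
      fun I hI k l hkl hk hl => hy.not_partialIso I hI fun hp => hkl ((hp _ hk _ hl).1.2 rfl)
  have hcard : ∀ P : Fin t → V × W, (Finset.univ.image P).card ≤ t := fun P =>
    Finset.card_image_le.trans (by simp)
  have hcard' : ∀ P : Pos t → V × W, (Finset.univ.image P).card ≤ 2 * t := fun P =>
    Finset.card_image_le.trans (by simp; omega)
  let M : Matrix (Fin t → V × W) (Fin t → V × W) ℝ := Matrix.of fun p q =>
    y (Finset.univ.image p ∪ Finset.univ.image q)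
  have hM : ∀ (g : Pos t → V) (h : Pos t → W),
      pairEntry M g h = y (Finset.univ.image fun k => (g k, h k)) := by
    intro g h
    refine congrArg y ?_
    ext x
    simp
  have e : Pos t ≃ Fin (t + t) := finSumFinEquiv
  refine ⟨M, ⟨hy.psd.submatrix fun P => ⟨Finset.univ.image P, hcard P⟩, fun p q => ?_⟩, ?_, ?_, ?_,
    ?_, ?_⟩
  · exact hy.nonneg _ ((Finset.card_union_le _ _).trans (by
      have := hcard p; have := hcard q; omega))
  · intro k g h
    -- Up to `2t - 1` pairs remain after removing position `k`, which is why the extended summation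
    -- identities are needed.
    have hI : ((Finset.univ.erase k).image fun k => (g k, h k)).card + 1 ≤ 2 * t := by
      have := Finset.card_image_le (s := Finset.univ.erase k) (f := fun k => (g k, h k))
      simp only [Finset.mem_univ, Finset.card_erase_of_mem, Finset.card_univ, Fintype.card_sum,
        Fintype.card_fin] at this
      omega
    have h1 : ∀ x, pairEntry M (Function.update g k x) h =
        y ((Finset.univ.erase k).image (fun k => (g k, h k)) ∪ {(x, h k)}) := by
      intro x
      rw [hM, ← image_update]
      congr 2
      ext l : 1
      by_cases hl : l = k
      · subst hl
        simp
      · simp [hl]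
    have h2 : ∀ z, pairEntry M g (Function.update h k z) =
        y ((Finset.univ.erase k).image (fun k => (g k, h k)) ∪ {(g k, z)}) := by
      intro x
      rw [hM, ← image_update]
      congr 2
      ext l : 1
      by_cases hl : l = k
      · subst hl
        simp
      · simp [hl]
    simp_rw [h1, h2]
    rw [hleft _ _ hI, hright _ _ hI]
  · intro g
    rw [← sum_image_eq_one hy.empty (by omega : t + t ≤ 2 * t) (fun i w => (g (e.symm i), w))
      (fun i => hright _), ← (e.arrowCongr (Equiv.refl W)).sum_comp]
    refine Finset.sum_congr rfl fun h _ => (hM g h).trans (congrArg y ?_)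
    ext x
    simp [e.symm.surjective.exists]
  · intro h
    rw [← sum_image_eq_one hy.empty (by omega : t + t ≤ 2 * t) (fun i v => (v, h (e.symm i)))
      (fun i => hleft _), ← (e.arrowCongr (Equiv.refl V)).sum_comp]
    refine Finset.sum_congr rfl fun g _ => (hM g h).trans (congrArg y ?_)
    ext x
    simp [e.symm.surjective.exists]
  · intro g h hgh
    rw [hM]
    exact hy.not_partialIso _ (hcard' _) fun hp => hgh ((partialIso_image_iff g h).1 hp)
  · intro σ g h
    rw [hM, hM]
    congr 1
    ext x
    simp only [Finset.mem_image, Finset.mem_univ, true_and]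
    exact σ.surjective.exists

end LasserreToDNN

/-! ## From DNN matrices to the Lasserre relaxation -/

section RangeInvariance

variable {X κ : Type*} [Fintype κ] [DecidableEq κ]

/-- A function of tuples that is invariant under permutations and under replacing a repeated entry
by another entry depends on the range of the tuple only. -/
theorem eq_of_range_eq {R : Type*} {μ : (κ → X) → R} (hperm : ∀ (σ : Equiv.Perm κ) P, μ (P ∘ σ) = μ P)
    (hmove : ∀ P k l m, l ≠ k → P k = P l → m ≠ k → μ (Function.update P k (P m)) = μ P)
    {P P' : κ → X} (h : Set.range P = Set.range P') : μ P = μ P' := by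
  classical
  -- `s` and `s'` select for each value one position at which `P` and `P'` take it, and `σ` carries
  -- the first selection to the second. The tuples `P` and `P' ∘ σ` then agree at the selected
  -- positions.
  choose s hs using fun x : Set.range P => x.2
  choose s' hs' using fun x : Set.range P => (Set.ext_iff.1 h x).1 x.2
  have hsi : Function.Injective s := fun x y hxy => Subtype.ext (by rw [← hs x, ← hs y, hxy])
  have hsi' : Function.Injective s' := fun x y hxy => Subtype.ext (by rw [← hs' x, ← hs' y, hxy])
  let σ : Equiv.Perm κ := Equiv.extendSubtype (p := (· ∈ Set.range s)) (q := (· ∈ Set.range s'))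
    ((Equiv.ofInjective s hsi).symm.trans (Equiv.ofInjective s' hsi'))
  have hσ : ∀ x, σ (s x) = s' x := by
    intro x
    refine (Equiv.extendSubtype_apply_of_mem _ _ ⟨x, rfl⟩).trans ?_
    simp [Equiv.ofInjective_symm_apply]
  rw [← hperm σ P']
  have hagree : ∀ x, P (s x) = P' (σ (s x)) := fun x => by rw [hσ, hs, hs']
  have hP : ∀ k, ∃ x, P k = P (s x) := fun k => ⟨⟨P k, k, rfl⟩, (hs ⟨P k, k, rfl⟩).symm⟩
  have hP' : ∀ k, ∃ x, P' (σ k) = P (s x) := fun k =>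
    ⟨⟨P' (σ k), (Set.ext_iff.1 h _).2 ⟨_, rfl⟩⟩,
      (hs ⟨P' (σ k), (Set.ext_iff.1 h _).2 ⟨_, rfl⟩⟩).symm⟩
  -- Unselected positions carry repeated values only, so they can be overwritten one after the other
  -- without changing `μ`.
  have key : ∀ T : Finset κ, (∀ k ∈ T, k ∉ Set.range s) → μ (T.piecewise (P' ∘ σ) P) = μ P := by
    intro T
    induction T using Finset.induction_on with
    | empty => simp
    | insert k T hk ih =>
      intro hT
      have hT' : ∀ x, s x ∉ T := fun x hx => hT _ (Finset.mem_insert_of_mem hx) ⟨x, rfl⟩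
      have hks : ∀ x, s x ≠ k := fun x hx => hT k (Finset.mem_insert_self _ _) ⟨x, hx⟩
      rw [← ih fun k hk => hT k (Finset.mem_insert_of_mem hk), Finset.piecewise_insert]
      obtain ⟨x, hx⟩ := hP k
      obtain ⟨z, hz⟩ := hP' k
      have := hmove (T.piecewise (P' ∘ σ) P) k (s x) (s z) (hks x) (by simp [hk, hT', hx]) (hks z)
      rwa [Finset.piecewise_eq_of_notMem _ _ _ (hT' z), ← hz] at this
  rw [← key (Finset.univ.filter (· ∉ Set.range s)) (by simp)]
  congr 1
  ext k
  by_cases hk : k ∈ Set.range s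
  · have hk' : k ∉ Finset.univ.filter (· ∉ Set.range s) := fun h => (Finset.mem_filter.1 h).2 hk
    rw [Finset.piecewise_eq_of_notMem _ _ _ hk']
    obtain ⟨x, rfl⟩ := hk
    exact hagree x
  · have hk' : k ∈ Finset.univ.filter (· ∉ Set.range s) :=
      Finset.mem_filter.2 ⟨Finset.mem_univ _, hk⟩
    rw [Finset.piecewise_eq_of_mem _ _ _ hk']

omit [Fintype κ] in
-- Positions outside `T` repeat values from `T`. With `T` missing one position, that position is
-- redundant and can receive a further pair.
theorem exists_image_eq [DecidableEq X] {I : Finset X} (hI : I.Nonempty) (T : Finset κ)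
    (h : I.card ≤ T.card) : ∃ P : κ → X, T.image P = I ∧ ∀ k, ∃ l ∈ T, P k = P l := by
  obtain ⟨f⟩ : Nonempty (I ↪ T) := Function.Embedding.nonempty_of_card_le (by simpa using h)
  obtain ⟨i₀, hi₀⟩ := hI
  have : Nonempty I := ⟨⟨i₀, hi₀⟩⟩
  let P : κ → X := fun k => if hk : k ∈ T then (Function.invFun f ⟨k, hk⟩ : I) else i₀
  have hPf : ∀ i : I, P (f i) = i := by
    intro i
    simp [P, Function.leftInverse_invFun f.injective i]
  have hPI : ∀ k, P k ∈ I := by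
    intro k
    by_cases hk : k ∈ T
    · simp [P, hk]
    · simpa [P, hk] using hi₀
  refine ⟨P, ?_, fun k => ⟨f ⟨P k, hPI k⟩, (f _).2, (hPf ⟨P k, hPI k⟩).symm⟩⟩
  ext x
  rw [Finset.mem_image]
  constructor
  · rintro ⟨k, -, rfl⟩
    exact hPI k
  · exact fun hx => ⟨f ⟨x, hx⟩, (f _).2, hPf ⟨x, hx⟩⟩

end RangeInvariance

/-! ### The Lasserre solution read off from a matrix -/

section DNNToLasserre

variable {t : ℕ} {V W : Type*} [Fintype V] [Fintype W]
  {G : SimpleGraph V} {H : SimpleGraph W} {M : Matrix (Fin t → V × W) (Fin t → V × W) ℝ}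

/-- The entry of `M` at a tuple of `2t` pairs. -/
def tupleEntry (M : Matrix (Fin t → V × W) (Fin t → V × W) ℝ) (P : Pos t → V × W) : ℝ :=
  M (fun i => P (.inl i)) (fun i => P (.inr i))

theorem IsDNNIsoMatrix.tupleEntry_eq_zero (hM : IsDNNIsoMatrix t G H M) {P : Pos t → V × W} (k l)
    (h : ¬ ((P k).1 = (P l).1 ↔ (P k).2 = (P l).2)) : tupleEntry M P = 0 :=
  hM.zero (fun k => (P k).1) (fun k => (P k).2) fun hs => h (hs k l).1

/-- The left side does not involve `a` and the right side does not involve `b`, so the common value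
is independent of both. -/
theorem IsDNNIsoMatrix.tupleEntry_sum (hM : IsDNNIsoMatrix t G H M) (P : Pos t → V × W) (k) (a : V)
    (b : W) : ∑ x, tupleEntry M (Function.update P k (x, b)) =
      ∑ z, tupleEntry M (Function.update P k (a, z)) := by
  have h := hM.sum_coord k (Function.update (fun k => (P k).1) k a)
    (Function.update (fun k => (P k).2) k b)
  have hfst : ∀ (p : V × W) l, (Function.update P k p l).1 =
      Function.update (fun k => (P k).1) k p.1 l := by
    intro p l
    by_cases hl : l = k
    · subst hl; simp
    · simp [hl]
  have hsnd : ∀ (p : V × W) l, (Function.update P k p l).2 =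
      Function.update (fun k => (P k).2) k p.2 l := by
    intro p l
    by_cases hl : l = k
    · subst hl; simp
    · simp [hl]
  have hent : ∀ p, tupleEntry M (Function.update P k p) =
      pairEntry M (Function.update (fun k => (P k).1) k p.1)
        (Function.update (fun k => (P k).2) k p.2) := by
    intro p
    unfold tupleEntry pairEntry
    simp_rw [← hfst, ← hsnd]
  simp_rw [hent]
  simpa using h

/-- For `a = (P l).1` only the summand `z = (P l).2` survives, since position `l` carries the same
first entry. By `tupleEntry_sum` the choice of `a` does not matter. -/
theorem IsDNNIsoMatrix.tupleEntry_eq_sum_right (hM : IsDNNIsoMatrix t G H M) {P : Pos t → V × W}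
    {k l} (hl : l ≠ k) (h : P k = P l) (a : V) :
    tupleEntry M P = ∑ z, tupleEntry M (Function.update P k (a, z)) := by
  rw [← hM.tupleEntry_sum P k a (P l).2, hM.tupleEntry_sum P k (P l).1 (P l).2,
    Finset.sum_eq_single (P l).2, Prod.mk.eta, ← h, Function.update_eq_self]
  · intro z _ hz
    refine hM.tupleEntry_eq_zero k l ?_
    simp [hl, hz]
  · simp

theorem IsDNNIsoMatrix.tupleEntry_move (hM : IsDNNIsoMatrix t G H M) (P : Pos t → V × W) (k l m)
    (hl : l ≠ k) (h : P k = P l) (hm : m ≠ k) :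
    tupleEntry M (Function.update P k (P m)) = tupleEntry M P := by
  rw [hM.tupleEntry_eq_sum_right hm (by simp [hm]) (P k).1,
    hM.tupleEntry_eq_sum_right hl h (P k).1]
  simp

variable [DecidableEq V] [DecidableEq W]

theorem IsDNNIsoMatrix.tupleEntry_eq (hM : IsDNNIsoMatrix t G H M) {P P' : Pos t → V × W}
    (h : Finset.univ.image P = Finset.univ.image P') : tupleEntry M P = tupleEntry M P' := by
  refine eq_of_range_eq (fun σ P => ?_) hM.tupleEntry_move ?_
  · exact (hM.symm σ (fun k => (P k).1) (fun k => (P k).2)).symm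
  · simpa [← Finset.coe_inj] using h

theorem card_pos (t : ℕ) : Fintype.card (Pos t) = 2 * t := by
  simp; omega

theorem DNNIsomorphic.lasserrePlusFeasible (ht : 1 ≤ t) (hG : DNNIsomorphic t G H) :
    LasserrePlusFeasible t G H := by
  classical
  obtain ⟨M, hM⟩ := hG
  let k₀ : Pos t := .inl ⟨0, ht⟩
  -- No `2t`-tuple has empty image, so the value at `∅` is prescribed. The default `0` only concerns
  -- sets with more than `2t` elements, which occur in no constraint.
  let y : Finset (V × W) → ℝ := fun I => if I = ∅ then 1 else
    if h : ∃ P : Pos t → V × W, Finset.univ.image P = I then tupleEntry M h.choose else 0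
  have hy0 : y ∅ = 1 := if_pos rfl
  have hy : ∀ P : Pos t → V × W, y (Finset.univ.image P) = tupleEntry M P := by
    intro P
    have hne : Finset.univ.image P ≠ ∅ :=
      Finset.Nonempty.ne_empty ⟨P k₀, Finset.mem_image_of_mem _ (Finset.mem_univ _)⟩
    have hex : ∃ P' : Pos t → V × W, Finset.univ.image P' = Finset.univ.image P := ⟨P, rfl⟩
    simp only [y, if_neg hne, dif_pos hex]
    exact hM.tupleEntry_eq hex.choose_spec
  have hconst : ∀ p : V × W, y {p} = tupleEntry M fun _ => p := by
    intro p
    rw [← hy]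
    congr 1
    ext x
    simp only [Finset.mem_singleton, Finset.mem_image, Finset.mem_univ, true_and]
    exact ⟨fun h => ⟨k₀, h.symm⟩, fun ⟨_, h⟩ => h.symm⟩
  have hempty_right : ∀ g : V, ∑ h : W, y (∅ ∪ {(g, h)}) = y ∅ := by
    intro g
    simp only [Finset.empty_union, hy0, hconst]
    rw [← hM.sum_right fun _ => g]
    -- In the row of a constant tuple only constant tuples have non-zero entries.
    refine Fintype.sum_of_injective (fun h _ => h) (fun h h' e => congrFun e k₀) _ _ ?_
      fun _ => rfl
    intro h hh
    refine hM.zero _ _ fun hs => hh ⟨h k₀, ?_⟩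
    ext l
    exact (hs k₀ l).1.1 rfl
  have hempty_left : ∀ h : W, ∑ g : V, y (∅ ∪ {(g, h)}) = y ∅ := by
    intro h
    simp only [Finset.empty_union, hy0, hconst]
    rw [← hM.sum_left fun _ => h]
    refine Fintype.sum_of_injective (fun h _ => h) (fun h h' e => congrFun e k₀) _ _ ?_
      fun _ => rfl
    intro g hg
    refine hM.zero _ _ fun hs => hg ⟨g k₀, ?_⟩
    ext l
    exact (hs k₀ l).1.2 rfl
  have hrep : ∀ I : Finset (V × W), I.Nonempty → I.card + 1 ≤ 2 * t → ∃ P : Pos t → V × W,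
      Finset.univ.image P = I ∧ (∃ l, l ≠ k₀ ∧ P k₀ = P l) ∧
      ∀ p, y (I ∪ {p}) = tupleEntry M (Function.update P k₀ p) := by
    intro I hI hcard
    obtain ⟨P, hP, hP'⟩ := exists_image_eq hI (Finset.univ.erase k₀) (by
      rw [Finset.card_erase_of_mem (Finset.mem_univ _), Finset.card_univ, card_pos]
      omega)
    refine ⟨P, ?_, ?_, fun p => ?_⟩
    · refine subset_antisymm ?_ (hP ▸ Finset.image_subset_image (Finset.erase_subset _ _))
      intro x hx
      obtain ⟨k, -, rfl⟩ := Finset.mem_image.1 hx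
      obtain ⟨l, hl, hkl⟩ := hP' k
      rw [hkl, ← hP]
      exact Finset.mem_image_of_mem _ hl
    · obtain ⟨l, hl, h⟩ := hP' k₀
      exact ⟨l, (Finset.mem_erase.1 hl).1, h⟩
    · rw [← hy, image_update, hP]
  have hright : ∀ I : Finset (V × W), I.card + 1 ≤ 2 * t → ∀ g : V,
      ∑ h : W, y (I ∪ {(g, h)}) = y I := by
    intro I hI g
    rcases I.eq_empty_or_nonempty with rfl | hne
    · exact hempty_right g
    · obtain ⟨P, rfl, ⟨l, hl, hlk⟩, hP⟩ := hrep I hne hI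
      simp_rw [hP, hy]
      exact (hM.tupleEntry_eq_sum_right hl hlk g).symm
  have hleft : ∀ I : Finset (V × W), I.card + 1 ≤ 2 * t → ∀ h : W,
      ∑ g : V, y (I ∪ {(g, h)}) = y I := by
    intro I hI h
    rcases I.eq_empty_or_nonempty with rfl | hne
    · exact hempty_left h
    · obtain ⟨P, rfl, ⟨l, hl, hlk⟩, hP⟩ := hrep I hne hI
      simp_rw [hP, hy]
      rw [hM.tupleEntry_sum P k₀ (P k₀).1]
      exact (hM.tupleEntry_eq_sum_right hl hlk _).symm
  have henum : ∀ I : Finset (V × W), I.Nonempty → I.card ≤ 2 * t →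
      ∃ P : Pos t → V × W, Finset.univ.image P = I := by
    intro I hI hcard
    obtain ⟨P, hP, -⟩ := exists_image_eq hI (Finset.univ : Finset (Pos t)) (by
      rwa [Finset.card_univ, card_pos])
    exact ⟨P, hP⟩
  have hyM : ∀ p q : Fin t → V × W, M p q = y (Finset.univ.image p ∪ Finset.univ.image q) := by
    intro p q
    change tupleEntry M (Sum.elim p q) = _
    rw [← hy]
    congr 1
    ext x
    simp
  refine ⟨y, ?_, fun I hI => hright I (by omega), fun I hI => hleft I (by omega), ?_, hy0, ?_⟩
  -- If `V` is empty, `∅` is the only index and the matrix is `(1)`; otherwise a vertex `g₀` is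
  -- available for representing `∅`.
  · rcases isEmpty_or_nonempty V with hV | ⟨⟨g₀⟩⟩
    · have hI : ∀ I : Finset (V × W), I = ∅ := fun I =>
        Finset.eq_empty_of_forall_notMem fun p _ => hV.false p.1
      refine posSemidef_of_eq_comb (Matrix.PosSemidef.one (n := Unit) (R := ℝ))
        (fun _ (_ : Unit) => ()) (fun _ _ => 1) fun I J => ?_
      simp [hI (I.1 ∪ J.1), hy0]
    · obtain ⟨h₀⟩ : Nonempty W := by
        by_contra hW
        rw [not_nonempty_iff] at hW
        have := hempty_right g₀
        simp [hy0] at this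
      have henum' : ∀ I : {I : Finset (V × W) // I.card ≤ t}, ∃ P : Fin t → V × W,
          I.1.Nonempty → Finset.univ.image P = I.1 := by
        intro I
        by_cases hI : I.1.Nonempty
        · obtain ⟨P, hP, -⟩ := exists_image_eq hI (Finset.univ : Finset (Fin t))
            (by simpa using I.2)
          exact ⟨P, fun _ => hP⟩
        · exact ⟨fun _ => (g₀, h₀), fun h => (hI h).elim⟩
      choose E hE using henum'
      have hc : ∀ p : V × W, (Finset.univ.image fun _ : Fin t => p) = {p} := fun p =>
        Finset.image_const ⟨⟨0, ht⟩, Finset.mem_univ _⟩ p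
      -- A non-empty `I` is represented by the basis vector of an enumeration. The empty set is
      -- represented by the sum over `h` of the constant tuples `(g₀, h)`, in accordance with `∑ h,
      -- y (I ∪ {(g₀, h)}) = y I`.
      refine posSemidef_of_eq_comb hM.dnn.1
        (fun (I : {I : Finset (V × W) // I.card ≤ t}) (o : Option W) =>
          o.elim (E I) fun h _ => (g₀, h))
        (fun I o => if I.1.Nonempty then o.elim 1 fun _ => 0 else o.elim 0 fun _ => 1) fun I J => ?_
      have hI := I.2
      have hJ := J.2
      by_cases hI0 : I.1.Nonempty <;> by_cases hJ0 : J.1.Nonempty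
      · simp [Fintype.sum_option, hyM, hI0, hJ0, hE]
      · simp only [Fintype.sum_option, hyM, hI0, hJ0, hE, Matrix.of_apply, if_true, if_false,
          Option.elim_none, Option.elim_some, hc, star_one, star_zero, one_mul, mul_one, mul_zero,
          zero_mul, zero_add, add_zero, Finset.sum_const_zero]
        rw [hright _ (by omega), Finset.not_nonempty_iff_eq_empty.1 hJ0, Finset.union_empty]
      · simp only [Fintype.sum_option, hyM, hI0, hJ0, hE, Matrix.of_apply, if_true, if_false,
          Option.elim_none, Option.elim_some, hc, star_one, star_zero, one_mul, mul_one, mul_zero,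
          zero_mul, zero_add, add_zero, Finset.sum_const_zero]
        simp_rw [Finset.union_comm _ J.1]
        rw [hright _ (by omega), Finset.not_nonempty_iff_eq_empty.1 hI0, Finset.union_empty]
      · simp only [Fintype.sum_option, hyM, hI0, hJ0, Matrix.of_apply, if_false,
          Option.elim_none, Option.elim_some, hc, star_one, star_zero, one_mul, mul_one, mul_zero,
          zero_mul, zero_add, Finset.sum_const_zero]
        simp_rw [hright _ (show ({_} : Finset (V × W)).card + 1 ≤ 2 * t by simp; omega)]
        rw [Finset.not_nonempty_iff_eq_empty.1 hI0, Finset.not_nonempty_iff_eq_empty.1 hJ0,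
          Finset.union_empty, ← hempty_right g₀]
        simp only [Finset.empty_union]
  · intro I hI hp
    have hne : I.Nonempty := by
      rw [Finset.nonempty_iff_ne_empty]
      rintro rfl
      exact hp (by simp [PartialIso])
    obtain ⟨P, rfl⟩ := henum I hne hI
    rw [hy]
    refine hM.zero (fun k => (P k).1) (fun k => (P k).2) fun hs => hp ?_
    exact (partialIso_image_iff (fun k => (P k).1) (fun k => (P k).2)).2 hs
  · intro I hI
    rcases I.eq_empty_or_nonempty with rfl | hne
    · rw [hy0]
      exact zero_le_one
    · obtain ⟨P, rfl⟩ := henum I hne hI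
      rw [hy]
      exact hM.dnn.2 _ _

end DNNToLasserre

/-! ## Doubly stochastic Choi matrices -/

section Choi

variable {α β : Type*} [Fintype α] [Fintype β]

/-- A doubly non-negative matrix indexed by pairs whose rows and columns of blocks sum to `1` and
which vanishes at pairs of pairs that agree in exactly one entry. -/
structure IsStochasticChoi (N : Matrix (α × β) (α × β) ℂ) : Prop where
  dnn : IsDNN N
  eq_iff : ∀ x y x' y', N (x, y) (x', y') ≠ 0 → (x = x' ↔ y = y')
  sum_right : ∀ x x', ∑ y, ∑ y', N (x, y) (x', y') = 1
  sum_left : ∀ y y', ∑ x, ∑ x', N (x, y) (x', y') = 1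

/-- The entries of `X` and `X'` agree wherever `N` does not vanish. -/
def Compat (N : Matrix (α × β) (α × β) ℂ) (X : Matrix α α ℂ) (X' : Matrix β β ℂ) : Prop :=
  ∀ x y x' y', N (x, y) (x', y') ≠ 0 → X x x' = X' y y'

/-- The linear map with Choi matrix `N`. -/
def choiMap (N : Matrix (α × β) (α × β) ℂ) (X : Matrix α α ℂ) : Matrix β β ℂ :=
  Matrix.of fun y y' => ∑ x, ∑ x', N (x, y) (x', y') * X x x'

/-- The Choi matrix of the adjoint map. -/
def choiSwap (N : Matrix (α × β) (α × β) ℂ) : Matrix (β × α) (β × α) ℂ :=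
  N.submatrix Prod.swap Prod.swap

variable {N : Matrix (α × β) (α × β) ℂ}

theorem IsStochasticChoi.swap (hN : IsStochasticChoi N) : IsStochasticChoi (choiSwap N) where
  dnn := ⟨hN.dnn.1.submatrix _, fun _ _ => hN.dnn.2 _ _⟩
  eq_iff x y x' y' h := (hN.eq_iff y x y' x' h).symm
  sum_right := hN.sum_left
  sum_left := hN.sum_right

omit [Fintype α] [Fintype β] in
theorem Compat.swap {X : Matrix α α ℂ} {X' : Matrix β β ℂ} (h : Compat N X X') :
    Compat (choiSwap N) X' X := fun x y x' y' hN => (h y x y' x' hN).symm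

theorem IsStochasticChoi.ne_zero_symm (hN : IsStochasticChoi N) {p q : α × β} (h : N p q ≠ 0) :
    N q p ≠ 0 := by
  intro h'
  have := hN.dnn.1.1.apply p q
  rw [h', star_zero] at this
  exact h this.symm

theorem Compat.star (hN : IsStochasticChoi N) {X : Matrix α α ℂ} {X' : Matrix β β ℂ}
    (h : Compat N X X') : Compat N (star X) (star X') :=
  fun x y x' y' hne => congrArg (Star.star : ℂ → ℂ) (h x' y' x y (hN.ne_zero_symm hne))

/-- Each entry of `choiMap N X` is an average, with weights from `N`, of entries of `X` that all
equal the entry of `X'`. -/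
theorem Compat.choiMap_eq (hN : IsStochasticChoi N) {X : Matrix α α ℂ} {X' : Matrix β β ℂ}
    (h : Compat N X X') : choiMap N X = X' := by
  ext y y'
  rw [← mul_one (X' y y'), ← hN.sum_left y y', mul_comm, Finset.sum_mul]
  simp_rw [Finset.sum_mul]
  refine Finset.sum_congr rfl fun x _ => Finset.sum_congr rfl fun x' _ => ?_
  by_cases h0 : N (x, y) (x', y') = 0
  · simp [h0]
  · rw [h x y x' y' h0]

/-- Expanding `∑ N |X - X'|²` gives `‖X‖² - ‖X‖² - ‖X'‖² + ‖X'‖² = 0`. All terms are non-negative,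
so `X` and `X'` agree wherever `N` does not vanish. -/
theorem compat_of_choiMap_eq (hN : IsStochasticChoi N) {X : Matrix α α ℂ} {X' : Matrix β β ℂ}
    (h : choiMap N X = X') (h' : choiMap (choiSwap N) X' = X) : Compat N X X' := by
  have hX' : ∀ y y', ∑ x, ∑ x', N (x, y) (x', y') * X x x' = X' y y' := fun y y' => by
    rw [← h]; rfl
  have hX : ∀ x x', ∑ y, ∑ y', N (x, y) (x', y') * X' y y' = X x x' := fun x x' => by
    conv_rhs => rw [← h']
    rfl
  have hswap : ∀ f : α → α → β → β → ℂ, ∑ x, ∑ x', ∑ y, ∑ y', f x x' y y' =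
      ∑ y, ∑ y', ∑ x, ∑ x', f x x' y y' := by
    intro f
    calc ∑ x, ∑ x', ∑ y, ∑ y', f x x' y y'
        = ∑ p : α × α, ∑ q : β × β, f p.1 p.2 q.1 q.2 := by
          simp only [Fintype.sum_prod_type]
      _ = ∑ q : β × β, ∑ p : α × α, f p.1 p.2 q.1 q.2 := Finset.sum_comm
      _ = _ := by simp only [Fintype.sum_prod_type]
  have h1 : ∑ x, ∑ x', ∑ y, ∑ y', N (x, y) (x', y') * (X x x' * Star.star (X x x')) =
      ∑ x, ∑ x', X x x' * Star.star (X x x') := by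
    simp_rw [← Finset.sum_mul, hN.sum_right, one_mul]
  have h2 : ∑ x, ∑ x', ∑ y, ∑ y', N (x, y) (x', y') * (X' y y' * Star.star (X x x')) =
      ∑ x, ∑ x', X x x' * Star.star (X x x') := by
    simp_rw [← mul_assoc, ← Finset.sum_mul, hX]
  have h3 : ∑ x, ∑ x', ∑ y, ∑ y', N (x, y) (x', y') * (X x x' * Star.star (X' y y')) =
      ∑ y, ∑ y', X' y y' * Star.star (X' y y') := by
    rw [hswap]
    simp_rw [← mul_assoc, ← Finset.sum_mul, hX']
  have h4 : ∑ x, ∑ x', ∑ y, ∑ y', N (x, y) (x', y') * (X' y y' * Star.star (X' y y')) =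
      ∑ y, ∑ y', X' y y' * Star.star (X' y y') := by
    rw [hswap]
    simp_rw [← Finset.sum_mul, hN.sum_left, one_mul]
  have hsum : ∑ x, ∑ x', ∑ y, ∑ y',
      N (x, y) (x', y') * ((X x x' - X' y y') * Star.star (X x x' - X' y y')) = 0 := by
    have : ∀ x x' y y',
        N (x, y) (x', y') * ((X x x' - X' y y') * Star.star (X x x' - X' y y')) =
        N (x, y) (x', y') * (X x x' * Star.star (X x x')) -
        N (x, y) (x', y') * (X' y y' * Star.star (X x x')) -
        (N (x, y) (x', y') * (X x x' * Star.star (X' y y')) -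
        N (x, y) (x', y') * (X' y y' * Star.star (X' y y'))) := by
      intro x x' y y'
      rw [star_sub]
      ring
    simp_rw [this, Finset.sum_sub_distrib, h1, h2, h3, h4, sub_self]
  have hnn : ∀ x x' y y',
      0 ≤ N (x, y) (x', y') * ((X x x' - X' y y') * Star.star (X x x' - X' y y')) :=
    fun x x' y y' => mul_nonneg (hN.dnn.2 _ _) (mul_star_self_nonneg _)
  intro x y x' y' hne
  rw [Finset.sum_eq_zero_iff_of_nonneg fun x _ => Finset.sum_nonneg fun x' _ =>
    Finset.sum_nonneg fun y _ => Finset.sum_nonneg fun y' _ => hnn x x' y y'] at hsum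
  have hsum := hsum x (Finset.mem_univ _)
  rw [Finset.sum_eq_zero_iff_of_nonneg fun x' _ =>
    Finset.sum_nonneg fun y _ => Finset.sum_nonneg fun y' _ => hnn x x' y y'] at hsum
  have hsum := hsum x' (Finset.mem_univ _)
  rw [Finset.sum_eq_zero_iff_of_nonneg fun y _ =>
    Finset.sum_nonneg fun y' _ => hnn x x' y y'] at hsum
  have hsum := hsum y (Finset.mem_univ _)
  rw [Finset.sum_eq_zero_iff_of_nonneg fun y' _ => hnn x x' y y'] at hsum
  have hsum := hsum y' (Finset.mem_univ _)
  rcases mul_eq_zero.1 ((mul_eq_zero.1 hsum).resolve_left hne) with h | h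
  exacts [sub_eq_zero.1 h, sub_eq_zero.1 (star_eq_zero.1 h)]

/-- All blocks have sum `1`, so `∑ y, e_(x₁, y) - ∑ y, e_(x, y)` has quadratic form `0` and lies in
the kernel. In the diagonal block of `x` only diagonal entries are non-zero. -/
theorem IsStochasticChoi.sum_snd (hN : IsStochasticChoi N) (x : α) (y : β) (x₁ : α) :
    ∑ y₁, N (x, y) (x₁, y₁) = N (x, y) (x, y) := by
  have h := sum_eq_zero_of_posSemidef hN.dnn.1
    (Sum.elim (fun y => (x₁, y)) (fun y => (x, y)) : β ⊕ β → α × β)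
    (Sum.elim (fun _ => 1) (fun _ => -1)) (by
      simp only [Fintype.sum_sum_type, Sum.elim_inl, Sum.elim_inr, star_one, one_mul, mul_one,
        mul_neg, star_neg, neg_mul, Finset.sum_add_distrib, Finset.sum_neg_distrib, hN.sum_right]
      ring) (x, y)
  simp only [Fintype.sum_sum_type, Sum.elim_inl, Sum.elim_inr, mul_one, mul_neg,
    Finset.sum_neg_distrib] at h
  rw [add_neg_eq_zero.1 h, Finset.sum_eq_single y]
  · intro y' _ hy'
    by_contra h0
    exact hy' ((hN.eq_iff _ _ _ _ h0).1 rfl).symm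
  · simp

theorem IsStochasticChoi.sum_fst (hN : IsStochasticChoi N) (x : α) (y : β) (y₁ : β) :
    ∑ x₁, N (x, y) (x₁, y₁) = N (x, y) (x, y) := hN.swap.sum_snd y x y₁

/-- The difference of the two sides is the row `p` of `N` applied to `∑ x, B x₁ x e_(x, y) - ∑ y₁,
B' y₁ y e_(x₁, y₁)`. By `sum_snd` and `sum_fst` each mixed term of its quadratic form cancels a pure
term, so the vector is in the kernel. -/
theorem Compat.sum_mul_eq (hN : IsStochasticChoi N) {B : Matrix α α ℂ} {B' : Matrix β β ℂ}
    (h : Compat N B B') (p : α × β) (x₁ : α) (y : β) :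
    ∑ x, N p (x, y) * B x₁ x = ∑ y₁, N p (x₁, y₁) * B' y₁ y := by
  have h' : ∀ x y₁, N (x, y) (x₁, y₁) ≠ 0 → B x₁ x = B' y₁ y := fun x y₁ hne =>
    h x₁ y₁ x y (hN.ne_zero_symm hne)
  have h1 : ∑ x, ∑ x', Star.star (B x₁ x) * (N (x, y) (x', y) * B x₁ x') =
      ∑ x, Star.star (B x₁ x) * (N (x, y) (x, y) * B x₁ x) := by
    refine Finset.sum_congr rfl fun x _ => Finset.sum_eq_single x (fun x' _ hx' => ?_) (by simp)
    have : N (x, y) (x', y) = 0 := by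
      by_contra h0
      exact hx' ((hN.eq_iff _ _ _ _ h0).2 rfl).symm
    simp [this]
  have h2 : ∑ x, ∑ y₁, Star.star (B x₁ x) * (N (x, y) (x₁, y₁) * B' y₁ y) =
      ∑ x, Star.star (B x₁ x) * (N (x, y) (x, y) * B x₁ x) := by
    refine Finset.sum_congr rfl fun x _ => ?_
    rw [← hN.sum_snd x y x₁, Finset.sum_mul, Finset.mul_sum]
    refine Finset.sum_congr rfl fun y₁ _ => ?_
    by_cases h0 : N (x, y) (x₁, y₁) = 0
    · simp [h0]
    · rw [h' x y₁ h0]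
  have h3 : ∑ y₁, ∑ x, Star.star (B' y₁ y) * (N (x₁, y₁) (x, y) * B x₁ x) =
      ∑ y₁, Star.star (B' y₁ y) * (N (x₁, y₁) (x₁, y₁) * B' y₁ y) := by
    refine Finset.sum_congr rfl fun y₁ _ => ?_
    rw [← hN.sum_fst x₁ y₁ y, Finset.sum_mul, Finset.mul_sum]
    refine Finset.sum_congr rfl fun x _ => ?_
    by_cases h0 : N (x₁, y₁) (x, y) = 0
    · simp [h0]
    · rw [h x₁ y₁ x y h0]
  have h4 : ∑ y₁, ∑ y₂, Star.star (B' y₁ y) * (N (x₁, y₁) (x₁, y₂) * B' y₂ y) =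
      ∑ y₁, Star.star (B' y₁ y) * (N (x₁, y₁) (x₁, y₁) * B' y₁ y) := by
    refine Finset.sum_congr rfl fun y₁ _ =>
      Finset.sum_eq_single y₁ (fun y₂ _ hy₂ => ?_) (by simp)
    have : N (x₁, y₁) (x₁, y₂) = 0 := by
      by_contra h0
      exact hy₂ ((hN.eq_iff _ _ _ _ h0).1 rfl).symm
    simp [this]
  have key := sum_eq_zero_of_posSemidef hN.dnn.1
    (Sum.elim (fun x => (x, y)) (fun y₁ => (x₁, y₁)) : α ⊕ β → α × β)
    (Sum.elim (fun x => B x₁ x) (fun y₁ => -B' y₁ y)) (by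
      simp only [Fintype.sum_sum_type, Sum.elim_inl, Sum.elim_inr, mul_neg, star_neg, neg_mul,
        Finset.sum_add_distrib, Finset.sum_neg_distrib, h1, h2, h3, h4]
      ring) p
  simp only [Fintype.sum_sum_type, Sum.elim_inl, Sum.elim_inr, mul_neg,
    Finset.sum_neg_distrib] at key
  exact add_neg_eq_zero.1 key

/-- The intertwining relation `sum_mul_eq` moves `B` across `N`, where it becomes `B'`; what remains
is `choiMap N A = A'`. -/
theorem Compat.choiMap_mul (hN : IsStochasticChoi N) {A B : Matrix α α ℂ} {A' B' : Matrix β β ℂ}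
    (hA : Compat N A A') (hB : Compat N B B') : choiMap N (A * B) = A' * B' := by
  ext y₂ y
  rw [← hA.choiMap_eq hN]
  simp only [choiMap, Matrix.of_apply, Matrix.mul_apply]
  calc ∑ x₂, ∑ x, N (x₂, y₂) (x, y) * ∑ x₁, A x₂ x₁ * B x₁ x
      = ∑ x₂, ∑ x₁, A x₂ x₁ * ∑ x, N (x₂, y₂) (x, y) * B x₁ x := by
        refine Finset.sum_congr rfl fun x₂ _ => ?_
        simp_rw [Finset.mul_sum]
        rw [Finset.sum_comm]
        refine Finset.sum_congr rfl fun x₁ _ => Finset.sum_congr rfl fun x _ => ?_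
        ring
    _ = ∑ x₂, ∑ x₁, A x₂ x₁ * ∑ y₁, N (x₂, y₂) (x₁, y₁) * B' y₁ y := by
        simp_rw [hB.sum_mul_eq hN]
    _ = ∑ x₂, ∑ y₁, (∑ x₁, N (x₂, y₂) (x₁, y₁) * A x₂ x₁) * B' y₁ y := by
        refine Finset.sum_congr rfl fun x₂ _ => ?_
        simp_rw [Finset.mul_sum, Finset.sum_mul]
        rw [Finset.sum_comm]
        refine Finset.sum_congr rfl fun x₁ _ => Finset.sum_congr rfl fun x _ => ?_
        ring
    _ = _ := by
        rw [Finset.sum_comm]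
        simp_rw [Finset.sum_mul]

theorem Compat.mul (hN : IsStochasticChoi N) {A B : Matrix α α ℂ} {A' B' : Matrix β β ℂ}
    (hA : Compat N A A') (hB : Compat N B B') : Compat N (A * B) (A' * B') :=
  compat_of_choiMap_eq hN (hA.choiMap_mul hN hB) (hA.swap.choiMap_mul hN.swap hB.swap)

end Choi

/-! ## From isomorphism maps to equivalences of adjacency algebras -/

section ChoiAlgebra

variable {α β : Type*} [Fintype α] [Fintype β] {N : Matrix (α × β) (α × β) ℂ}

theorem IsStochasticChoi.card_eq (hN : IsStochasticChoi N) : Fintype.card α = Fintype.card β := by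
  have h1 : ∑ p : α × α, ∑ q : β × β, N (p.1, q.1) (p.2, q.2) = (Fintype.card (α × α) : ℂ) := by
    simp [Fintype.sum_prod_type, hN.sum_right]
  have h2 : ∑ q : β × β, ∑ p : α × α, N (p.1, q.1) (p.2, q.2) = (Fintype.card (β × β) : ℂ) := by
    simp [Fintype.sum_prod_type, hN.sum_left]
  rw [Finset.sum_comm, h2] at h1
  have h : Fintype.card β * Fintype.card β = Fintype.card α * Fintype.card α := by
    rw [← Fintype.card_prod, ← Fintype.card_prod]
    exact_mod_cast h1
  exact (Nat.mul_self_inj.1 h).symm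

end ChoiAlgebra

section IsoChoi

variable {t : ℕ} {V W : Type*} [Fintype V] [Fintype W] {G : SimpleGraph V} {H : SimpleGraph W}

/-- A stochastic Choi matrix that respects the homomorphism tensors of atomic graphs and whose
support is invariant under permutations of the coordinates. -/
structure IsIsoChoi (G : SimpleGraph V) (H : SimpleGraph W)
    (N : Matrix ((Fin t → V) × (Fin t → W)) ((Fin t → V) × (Fin t → W)) ℂ) : Prop where
  choi : IsStochasticChoi N
  atomic : ∀ A : BiGraph t, A.Atomic → Compat N (homTensor A G) (homTensor A H)
  perm : ∀ (σ : Equiv.Perm (Pos t)) (x x' : Fin t → V) (y y' : Fin t → W),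
    N (x, y) (x', y') ≠ 0 →
      N (fun i => Sum.elim x x' (σ (.inl i)), fun i => Sum.elim y y' (σ (.inl i)))
        (fun i => Sum.elim x x' (σ (.inr i)), fun i => Sum.elim y y' (σ (.inr i))) ≠ 0

variable {N : Matrix ((Fin t → V) × (Fin t → W)) ((Fin t → V) × (Fin t → W)) ℂ}

theorem IsIsoChoi.swap (hN : IsIsoChoi G H N) : IsIsoChoi H G (choiSwap N) where
  choi := hN.choi.swap
  atomic A hA := (hN.atomic A hA).swap
  perm σ x x' y y' h := hN.perm σ y y' x x' h

variable [DecidableEq V] [DecidableEq W]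

theorem IsIsoChoi.compat_one (hN : IsIsoChoi G H N) : Compat N 1 1 := fun x y x' y' h => by
  simp [Matrix.one_apply, hN.choi.eq_iff x y x' y' h]

/-- The tensors over `V` that `N` matches with an element of the adjacency algebra of `H`. -/
def compatAlgebra (hN : IsIsoChoi G H N) : StarSubalgebra ℂ (Tensor t V) where
  carrier := {X | ∃ X' ∈ adjAlgebra t H, Compat N X X'}
  mul_mem' := by
    rintro X Y ⟨X', hX', hX⟩ ⟨Y', hY', hY⟩
    exact ⟨X' * Y', mul_mem hX' hY', hX.mul hN.choi hY⟩
  add_mem' := by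
    rintro X Y ⟨X', hX', hX⟩ ⟨Y', hY', hY⟩
    exact ⟨X' + Y', add_mem hX' hY',
      fun x y x' y' h => congrArg₂ (· + ·) (hX x y x' y' h) (hY x y x' y' h)⟩
  algebraMap_mem' c := ⟨algebraMap ℂ _ c, algebraMap_mem _ c, fun x y x' y' h => by
    simp only [Algebra.algebraMap_eq_smul_one, Matrix.smul_apply, hN.compat_one x y x' y' h]⟩
  star_mem' := by
    rintro X ⟨X', hX', hX⟩
    exact ⟨star X', star_mem hX', hX.star hN.choi⟩

/-- By minimality of the adjacency algebra it suffices that `compatAlgebra hN` has the closure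
properties that define it; matrix products are covered by `Compat.mul`. -/
theorem IsIsoChoi.adjAlgebra_le (hN : IsIsoChoi G H N) : adjAlgebra t G ≤ compatAlgebra hN := by
  refine sInf_le ⟨⟨?_, ?_, ?_⟩, fun A hA => ?_⟩
  · exact ⟨allOnes _, (adjAlgebra_coherent t H).allOnes_mem, fun _ _ _ _ _ => rfl⟩
  · rintro X ⟨X', hX', hX⟩ Y ⟨Y', hY', hY⟩
    exact ⟨X' ⊙ Y', (adjAlgebra_coherent t H).hadamard_mem _ hX' _ hY',
      fun x y x' y' h => congrArg₂ (· * ·) (hX x y x' y' h) (hY x y x' y' h)⟩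
  · rintro σ X ⟨X', hX', hX⟩
    exact ⟨permTensor σ X', (adjAlgebra_coherent t H).perm_mem σ _ hX',
      fun x y x' y' h => hX _ _ _ _ (hN.perm σ⁻¹ x x' y y' h)⟩
  · exact ⟨homTensor A H, homTensor_mem_adjAlgebra H hA, hN.atomic A hA⟩

theorem IsIsoChoi.exists_compat (hN : IsIsoChoi G H N) (X : adjAlgebra t G) :
    choiMap N X.1 ∈ adjAlgebra t H ∧ Compat N X.1 (choiMap N X.1) := by
  obtain ⟨X', hX', hX⟩ := hN.adjAlgebra_le X.2
  rw [hX.choiMap_eq hN.choi]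
  exact ⟨hX', hX⟩

theorem IsIsoChoi.tEquivalent (ht : 1 ≤ t) (hN : IsIsoChoi G H N) : TEquivalent t G H := by
  have hc := fun X => (hN.exists_compat X).2
  refine ⟨?_,
    { toFun := fun X => ⟨choiMap N X.1, (hN.exists_compat X).1⟩
      invFun := fun X => ⟨choiMap (choiSwap N) X.1, (hN.swap.exists_compat X).1⟩
      map_add' := fun X Y => Subtype.ext (Compat.choiMap_eq hN.choi
        fun x y x' y' h => congrArg₂ (· + ·) (hc X x y x' y' h) (hc Y x y x' y' h))
      map_smul' := fun c X => Subtype.ext (Compat.choiMap_eq hN.choi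
        fun x y x' y' h => congrArg (c * ·) (hc X x y x' y' h))
      left_inv := fun X => Subtype.ext ((hc X).swap.choiMap_eq hN.choi.swap)
      right_inv := fun X =>
        Subtype.ext ((hN.swap.exists_compat X).2.swap.choiMap_eq hN.choi) }, ?_⟩
  · have := hN.choi.card_eq
    rw [Fintype.card_fun, Fintype.card_fun, Fintype.card_fin] at this
    exact Nat.pow_left_injective (by omega) this
  · constructor
    · exact fun M => Subtype.ext (((hc M).star hN.choi).choiMap_eq hN.choi)
    · exact fun M M' => Subtype.ext (((hc M).mul hN.choi (hc M')).choiMap_eq hN.choi)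
    · exact Subtype.ext (hN.compat_one.choiMap_eq hN.choi)
    · exact fun A hA => Subtype.ext ((hN.atomic A hA).choiMap_eq hN.choi)
    · exact Subtype.ext (Compat.choiMap_eq hN.choi fun _ _ _ _ _ => rfl)
    · exact fun M M' => Subtype.ext (Compat.choiMap_eq hN.choi
        fun x y x' y' h => congrArg₂ (· * ·) (hc M x y x' y' h) (hc M' x y x' y' h))
    · exact fun σ M => Subtype.ext (Compat.choiMap_eq hN.choi
        fun x y x' y' h => hc M _ _ _ _ (hN.perm σ⁻¹ x x' y y' h))

end IsoChoi

/-! ### The Choi matrix of an isomorphism map -/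

section MapChoi

variable {t : ℕ} {V W : Type*}

/-- The Choi matrix of a linear map. -/
def mapChoi {m n : Type*} [DecidableEq m] (Φ : Matrix m m ℂ →ₗ[ℂ] Matrix n n ℂ) :
    Matrix (m × n) (m × n) ℂ :=
  Matrix.of fun p q => Φ (Matrix.single p.1 q.1 1) p.2 q.2

/-- As in Choi's theorem, the Choi matrix is the image under `id ⊗ Φ` of the rank-one matrix of `∑
a, e_a ⊗ e_a`, which is doubly non-negative. -/
theorem CompletelyDNNPreserving.isDNN_mapChoi {m n : Type*} [Fintype m] [DecidableEq m]
    {Φ : Matrix m m ℂ →ₗ[ℂ] Matrix n n ℂ} (h : CompletelyDNNPreserving Φ) :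
    IsDNN (mapChoi Φ) := by
  let e := Fintype.equivFin m
  let v : Fin (Fintype.card m) × m → ℂ := fun p => if e p.2 = p.1 then 1 else 0
  have hv : star v = v := by
    ext p
    simp only [v, Pi.star_apply]
    split_ifs <;> simp
  have hX : IsDNN (Matrix.vecMulVec v (star v)) := by
    refine ⟨Matrix.posSemidef_vecMulVec_self_star v, fun p q => ?_⟩
    rw [hv, Matrix.vecMulVec_apply]
    simp only [v]
    split_ifs <;> simp
  have key : mapChoi Φ = (ampliation _ Φ (Matrix.vecMulVec v (star v))).submatrix
      (fun p => (e p.1, p.2)) (fun p => (e p.1, p.2)) := by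
    ext ⟨a, c⟩ ⟨b, d⟩
    simp only [mapChoi, ampliation, Matrix.submatrix_apply, Matrix.of_apply]
    refine congrArg (fun Y : Matrix m m ℂ => Φ Y c d) ?_
    ext a' b'
    rw [hv]
    simp only [Matrix.of_apply, Matrix.vecMulVec_apply, v, e.injective.eq_iff, Matrix.single_apply]
    by_cases h1 : a = a' <;> by_cases h2 : b = b' <;> simp [h1, h2, eq_comm]
  rw [key]
  exact ⟨(h _ _ hX).1.submatrix _, fun _ _ => (h _ _ hX).2 _ _⟩

theorem edgelessAtomic_atomic {α : Type} (l : Pos t → α) : (edgelessAtomic l).Atomic :=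
  Set.rangeFactorization_surjective

open Classical in
theorem labHomCount_edgelessAtomic {α : Type} (l : Pos t → α) (G : SimpleGraph V) (g : Pos t → V) :
    labHomCount (edgelessAtomic l) G g = if ∀ k k', l k = l k' → g k = g k' then 1 else 0 := by
  rw [labHomCount_atomic (edgelessAtomic_atomic l)]
  refine if_congr ⟨fun h k k' hk => h.1 k k' (Subtype.ext hk), fun h => ⟨fun k k' hk => ?_, ?_⟩⟩
    rfl rfl
  · exact h k k' (congrArg Subtype.val hk)
  · exact fun k k' hk => hk.elim

open Classical in
-- The `i`-th in-label and out-label share a vertex. Thus the identity is an atomic tensor, and the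
-- condition on atomic graphs yields `IsStochasticChoi.eq_iff`.
theorem homTensor_identity (G : SimpleGraph V) (x y : Fin t → V) :
    homTensor (edgelessAtomic (Sum.elim id id : Pos t → Fin t)) G x y = if x = y then 1 else 0 := by
  rw [homTensor_apply, labHomCount_edgelessAtomic]
  push_cast
  refine if_congr ⟨fun h => funext fun i => h (.inl i) (.inr i) rfl, ?_⟩ rfl rfl
  rintro rfl (i | i) (j | j) hij <;> exact congrArg x hij

theorem permTensor_single [DecidableEq V] (σ : Equiv.Perm (Pos t)) (g : Pos t → V) :
    permTensor σ (Matrix.single (fun i => g (.inl i)) (fun i => g (.inr i)) (1 : ℂ)) =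
      Matrix.single (fun i => g (σ (.inl i))) (fun i => g (σ (.inr i))) 1 := by
  ext x y
  simp only [permTensor, Matrix.of_apply, Matrix.single_apply, funext_iff]
  refine if_congr ⟨fun h => ?_, fun h => ?_⟩ rfl rfl
  · have h' : ∀ k, g k = Sum.elim x y (σ⁻¹ k) := by
      rintro (i | i)
      exacts [h.1 i, h.2 i]
    exact ⟨fun i => by simp [h'], fun i => by simp [h']⟩
  · have h' : ∀ k, g (σ k) = Sum.elim x y k := by
      rintro (i | i)
      exacts [h.1 i, h.2 i]
    exact ⟨fun i => by simp [← h'], fun i => by simp [← h']⟩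

variable [Fintype W] [DecidableEq V] {G : SimpleGraph V} {H : SimpleGraph W}

theorem IsDNNIsoMap.mapChoi_perm {Φ : Tensor t V →ₗ[ℂ] Tensor t W} (h : IsDNNIsoMap t G H Φ)
    (σ : Equiv.Perm (Pos t)) (x x' : Fin t → V) (y y' : Fin t → W) :
    mapChoi Φ (fun i => Sum.elim x x' (σ (.inl i)), fun i => Sum.elim y y' (σ (.inl i)))
      (fun i => Sum.elim x x' (σ (.inr i)), fun i => Sum.elim y y' (σ (.inr i))) =
      mapChoi Φ (x, y) (x', y') := by
  simp only [mapChoi, Matrix.of_apply]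
  have := permTensor_single σ (Sum.elim x x')
  rw [← this, h.perm]
  simp only [permTensor, Matrix.of_apply, Sum.elim_inl, Sum.elim_inr]
  have hy : ∀ k, Sum.elim (fun i => Sum.elim y y' (σ (.inl i)))
      (fun i => Sum.elim y y' (σ (.inr i))) k = Sum.elim y y' (σ k) := by
    rintro (i | i) <;> rfl
  simp [hy]

variable [Fintype V] [DecidableEq W]

theorem IsDNNIsoMap.isIsoChoi {Φ : Tensor t V →ₗ[ℂ] Tensor t W} (h : IsDNNIsoMap t G H Φ) :
    IsIsoChoi G H (mapChoi Φ) := by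
  have hat : ∀ A : BiGraph t, A.Atomic → Compat (mapChoi Φ) (homTensor A G) (homTensor A H) := by
    intro A hA x y x' y' hne
    -- On a matrix unit, the Schur product on the `G` side is multiplication by one entry, so the
    -- two tensor entries agree wherever the Choi matrix is non-zero.
    have h1 := congrFun₂ (h.atomic A hA (Matrix.single x x' 1)) y y'
    have h2 : homTensor A G ⊙ Matrix.single x x' 1 =
        homTensor A G x x' • Matrix.single x x' (1 : ℂ) := by
      ext a b
      simp only [Matrix.hadamard_apply, Matrix.smul_apply, Matrix.single_apply, smul_eq_mul]
      split_ifs with hab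
      · rw [hab.1, hab.2]
      · simp
    rw [h2, map_smul] at h1
    exact mul_right_cancel₀ hne h1
  refine ⟨⟨h.dnn.isDNN_mapChoi, fun x y x' y' hne => ?_, fun x x' => ?_, fun y y' => ?_⟩, hat,
    fun σ x x' y y' hne => (h.mapChoi_perm σ x x' y y').trans_ne hne⟩
  · classical
    have := hat _ (edgelessAtomic_atomic (Sum.elim id id : Pos t → Fin t)) x y x' y' hne
    rw [homTensor_identity, homTensor_identity] at this
    by_cases h1 : x = x' <;> by_cases h2 : y = y' <;> simp [h1, h2] at this ⊢
  · have := congrFun₂ h.adjoint_allOnes x x'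
    simp only [adjointMap, allOnes, Matrix.of_apply, mul_one, ← star_sum] at this
    exact (star_eq_iff_star_eq.1 this).symm.trans (star_one ℂ)
  · have := congrFun₂ h.map_allOnes y y'
    rw [Matrix.matrix_eq_sum_single (allOnes (Fin t → V)), map_sum] at this
    simp only [map_sum, Matrix.sum_apply] at this
    exact this

theorem IsDNNIsoMap.tEquivalent (ht : 1 ≤ t) {Φ : Tensor t V →ₗ[ℂ] Tensor t W}
    (h : IsDNNIsoMap t G H Φ) : TEquivalent t G H := h.isIsoChoi.tEquivalent ht

end MapChoi

/-! ## From matrices to isomorphism maps -/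

section MatrixToMap

open scoped MatrixOrder in
theorem _root_.Matrix.PosSemidef.map_ofReal {n : Type*} [Fintype n] [DecidableEq n]
    {M : Matrix n n ℝ} (hM : M.PosSemidef) : (M.map (fun x => (x : ℂ))).PosSemidef := by
  obtain ⟨B, rfl⟩ := CStarAlgebra.nonneg_iff_eq_star_mul_self.1 hM.nonneg
  have : (star B * B).map (fun x => (x : ℂ)) =
      (B.map (fun x => (x : ℂ)))ᴴ * B.map (fun x => (x : ℂ)) := by
    ext i j
    simp [Matrix.mul_apply, Matrix.star_apply]
  rw [this]
  exact Matrix.posSemidef_conjTranspose_mul_self _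

variable {α β : Type*} [Fintype α]

/-- The linear map with Choi matrix `N`, as a bundled map. -/
def choiLinearMap (N : Matrix (α × β) (α × β) ℂ) : Matrix α α ℂ →ₗ[ℂ] Matrix β β ℂ where
  toFun := choiMap N
  map_add' X Y := by
    ext
    simp [choiMap, mul_add, Finset.sum_add_distrib]
  map_smul' c X := by
    ext
    simp [choiMap, Finset.mul_sum, mul_left_comm]

variable [Fintype β] in
-- The output is a compression of the Schur product of inflated copies of `N` and `X`, which is
-- positive semidefinite by the Schur product theorem.
theorem IsDNN.completelyDNNPreserving {N : Matrix (α × β) (α × β) ℂ} (hN : IsDNN N) :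
    CompletelyDNNPreserving (choiLinearMap N) := by
  classical
  intro r X hX
  have hK : (N.submatrix (fun p : Fin r × α × β => p.2) (fun p => p.2) ⊙
      X.submatrix (fun p : Fin r × α × β => (p.1, p.2.1)) (fun p => (p.1, p.2.1))).PosSemidef :=
    (hN.1.submatrix _).hadamard (hX.1.submatrix _)
  refine ⟨posSemidef_of_eq_comb hK (fun p x => (p.1, x, p.2)) (fun _ _ => 1) fun p q => ?_,
    fun p q => ?_⟩
  · simp [ampliation, choiLinearMap, choiMap]
  · exact Finset.sum_nonneg fun x _ => Finset.sum_nonneg fun x' _ =>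
      mul_nonneg (hN.2 _ _) (hX.2 _ _)

theorem choiMap_single [DecidableEq α] (N : Matrix (α × β) (α × β) ℂ) (x x' : α) (y y' : β) :
    choiMap N (Matrix.single x x' 1) y y' = N (x, y) (x', y') := by
  simp only [choiMap, Matrix.of_apply, Matrix.single_apply, mul_ite, mul_one, mul_zero]
  rw [Finset.sum_eq_single x, Finset.sum_eq_single x'] <;> simp +contextual [eq_comm]

theorem sum_pos_eq {t : ℕ} {V R : Type*} [Fintype V] [AddCommMonoid R]
    (f : (Pos t → V) → R) :
    ∑ g, f g = ∑ x : Fin t → V, ∑ x' : Fin t → V, f (Sum.elim x x') := by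
  rw [← Fintype.sum_prod_type', ← (Equiv.sumArrowEquivProdArrow (Fin t) (Fin t) V).symm.sum_comp]
  rfl

variable {t : ℕ} {V W : Type*}

/-- The complexification of `M`, with pairs of tuples in place of tuples of pairs. -/
def pairChoi (M : Matrix (Fin t → V × W) (Fin t → V × W) ℝ) :
    Matrix ((Fin t → V) × (Fin t → W)) ((Fin t → V) × (Fin t → W)) ℂ :=
  (M.map (fun x => (x : ℂ))).submatrix (fun p i => (p.1 i, p.2 i)) (fun p i => (p.1 i, p.2 i))

theorem pairChoi_apply (M : Matrix (Fin t → V × W) (Fin t → V × W) ℝ) (x x' : Fin t → V)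
    (y y' : Fin t → W) :
    pairChoi M (x, y) (x', y') = (pairEntry M (Sum.elim x x') (Sum.elim y y') : ℂ) := rfl

variable [Fintype V] [Fintype W] [DecidableEq V] [DecidableEq W] {G : SimpleGraph V}
  {H : SimpleGraph W}

theorem IsDNNIsoMatrix.isDNNIsoMap {M : Matrix (Fin t → V × W) (Fin t → V × W) ℝ}
    (h : IsDNNIsoMatrix t G H M) : IsDNNIsoMap t G H (choiLinearMap (pairChoi M)) where
  dnn := by
    refine IsDNN.completelyDNNPreserving ⟨h.dnn.1.map_ofReal.submatrix _, fun p q => ?_⟩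
    exact Complex.zero_le_real.2 (h.dnn.2 _ _)
  atomic A hA X := by
    ext y y'
    simp only [choiLinearMap, LinearMap.coe_mk, AddHom.coe_mk, choiMap, Matrix.of_apply,
      Matrix.hadamard_apply, Finset.mul_sum]
    refine Finset.sum_congr rfl fun x _ => Finset.sum_congr rfl fun x' _ => ?_
    -- On tuples of equal type atomic graphs have equal counts; on all others the entry of `M`
    -- vanishes.
    by_cases hT : SameType G H (Sum.elim x x') (Sum.elim y y')
    · rw [homTensor_apply, homTensor_apply, labHomCount_atomic_eq hA hT]
      ring
    · simp [pairChoi_apply, h.zero _ _ hT]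
  map_allOnes := by
    ext y y'
    have := h.sum_left (Sum.elim y y')
    rw [sum_pos_eq] at this
    simp only [choiLinearMap, LinearMap.coe_mk, AddHom.coe_mk, choiMap, Matrix.of_apply, allOnes,
      mul_one, pairChoi_apply]
    exact_mod_cast this
  adjoint_allOnes := by
    ext x x'
    have := h.sum_right (Sum.elim x x')
    rw [sum_pos_eq] at this
    simp only [adjointMap, choiLinearMap, LinearMap.coe_mk, AddHom.coe_mk, choiMap_single,
      Matrix.of_apply, allOnes, mul_one, pairChoi_apply, Complex.star_def, Complex.conj_ofReal]
    exact_mod_cast this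
  perm σ X := by
    ext y y'
    let h' : Pos t → W := fun k => Sum.elim y y' (σ⁻¹ k)
    have h1 : ∀ (X : Tensor t V) (y y' : Fin t → W), choiMap (pairChoi M) X y y' =
        ∑ g : Pos t → V, (pairEntry M g (Sum.elim y y') : ℂ) *
          X (fun i => g (.inl i)) (fun i => g (.inr i)) := fun X y y' => by
      rw [sum_pos_eq]
      rfl
    change choiMap (pairChoi M) (permTensor σ X) y y' =
      choiMap (pairChoi M) X (fun i => h' (.inl i)) (fun i => h' (.inr i))
    rw [h1, h1, ← (σ.symm.arrowCongr (Equiv.refl V)).sum_comp]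
    refine Finset.sum_congr rfl fun g _ => ?_
    have h2 : permTensor σ X (fun i => g (σ (.inl i))) (fun i => g (σ (.inr i))) =
        X (fun i => g (.inl i)) (fun i => g (.inr i)) := by
      have : Sum.elim (fun i => g (σ (.inl i))) (fun i => g (σ (.inr i))) = fun k => g (σ k) :=
        Sum.elim_comp_inl_inr fun k => g (σ k)
      simp [permTensor, this]
    have h3 : pairEntry M (fun k => g (σ k)) (Sum.elim y y') = pairEntry M g h' := by
      rw [h.symm σ⁻¹]
      simp [h']
    have h4 : Sum.elim (fun i => h' (.inl i)) (fun i => h' (.inr i)) = h' :=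
      Sum.elim_comp_inl_inr h'
    rw [h4]
    exact congrArg₂ (· * ·) (congrArg Complex.ofReal h3) h2

theorem DNNIsomorphic.exists_isDNNIsoMap (h : DNNIsomorphic t G H) :
    ∃ Φ : Tensor t V →ₗ[ℂ] Tensor t W, IsDNNIsoMap t G H Φ :=
  let ⟨M, hM⟩ := h
  ⟨choiLinearMap (pairChoi M), hM.isDNNIsoMap⟩

end MatrixToMap

/-! ## From equivalences of adjacency algebras to homomorphism counts -/

section AlgebraToCounts

variable {t : ℕ} {V W : Type*}

theorem homTensor_iso {F F' : BiGraph t} (e : F.IsIso F') (G : SimpleGraph V) :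
    homTensor F G = homTensor F' G := by
  ext x y
  rw [homTensor_apply, homTensor_apply, labHomCount_iso e]

theorem homTensor_parallel (F F' : BiGraph t) (G : SimpleGraph V) :
    homTensor (F.parallel F') G = homTensor F G ⊙ homTensor F' G := by
  ext x y
  simp only [homTensor_apply, Matrix.hadamard_apply, labHomCount_parallel, Nat.cast_mul]

theorem homTensor_perm (σ : Equiv.Perm (Pos t)) (F : BiGraph t) (G : SimpleGraph V) :
    homTensor (F.perm σ) G = permTensor σ (homTensor F G) := by
  ext x y
  simp only [permTensor, Matrix.of_apply, homTensor_apply, labHomCount_perm]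
  exact congrArg (fun g => (labHomCount F G g : ℂ))
    (Sum.elim_comp_inl_inr fun k => Sum.elim x y (σ⁻¹ k)).symm

variable [Fintype V] [Fintype W] [DecidableEq V] [DecidableEq W]

theorem homTensor_series (F F' : BiGraph t) (G : SimpleGraph V) :
    homTensor (F.series F') G = homTensor F G * homTensor F' G := by
  ext x y
  simp only [homTensor_apply, Matrix.mul_apply, labHomCount_series, Nat.cast_sum, Nat.cast_mul]

theorem allOnes_mul_homTensor_mul_allOnes (F : BiGraph t) (G : SimpleGraph V) :
    allOnes _ * homTensor F G * allOnes _ = (homCount F.toFinGraph G : ℂ) • allOnes _ := by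
  ext x y
  simp only [Matrix.mul_apply, allOnes, Matrix.of_apply, one_mul, mul_one, Matrix.smul_apply,
    smul_eq_mul, ← sum_labHomCount, sum_pos_eq, homTensor_apply, Nat.cast_sum]
  exact Finset.sum_comm

variable {G : SimpleGraph V} {H : SimpleGraph W}

theorem LPlus.map_homTensor {F : BiGraph t} (hF : LPlus t F)
    {φ : adjAlgebra t G ≃ₗ[ℂ] adjAlgebra t H} (hφ : IsTEquivalence t G H φ) :
    ∃ h : homTensor F G ∈ adjAlgebra t G, (φ ⟨_, h⟩ : Tensor t W) = homTensor F H := by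
  induction hF with
  | atomic hA => exact ⟨_, congrArg Subtype.val (hφ.map_atomic _ hA)⟩
  | parallel _ _ ih ih' =>
    obtain ⟨h, e⟩ := ih
    obtain ⟨h', e'⟩ := ih'
    simp only [homTensor_parallel]
    refine ⟨(adjAlgebra_coherent t G).hadamard_mem _ h _ h', ?_⟩
    exact (congrArg Subtype.val (hφ.map_hadamard ⟨_, h⟩ ⟨_, h'⟩)).trans (congrArg₂ (· ⊙ ·) e e')
  | series _ _ ih ih' =>
    obtain ⟨h, e⟩ := ih
    obtain ⟨h', e'⟩ := ih'
    simp only [homTensor_series]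
    refine ⟨mul_mem h h', ?_⟩
    rw [← e, ← e', ← MulMemClass.coe_mul, ← hφ.map_mul]
    rfl
  | perm σ _ ih =>
    obtain ⟨h, e⟩ := ih
    simp only [homTensor_perm]
    refine ⟨(adjAlgebra_coherent t G).perm_mem σ _ h, ?_⟩
    exact (congrArg Subtype.val (hφ.map_perm σ ⟨_, h⟩)).trans (congrArg (permTensor σ) e)
  | iso e _ ih =>
    rwa [← homTensor_iso e, ← homTensor_iso e]

theorem LPlus.homCount_eq {F : BiGraph t} (hF : LPlus t F) (ht : 1 ≤ t)
    (h : TEquivalent t G H) : homCount F.toFinGraph G = homCount F.toFinGraph H := by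
  obtain ⟨hcard, φ, hφ⟩ := h
  have : Nonempty (Pos t) := ⟨.inl ⟨0, ht⟩⟩
  -- Over empty vertex sets `allOnes` has no entry to compare, but there are no images for the
  -- labels either, so both counts are `0`.
  rcases isEmpty_or_nonempty W with hW | ⟨⟨w⟩⟩
  · have hV : IsEmpty V := by rwa [← Fintype.card_eq_zero_iff, hcard, Fintype.card_eq_zero_iff]
    rw [← sum_labHomCount, ← sum_labHomCount, Finset.univ_eq_empty, Finset.univ_eq_empty,
      Finset.sum_empty, Finset.sum_empty]
  · obtain ⟨hm, e⟩ := hF.map_homTensor hφ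
    let J : adjAlgebra t G := ⟨allOnes _, (adjAlgebra_coherent t G).allOnes_mem⟩
    have hJ : (φ J : Tensor t W) = allOnes _ := congrArg Subtype.val hφ.map_allOnes
    have h1 : J * ⟨_, hm⟩ * J = (homCount F.toFinGraph G : ℂ) • J :=
      Subtype.ext (allOnes_mul_homTensor_mul_allOnes F G)
    have h2 := congrArg (fun X => (φ X : Tensor t W)) h1
    simp only [hφ.map_mul, map_smul, MulMemClass.coe_mul, hJ, e, SetLike.val_smul,
      allOnes_mul_homTensor_mul_allOnes F H] at h2
    have h3 := congrFun₂ h2 (fun _ => w) (fun _ => w)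
    simp only [allOnes, Matrix.smul_apply, Matrix.of_apply, smul_eq_mul, mul_one] at h3
    exact_mod_cast h3.symm

theorem TEquivalent.homIndist (ht : 1 ≤ t) (h : TEquivalent t G H) :
    HomIndist (underlying (LPlus t)) G H := by
  rintro F ⟨B, hB, e⟩
  rw [← homCount_iso e, ← homCount_iso e]
  exact hB.homCount_eq ht h

end AlgebraToCounts

/-! ## Algebras of functions on tuples and their atoms -/

section FunctionAlgebra

variable {X : Type*} (S : Subalgebra ℝ (X → ℝ))

/-- Two points are equivalent if they are not separated by `S`. -/
def SameAtom (c d : X) : Prop := ∀ f ∈ S, f c = f d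

variable {S} in
theorem SameAtom.symm {c d : X} (h : SameAtom S c d) : SameAtom S d c :=
  fun f hf => (h f hf).symm

variable {S} in
theorem SameAtom.trans {c d e : X} (h : SameAtom S c d) (h' : SameAtom S d e) : SameAtom S c e :=
  fun f hf => (h f hf).trans (h' f hf)

open Classical in
/-- The indicator function of the atom of `c`. -/
noncomputable def atomInd (c d : X) : ℝ := if SameAtom S c d then 1 else 0

theorem atomInd_nonneg (c d : X) : 0 ≤ atomInd S c d := by
  unfold atomInd
  split_ifs <;> simp

theorem atomInd_self (c : X) : atomInd S c c = 1 := if_pos fun _ _ => rfl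

variable {S}

theorem atomInd_ne_zero {c d : X} : atomInd S c d ≠ 0 ↔ SameAtom S c d := by
  unfold atomInd
  split_ifs with h <;> simp [h]

theorem SameAtom.atomInd_eq {c d : X} (h : SameAtom S c d) : atomInd S c = atomInd S d := by
  classical
  ext e
  exact if_congr ⟨fun h' => h.symm.trans h', fun h' => h.trans h'⟩ rfl rfl

theorem atomInd_comm (c d : X) : atomInd S c d = atomInd S d c := by
  classical exact if_congr ⟨SameAtom.symm, SameAtom.symm⟩ rfl rfl

theorem atomInd_mul_congr {c d : X} {a b : ℝ} (h : SameAtom S c d → a = b) :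
    atomInd S c d * a = atomInd S c d * b := by
  by_cases h0 : atomInd S c d = 0
  · simp [h0]
  · rw [h (atomInd_ne_zero.1 h0)]

/-- Lagrange interpolation: for each `d` outside the atom, a factor built from a function separating
`c` and `d` vanishes at `d` and equals `1` at `c`. The product lies in `S` and is therefore `1` on
the whole atom. -/
theorem atomInd_mem [Finite X] (c : X) : atomInd S c ∈ S := by
  classical
  have := Fintype.ofFinite X
  have hsep : ∀ d, ∃ f ∈ S, ¬ SameAtom S c d → f c ≠ f d := by
    intro d
    by_cases h : SameAtom S c d
    · exact ⟨0, zero_mem S, fun h' => (h' h).elim⟩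
    · simp only [SameAtom, not_forall] at h
      obtain ⟨f, hf, h⟩ := h
      exact ⟨f, hf, fun _ => h⟩
  choose f hf hsep using hsep
  let p : X → ℝ := ∏ d with ¬ SameAtom S c d,
    ((f d c - f d d)⁻¹ • (f d - algebraMap ℝ (X → ℝ) (f d d)))
  have hp : p ∈ S := prod_mem fun d _ => S.smul_mem (sub_mem (hf d) (S.algebraMap_mem _)) _
  have hpe : ∀ e, p e = ∏ d with ¬ SameAtom S c d, (f d c - f d d)⁻¹ * (f d e - f d d) := fun e => by
    simp [p, Finset.prod_apply]
  convert hp using 1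
  ext e
  by_cases h : SameAtom S c e
  · rw [← h p hp, hpe, Finset.prod_eq_one]
    · exact if_pos h
    · intro d hd
      exact inv_mul_cancel₀ (sub_ne_zero.2 (hsep d (Finset.mem_filter.1 hd).2))
  · rw [hpe, Finset.prod_eq_zero (Finset.mem_filter.2 ⟨Finset.mem_univ e, h⟩)]
    · exact if_neg h
    · rw [sub_self, mul_zero]

end FunctionAlgebra

/-! ### A criterion for positive semidefiniteness -/

section PosSemidef

/-- If `M z = l z` with `l < 0`, then `l² z = l K z`, so `l` is a negative eigenvalue of `K`, a
contradiction. -/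
theorem _root_.Matrix.IsHermitian.posSemidef_of_mul_self {n : Type*} [Fintype n] [DecidableEq n]
    {M K : Matrix n n ℝ} (hM : M.IsHermitian) (hK : K.PosSemidef) (h : M * M = K * M) :
    M.PosSemidef := by
  refine hM.posSemidef_iff_eigenvalues_nonneg.2 fun i => ?_
  have h1 := hM.mulVec_eigenvectorBasis i
  set z : n → ℝ := ⇑(hM.eigenvectorBasis i) with hz
  set l := hM.eigenvalues i
  have h2 : M *ᵥ (M *ᵥ z) = K *ᵥ (M *ᵥ z) := by
    rw [Matrix.mulVec_mulVec, Matrix.mulVec_mulVec, h]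
  rw [h1, Matrix.mulVec_smul, Matrix.mulVec_smul, h1] at h2
  by_contra hneg
  have hl : l < 0 := not_le.1 hneg
  have h3 : l • z = K *ᵥ z := smul_right_injective _ hl.ne h2
  have h4 := hK.dotProduct_mulVec_nonneg z
  rw [← h3, dotProduct_smul, smul_eq_mul] at h4
  have h5 : 0 < star z ⬝ᵥ z := by
    refine Matrix.dotProduct_star_self_pos_iff.2 fun h0 => ?_
    refine hM.eigenvectorBasis.orthonormal.ne_zero i ?_
    ext j
    exact congrFun h0 j
  nlinarith

end PosSemidef

/-! ## The matrix of a matched algebra of functions on tuples -/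

section MatchedAlgebra

variable {t : ℕ} {V W : Type*}

/-- The type of `2t`-tuples over `V` or over `W`. -/
abbrev Tuples (t : ℕ) (V W : Type*) : Type _ := (Pos t → V) ⊕ (Pos t → W)

/-- The action of permutations on tuples. -/
def Tuples.perm (σ : Equiv.Perm (Pos t)) : Tuples t V W → Tuples t V W :=
  Sum.map (fun g k => g (σ k)) (fun h k => h (σ k))

theorem Tuples.perm_perm (σ τ : Equiv.Perm (Pos t)) (c : Tuples t V W) :
    Tuples.perm σ (Tuples.perm τ c) = Tuples.perm (τ * σ) c := by
  rcases c with g | h <;> rfl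

variable [Fintype V]

variable {S : Subalgebra ℝ (Tuples t V W → ℝ)}

variable (S) in
/-- The number of tuples over `V` in the atom of `c`. -/
noncomputable def atomSize (c : Tuples t V W) : ℝ := ∑ g, atomInd S c (.inl g)

theorem SameAtom.atomSize_eq {c d : Tuples t V W} (h : SameAtom S c d) :
    atomSize S c = atomSize S d := by
  unfold atomSize
  rw [h.atomInd_eq]

/-- A member of `S` is constant on atoms. This turns its value at `c`, even for `c` over `W`, into a
sum over `V`. -/
theorem atomSize_mul {f : Tuples t V W → ℝ} (hf : f ∈ S) (c : Tuples t V W) :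
    atomSize S c * f c = ∑ g, atomInd S c (.inl g) * f (.inl g) := by
  rw [atomSize, Finset.sum_mul]
  exact Finset.sum_congr rfl fun g _ => atomInd_mul_congr fun h => h f hf

variable [Fintype W]

/-- The matrix product, on functions of tuples. -/
def tupleMul (f f' : Tuples t V W → ℝ) : Tuples t V W → ℝ :=
  Sum.elim
    (fun g => ∑ z, f (.inl (Sum.elim (fun i => g (.inl i)) z)) *
      f' (.inl (Sum.elim z fun i => g (.inr i))))
    (fun h => ∑ z, f (.inr (Sum.elim (fun i => h (.inl i)) z)) *
      f' (.inr (Sum.elim z fun i => h (.inr i))))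

/-- The sum of a function on tuples over one coordinate. -/
def coordSum (k : Pos t) (f : Tuples t V W → ℝ) : Tuples t V W → ℝ :=
  Sum.elim (fun g => ∑ x, f (.inl (Function.update g k x)))
    (fun h => ∑ z, f (.inr (Function.update h k z)))

/-- An algebra of functions on tuples that is closed under permutations, matrix products and sums
over a coordinate, and whose members have the same sum over `V` and over `W`. -/
structure IsMatched (S : Subalgebra ℝ (Tuples t V W → ℝ)) : Prop where
  sum_eq : ∀ f ∈ S, ∑ g, f (.inl g) = ∑ h, f (.inr h)
  perm_mem : ∀ σ, ∀ f ∈ S, (fun c => f (Tuples.perm σ c)) ∈ S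
  mul_mem : ∀ f ∈ S, ∀ f' ∈ S, tupleMul f f' ∈ S
  coordSum_mem : ∀ k, ∀ f ∈ S, coordSum k f ∈ S

namespace IsMatched

variable (hS : IsMatched S)
include hS

theorem atomSize_eq_sum (c : Tuples t V W) : atomSize S c = ∑ h, atomInd S c (.inr h) :=
  hS.sum_eq _ (atomInd_mem c)

theorem atomSize_pos (c : Tuples t V W) : 0 < atomSize S c := by
  rcases c with g | h
  · exact Finset.sum_pos' (fun _ _ => atomInd_nonneg S _ _)
      ⟨g, Finset.mem_univ _, (atomInd_self S _).symm ▸ one_pos⟩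
  · rw [hS.atomSize_eq_sum]
    exact Finset.sum_pos' (fun _ _ => atomInd_nonneg S _ _)
      ⟨h, Finset.mem_univ _, (atomInd_self S _).symm ▸ one_pos⟩

theorem sameAtom_perm (σ : Equiv.Perm (Pos t)) {c d : Tuples t V W} (h : SameAtom S c d) :
    SameAtom S (Tuples.perm σ c) (Tuples.perm σ d) := fun f hf => h _ (hS.perm_mem σ f hf)

theorem atomInd_perm (σ : Equiv.Perm (Pos t)) (c d : Tuples t V W) :
    atomInd S (Tuples.perm σ c) (Tuples.perm σ d) = atomInd S c d := by
  classical
  refine if_congr ⟨fun h => ?_, hS.sameAtom_perm σ⟩ rfl rfl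
  have := hS.sameAtom_perm σ⁻¹ h
  rw [Tuples.perm_perm, Tuples.perm_perm, mul_inv_cancel] at this
  rcases c with _ | _ <;> rcases d with _ | _ <;> exact this

theorem atomSize_perm (σ : Equiv.Perm (Pos t)) (c : Tuples t V W) :
    atomSize S (Tuples.perm σ c) = atomSize S c := by
  unfold atomSize
  rw [← (σ.symm.arrowCongr (Equiv.refl V)).sum_comp]
  exact Finset.sum_congr rfl fun g _ => hS.atomInd_perm σ c (.inl g)

theorem coordSum_symm (k : Pos t) (c d : Tuples t V W) :
    atomSize S c * coordSum k (atomInd S d) c = atomSize S d * coordSum k (atomInd S c) d := by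
  rw [atomSize_mul (hS.coordSum_mem k _ (atomInd_mem d)),
    atomSize_mul (hS.coordSum_mem k _ (atomInd_mem c))]
  simp only [coordSum, Sum.elim_inl, Finset.mul_sum]
  rw [← Fintype.sum_prod_type', ← Fintype.sum_prod_type']
  let e : Equiv.Perm ((Pos t → V) × V) :=
    Function.Involutive.toPerm (fun p => (Function.update p.1 k p.2, p.1 k)) fun p => by simp
  refine Fintype.sum_equiv e _ _ fun p => ?_
  simp [e, Function.Involutive.toPerm, mul_comm]

/-- Triangles are counted from two of their sides. -/
theorem tupleMul_symm (c d e : Tuples t V W) :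
    atomSize S e * tupleMul (atomInd S c) (atomInd S d) e = atomSize S d *
      tupleMul (fun b => atomInd S c (Tuples.perm (Equiv.sumComm _ _) b)) (atomInd S e) d := by
  -- Both sides count the triples `x, z, x'` over `V` with `(x, z)`, `(z, x')` and `(x, x')` in the
  -- atoms of `c`, `d` and `e`.
  rw [atomSize_mul (hS.mul_mem _ (atomInd_mem c) _ (atomInd_mem d)),
    atomSize_mul (hS.mul_mem _ (hS.perm_mem _ _ (atomInd_mem c)) _ (atomInd_mem e))]
  have hswap : ∀ x y : Fin t → V,
      Tuples.perm (Equiv.sumComm _ _) (.inl (Sum.elim x y) : Tuples t V W) =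
        .inl (Sum.elim y x) := fun x y =>
    congrArg Sum.inl (funext fun k => by rcases k with i | i <;> rfl)
  simp only [tupleMul, Sum.elim_inl, sum_pos_eq, Sum.elim_inr, hswap, Finset.mul_sum]
  calc ∑ x, ∑ x', ∑ z, atomInd S e (.inl (Sum.elim x x')) *
        (atomInd S c (.inl (Sum.elim x z)) * atomInd S d (.inl (Sum.elim z x')))
      = ∑ x', ∑ x, ∑ z, atomInd S e (.inl (Sum.elim x x')) *
        (atomInd S c (.inl (Sum.elim x z)) * atomInd S d (.inl (Sum.elim z x'))) :=
        Finset.sum_comm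
    _ = ∑ x', ∑ z, ∑ x, atomInd S e (.inl (Sum.elim x x')) *
        (atomInd S c (.inl (Sum.elim x z)) * atomInd S d (.inl (Sum.elim z x'))) :=
        Finset.sum_congr rfl fun _ _ => Finset.sum_comm
    _ = _ := by
        rw [Finset.sum_comm]
        refine Finset.sum_congr rfl fun _ _ => Finset.sum_congr rfl fun _ _ =>
          Finset.sum_congr rfl fun _ _ => ?_
        ring

end IsMatched

end MatchedAlgebra

/-! ## The isomorphism matrix of a matched algebra -/

section MatchedMatrix

theorem elim_comp_sumComm {α β γ : Type*} (f : α → γ) (g : β → γ) :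
    (fun k => Sum.elim f g (Equiv.sumComm β α k)) = Sum.elim g f :=
  funext fun k => by rcases k with i | i <;> rfl

variable {t : ℕ} {V W : Type*} [Fintype V]

variable (S : Subalgebra ℝ (Tuples t V W → ℝ))

/-- The probability that a random tuple over `W` in the atom of `g` is `h`. -/
noncomputable def matchProb (g : Pos t → V) (h : Pos t → W) : ℝ :=
  atomInd S (.inl g) (.inr h) / atomSize S (.inl g)

/-- The matrix with entries `matchProb`, indexed by pairs of tuples. -/
noncomputable def matchMatrix :
    Matrix ((Fin t → V) × (Fin t → W)) ((Fin t → V) × (Fin t → W)) ℝ :=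
  Matrix.of fun p q => matchProb S (Sum.elim p.1 q.1) (Sum.elim p.2 q.2)

/-- The Gram matrix `K` with `matchMatrix S ^ 2 = (K ⊗ 1) * matchMatrix S`. -/
noncomputable def matchGram : Matrix (Fin t → V) (Fin t → V) ℝ :=
  Matrix.of fun x y => ∑ z, atomInd S (.inl (Sum.elim x z)) (.inl (Sum.elim y z)) /
    atomSize S (.inl (Sum.elim x z))

variable {S}

theorem matchProb_eq (g : Pos t → V) (h : Pos t → W) :
    matchProb S g h = atomInd S (.inr h) (.inl g) / atomSize S (.inr h) := by
  unfold matchProb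
  rw [atomInd_comm, div_eq_mul_inv, div_eq_mul_inv]
  exact atomInd_mul_congr fun h' => by rw [h'.atomSize_eq]

variable [Fintype W] (hS : IsMatched S)
include hS

theorem matchProb_perm (σ : Equiv.Perm (Pos t)) (g : Pos t → V) (h : Pos t → W) :
    matchProb S (fun k => g (σ k)) (fun k => h (σ k)) = matchProb S g h :=
  congrArg₂ (· / ·) (hS.atomInd_perm σ (.inl g) (.inr h)) (hS.atomSize_perm σ (.inl g))

theorem matchMatrix_symm (p q : (Fin t → V) × (Fin t → W)) :
    matchMatrix S p q = matchMatrix S q p := by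
  simp only [matchMatrix, Matrix.of_apply]
  rw [← matchProb_perm hS (Equiv.sumComm _ _), elim_comp_sumComm, elim_comp_sumComm]

/-- A Gram representation: the vector of `x` has the entry `1 / |g|` at `(z, g)` if `(x, z)` lies in
the atom of `g`, and `0` otherwise. -/
theorem matchGram_eq (x y : Fin t → V) : matchGram S x y =
    ∑ z, ∑ g, atomInd S (.inl (Sum.elim x z)) (.inl g) / atomSize S (.inl g) *
      (atomInd S (.inl (Sum.elim y z)) (.inl g) / atomSize S (.inl g)) := by
  refine Finset.sum_congr rfl fun z _ => ?_
  set c : Tuples t V W := .inl (Sum.elim x z)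
  set d : Tuples t V W := .inl (Sum.elim y z)
  have h : ∀ g : Pos t → V, atomInd S c (.inl g) / atomSize S (.inl g) *
      (atomInd S d (.inl g) / atomSize S (.inl g)) =
        atomInd S c (.inl g) * (atomInd S c d / atomSize S c ^ 2) := fun g => by
    rw [div_mul_eq_mul_div, mul_div_assoc]
    refine atomInd_mul_congr fun h => ?_
    rw [h.atomSize_eq, h.atomInd_eq, atomInd_comm]
    field_simp
  simp_rw [h]
  rw [← Finset.sum_mul]
  change _ = atomSize S c * _
  have := (hS.atomSize_pos c).ne'
  field_simp

theorem matchGram_posSemidef : (matchGram S).PosSemidef := by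
  let B : Matrix (Fin t → V) ((Fin t → V) × (Pos t → V)) ℝ := Matrix.of fun x p =>
    atomInd S (.inl (Sum.elim x p.1)) (.inl p.2) / atomSize S (.inl p.2)
  have : matchGram S = B * Bᴴ := by
    ext x y
    rw [matchGram_eq hS, Matrix.mul_apply, Fintype.sum_prod_type]
    rfl
  rw [this]
  exact Matrix.posSemidef_self_mul_conjTranspose B

/-- For fixed `z`, the sum over `w` counts triangles over `W` on the side `(u, u')`. By
`tupleMul_symm` this becomes a count over `V` on the side `(z, x')`, with a third vertex `y` in
place of `w`. The atom sizes then regroup, and the sum over `z` gives `matchGram S x y`. -/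
theorem matchMatrix_mul_self [DecidableEq W] :
    matchMatrix S * matchMatrix S =
      Matrix.of (fun p q => if p.2 = q.2 then matchGram S p.1 q.1 else 0) * matchMatrix S := by
  ext ⟨x, u⟩ ⟨x', u'⟩
  simp only [Matrix.mul_apply, Fintype.sum_prod_type, Matrix.of_apply, ite_mul, zero_mul,
    Finset.sum_ite_eq, Finset.mem_univ, if_true]
  set e : Tuples t V W := .inr (Sum.elim u u')
  have h1 : ∀ z : Fin t → V, ∑ w, matchMatrix S (x, u) (z, w) * matchMatrix S (z, w) (x', u') =
      tupleMul (atomInd S (.inl (Sum.elim x z))) (atomInd S (.inl (Sum.elim z x'))) e /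
        (atomSize S (.inl (Sum.elim x z)) * atomSize S (.inl (Sum.elim z x'))) := fun z => by
    simp only [tupleMul, e, Sum.elim_inr, Sum.elim_inl, Finset.sum_div]
    refine Finset.sum_congr rfl fun w _ => ?_
    simp only [matchMatrix, matchProb, Matrix.of_apply]
    rw [div_mul_div_comm]
  have h2 : ∀ z : Fin t → V,
      tupleMul (atomInd S (.inl (Sum.elim x z))) (atomInd S (.inl (Sum.elim z x'))) e /
        (atomSize S (.inl (Sum.elim x z)) * atomSize S (.inl (Sum.elim z x'))) =
      ∑ y, atomInd S (.inl (Sum.elim x z)) (.inl (Sum.elim y z)) /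
        atomSize S (.inl (Sum.elim x z)) * (atomInd S e (.inl (Sum.elim y x')) / atomSize S e) := by
    intro z
    have hswap : ∀ x y : Fin t → V,
        Tuples.perm (Equiv.sumComm _ _) (.inl (Sum.elim x y) : Tuples t V W) =
          .inl (Sum.elim y x) := fun x y => congrArg Sum.inl (elim_comp_sumComm x y)
    have h := hS.tupleMul_symm (.inl (Sum.elim x z)) (.inl (Sum.elim z x')) e
    have h' : tupleMul (fun b => atomInd S (.inl (Sum.elim x z))
        (Tuples.perm (Equiv.sumComm _ _) b)) (atomInd S e) (.inl (Sum.elim z x')) =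
        ∑ y, atomInd S (.inl (Sum.elim x z)) (.inl (Sum.elim y z)) *
          atomInd S e (.inl (Sum.elim y x')) := by
      simp only [tupleMul, Sum.elim_inl, Sum.elim_inr, hswap]
    rw [h'] at h
    have hc := (hS.atomSize_pos (.inl (Sum.elim x z))).ne'
    have hd := (hS.atomSize_pos (.inl (Sum.elim z x'))).ne'
    have he := (hS.atomSize_pos e).ne'
    simp_rw [div_mul_div_comm]
    rw [← Finset.sum_div, div_eq_div_iff (mul_ne_zero hc hd) (mul_ne_zero hc he)]
    linear_combination (atomSize S (.inl (Sum.elim x z))) * h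
  simp_rw [h1, h2]
  rw [Finset.sum_comm]
  refine Finset.sum_congr rfl fun y _ => ?_
  rw [← Finset.sum_mul]
  refine congrArg₂ (· * ·) rfl ?_
  exact (matchProb_eq _ _).symm

theorem matchMatrix_posSemidef : (matchMatrix S).PosSemidef := by
  classical
  have h : Matrix.of (fun p q : (Fin t → V) × (Fin t → W) =>
      if p.2 = q.2 then matchGram S p.1 q.1 else 0) =
      Matrix.kroneckerMap (· * ·) (matchGram S) (1 : Matrix (Fin t → W) (Fin t → W) ℝ) := by
    ext p q
    simp [Matrix.one_apply]
  refine Matrix.IsHermitian.posSemidef_of_mul_self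
    (Matrix.IsHermitian.ext fun p q => (matchMatrix_symm hS q p)) ?_ (matchMatrix_mul_self hS)
  rw [h]
  exact (matchGram_posSemidef hS).kronecker Matrix.PosSemidef.one

/-- Row and column sums are `1` because each atom has equally many tuples over `V` and `W`; the
coordinate condition is `coordSum_symm` across the two sides. -/
theorem IsMatched.dnnIsomorphic {G : SimpleGraph V} {H : SimpleGraph W}
    (hSGH : ∀ g h, SameAtom S (.inl g) (.inr h) → SameType G H g h) : DNNIsomorphic t G H := by
  let e : (Fin t → V × W) → (Fin t → V) × (Fin t → W) := fun p =>
    (fun i => (p i).1, fun i => (p i).2)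
  have hM : ∀ g h, pairEntry ((matchMatrix S).submatrix e e) g h = matchProb S g h := fun g h =>
    congrArg₂ (matchProb S) (Sum.elim_comp_inl_inr g) (Sum.elim_comp_inl_inr h)
  refine ⟨(matchMatrix S).submatrix e e, ⟨(matchMatrix_posSemidef hS).submatrix _, fun p q =>
    div_nonneg (atomInd_nonneg S _ _) (hS.atomSize_pos _).le⟩, fun k g h => ?_, fun g => ?_,
    fun h => ?_, fun g h hT => ?_, fun σ g h => ?_⟩ <;> simp only [hM]
  · have h1 : ∑ x, matchProb S (Function.update g k x) h =
        coordSum k (atomInd S (.inr h)) (.inl g) / atomSize S (.inr h) := by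
      simp_rw [matchProb_eq]
      rw [← Finset.sum_div]
      rfl
    have h2 : ∑ z, matchProb S g (Function.update h k z) =
        coordSum k (atomInd S (.inl g)) (.inr h) / atomSize S (.inl g) := by
      simp_rw [matchProb]
      rw [← Finset.sum_div]
      rfl
    rw [h1, h2, div_eq_div_iff (hS.atomSize_pos _).ne' (hS.atomSize_pos _).ne', mul_comm,
      hS.coordSum_symm, mul_comm]
  · simp_rw [matchProb]
    rw [← Finset.sum_div, ← hS.atomSize_eq_sum, div_self (hS.atomSize_pos _).ne']
  · simp_rw [matchProb_eq]
    rw [← Finset.sum_div, ← atomSize, div_self (hS.atomSize_pos _).ne']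
  · rw [matchProb, div_eq_zero_iff]
    left
    by_contra h0
    exact hT (hSGH g h (atomInd_ne_zero.1 h0))
  · exact (matchProb_perm hS σ g h).symm

end MatchedMatrix

/-! ## From homomorphism counts to isomorphism matrices -/

section CountsToMatrix

variable {t : ℕ} {V W : Type*} (G : SimpleGraph V) (H : SimpleGraph W)

/-- The homomorphism counts of a bilabelled graph, as a function of the images of the labels. -/
noncomputable def tupleCount (B : BiGraph t) : Tuples t V W → ℝ :=
  Sum.elim (fun g => labHomCount B G g) (fun h => labHomCount B H h)

/-- The algebra spanned by the homomorphism counts of the graphs in `LPlus t`. -/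
noncomputable def homAlgebra (t : ℕ) : Subalgebra ℝ (Tuples t V W → ℝ) :=
  (Submodule.span ℝ {f | ∃ B : BiGraph t, LPlus t B ∧ tupleCount G H B = f}).toSubalgebra
    -- The constant function `1` counts the maps from `2t` isolated labelled vertices; products of
    -- counts come from parallel composition.
    (Submodule.subset_span ⟨_, LPlus.edgelessAtomic id, by
      classical
      ext (g | h) <;> simp [tupleCount, labHomCount_edgelessAtomic]⟩)
    (LinearMap.BilinMap.apply_apply_mem_of_mem_span _ _ _ (LinearMap.mul ℝ _) (by
      rintro _ ⟨B, hB, rfl⟩ _ ⟨B', hB', rfl⟩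
      refine Submodule.subset_span ⟨_, hB.parallel hB', ?_⟩
      ext (g | h) <;> simp [tupleCount, labHomCount_parallel]))

variable {G H}

theorem tupleCount_mem {B : BiGraph t} (hB : LPlus t B) :
    tupleCount G H B ∈ homAlgebra G H t := Submodule.subset_span ⟨B, hB, rfl⟩

theorem perm_mem_homAlgebra (σ : Equiv.Perm (Pos t)) {f : Tuples t V W → ℝ}
    (hf : f ∈ homAlgebra G H t) : (fun c => f (Tuples.perm σ c)) ∈ homAlgebra G H t := by
  induction hf using Submodule.span_induction with
  | mem f hf =>
    obtain ⟨B, hB, rfl⟩ := hf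
    convert tupleCount_mem (G := G) (H := H) (hB.perm σ⁻¹) using 1
    ext (g | h) <;> simp [tupleCount, labHomCount_perm, Tuples.perm]
  | zero => exact zero_mem (homAlgebra G H t)
  | add f f' _ _ ih ih' => exact add_mem ih ih'
  | smul a f _ ih => exact (homAlgebra G H t).smul_mem ih a

open Classical in
theorem labHomCount_identify {U : Type*} (K : SimpleGraph U) (i j : Pos t) (g : Pos t → U) :
    labHomCount (edgelessAtomic fun k => if k = j then i else k) K g =
      if g i = g j then 1 else 0 := by
  have hiff : (∀ k k', (if k = j then i else k) = (if k' = j then i else k') → g k = g k') ↔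
      g i = g j := by
    refine ⟨fun hg => hg i j (by simp), fun hg k k' hk => ?_⟩
    have h : ∀ k, g k = g (if k = j then i else k) := fun k => by
      split_ifs with hk
      exacts [hk ▸ hg.symm, rfl]
    exact (h k).trans ((congrArg g hk).trans (h k').symm)
  rw [labHomCount_edgelessAtomic]
  by_cases hg : g i = g j
  · rw [if_pos (hiff.2 hg), if_pos hg]
  · rw [if_neg fun h => hg (hiff.1 h), if_neg hg]

/-- The atomic graph with `2t` distinct vertices whose only edge joins those labelled `i`, `j`. -/
def edgeAtomic (i j : Pos t) : BiGraph t where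
  V := Pos t
  Adj a b := (a = i ∧ b = j) ∨ (a = j ∧ b = i)
  symm := fun h => h.elim (fun h => .inr h.symm) fun h => .inl h.symm
  lab := id

theorem edgeAtomic_atomic (i j : Pos t) : (edgeAtomic i j).Atomic := Function.surjective_id

open Classical in
theorem labHomCount_edgeAtomic {U : Type*} (K : SimpleGraph U) (i j : Pos t) (g : Pos t → U) :
    labHomCount (edgeAtomic i j) K g = if K.Adj (g i) (g j) then 1 else 0 := by
  rw [labHomCount_atomic (edgeAtomic_atomic i j)]
  refine if_congr ⟨fun h => h.2 i j (.inl ⟨rfl, rfl⟩), fun h => ⟨fun k l hkl => congrArg g hkl,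
    fun k l hkl => ?_⟩⟩ rfl rfl
  rcases hkl with ⟨hk, hl⟩ | ⟨hk, hl⟩
  · exact (congrArg₂ (fun a b => K.Adj (g a) (g b)) hk hl).mpr h
  · exact (congrArg₂ (fun a b => K.Adj (g a) (g b)) hk hl).mpr h.symm

/-- Two atomic graphs suffice for each pair `i`, `j`: one merges the two labels and detects
equality, the other joins them by an edge and detects adjacency. -/
theorem sameType_of_sameAtom {g : Pos t → V} {h : Pos t → W}
    (hgh : SameAtom (homAlgebra G H t) (.inl g) (.inr h)) : SameType G H g h := by
  classical
  have key : ∀ {B : BiGraph t}, LPlus t B → labHomCount B G g = labHomCount B H h := fun hB =>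
    Nat.cast_injective (R := ℝ) (hgh _ (tupleCount_mem hB))
  have hiff : ∀ {p q : Prop}, (if p then 1 else 0) = (if q then 1 else 0) → (p ↔ q) := by
    intro p q hpq
    by_cases hp : p <;> by_cases hq : q <;> simp_all
  intro i j
  have h1 := key (LPlus.edgelessAtomic fun k => if k = j then i else k)
  have h2 := key (LPlus.atomic (edgeAtomic_atomic i j))
  rw [labHomCount_identify, labHomCount_identify] at h1
  rw [labHomCount_edgeAtomic, labHomCount_edgeAtomic] at h2
  exact ⟨hiff h1, hiff h2⟩

variable [Fintype V] [Fintype W] [DecidableEq V] [DecidableEq W]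

theorem tupleMul_mem_homAlgebra {f f' : Tuples t V W → ℝ} (hf : f ∈ homAlgebra G H t)
    (hf' : f' ∈ homAlgebra G H t) : tupleMul f f' ∈ homAlgebra G H t := by
  refine LinearMap.BilinMap.apply_apply_mem_of_mem_span (homAlgebra G H t).toSubmodule _ _
    (LinearMap.mk₂ ℝ tupleMul ?_ ?_ ?_ ?_) ?_ f f' hf hf'
  · intro f₁ f₂ f
    ext (g | h) <;> simp [tupleMul, add_mul, Finset.sum_add_distrib]
  · intro a f₁ f
    ext (g | h) <;> simp [tupleMul, mul_assoc, Finset.mul_sum]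
  · intro f f₁ f₂
    ext (g | h) <;> simp [tupleMul, mul_add, Finset.sum_add_distrib]
  · intro a f f₁
    ext (g | h) <;> simp [tupleMul, mul_left_comm, Finset.mul_sum]
  · rintro _ ⟨B, hB, rfl⟩ _ ⟨B', hB', rfl⟩
    have h : tupleMul (tupleCount G H B) (tupleCount G H B') = tupleCount G H (B.series B') := ?_
    · exact Set.mem_of_eq_of_mem h (tupleCount_mem (hB.series hB'))
    ext (g | h)
    · obtain ⟨x, y, rfl⟩ : ∃ x y, g = Sum.elim x y := ⟨_, _, (Sum.elim_comp_inl_inr g).symm⟩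
      simp [tupleMul, tupleCount, labHomCount_series]
    · obtain ⟨x, y, rfl⟩ : ∃ x y, h = Sum.elim x y := ⟨_, _, (Sum.elim_comp_inl_inr h).symm⟩
      simp [tupleMul, tupleCount, labHomCount_series]

/-- The edgeless graph joins the `i`-th in-label and out-label into one vertex except for `i = j`.
Its count is the indicator that `z` agrees with the out-part of `g` away from `j`, so a coordinate
sum is a matrix product. -/
theorem sum_update_eq {U : Type*} [Fintype U] [DecidableEq U] (K : SimpleGraph U) (j : Fin t)
    (f : (Pos t → U) → ℝ) (g : Pos t → U) :
    ∑ x, f (Function.update g (.inr j) x) = ∑ z, f (Sum.elim (fun i => g (.inl i)) z) *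
      labHomCount (edgelessAtomic (Sum.elim Sum.inl fun i => if i = j then .inr j else .inl i))
        K (Sum.elim z fun i => g (.inr i)) := by
  classical
  refine Fintype.sum_of_injective (Function.update (fun i => g (.inr i)) j)
    (Function.update_injective _ _) _ _ (fun z hz => ?_) fun x => ?_
  · rw [labHomCount_edgelessAtomic, if_neg, Nat.cast_zero, mul_zero]
    intro hl
    refine hz ⟨z j, funext fun i => ?_⟩
    by_cases hi : i = j
    · rw [hi, Function.update_self]
    · rw [Function.update_of_ne hi]
      exact (hl (.inl i) (.inr i) (by simp [hi])).symm
  · rw [labHomCount_edgelessAtomic, if_pos, Nat.cast_one, mul_one, ← Sum.update_elim_inr]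
    · exact congrArg (fun g => f (Function.update g (.inr j) x)) (Sum.elim_comp_inl_inr g).symm
    · rintro (i | i) (i' | i') <;> simp only [Sum.elim_inl, Sum.elim_inr] <;> intro hi
      · rw [Sum.inl_injective hi]
      · split_ifs at hi with h1
        rw [← Sum.inl_injective hi] at h1 ⊢
        rw [Function.update_of_ne h1]
      · split_ifs at hi with h1
        rw [Sum.inl_injective hi] at h1 ⊢
        rw [Function.update_of_ne h1]
      · split_ifs at hi with h1 h2 h2
        · rw [h1, h2]
        · rw [Sum.inl_injective hi]

theorem update_comp_sumComm {U : Type*} (g : Pos t → U) (i : Fin t) (x : U) :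
    (fun k => Function.update (fun k => g (Equiv.sumComm _ _ k)) (.inr i) x
      (Equiv.sumComm _ _ k)) = Function.update g (.inl i) x := by
  ext (i | i) <;> simp [Function.update_apply]

theorem coordSum_mem_homAlgebra (k : Pos t) {f : Tuples t V W → ℝ}
    (hf : f ∈ homAlgebra G H t) : coordSum k f ∈ homAlgebra G H t := by
  have hr : ∀ j, ∀ f ∈ homAlgebra G H t, coordSum (.inr j) f ∈ homAlgebra G H t := by
    intro j f hf
    convert tupleMul_mem_homAlgebra hf (tupleCount_mem (LPlus.edgelessAtomic
      (Sum.elim Sum.inl fun i => if i = j then .inr j else .inl i))) using 1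
    ext (g | h)
    · exact sum_update_eq G j (fun g => f (.inl g)) g
    · exact sum_update_eq H j (fun h => f (.inr h)) h
  rcases k with j | j
  · convert perm_mem_homAlgebra (Equiv.sumComm _ _)
      (hr j _ (perm_mem_homAlgebra (Equiv.sumComm _ _) hf)) using 1
    ext (g | h)
    · exact Finset.sum_congr rfl fun x _ =>
        congrArg (fun g => f (.inl g)) (update_comp_sumComm g j x).symm
    · exact Finset.sum_congr rfl fun x _ =>
        congrArg (fun g => f (.inr g)) (update_comp_sumComm h j x).symm
  · exact hr j f hf

/-- Summing over all images of the labels gives the homomorphism count of the underlying graph. This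
is where homomorphism indistinguishability enters. -/
theorem HomIndist.sum_eq (h : HomIndist (underlying (LPlus t)) G H) {f : Tuples t V W → ℝ}
    (hf : f ∈ homAlgebra G H t) : ∑ g, f (.inl g) = ∑ h, f (.inr h) := by
  induction hf using Submodule.span_induction with
  | mem f hf =>
    obtain ⟨B, hB, rfl⟩ := hf
    simp only [tupleCount, Sum.elim_inl, Sum.elim_inr]
    have := h B.toFinGraph ⟨B, hB, Equiv.refl _, fun _ _ => Iff.rfl⟩
    rw [← sum_labHomCount, ← sum_labHomCount] at this
    exact_mod_cast this
  | zero => simp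
  | add f f' _ _ ih ih' => simp [Finset.sum_add_distrib, ih, ih']
  | smul a f _ ih => simp [← Finset.mul_sum, ih]

theorem HomIndist.dnnIsomorphic (h : HomIndist (underlying (LPlus t)) G H) :
    DNNIsomorphic t G H :=
  IsMatched.dnnIsomorphic (S := homAlgebra G H t)
    { sum_eq := fun _ hf => h.sum_eq hf
      perm_mem := fun σ _ hf => perm_mem_homAlgebra σ hf
      mul_mem := fun _ hf _ hf' => tupleMul_mem_homAlgebra hf hf'
      coordSum_mem := fun k _ hf => coordSum_mem_homAlgebra k hf }
    fun _ _ => sameType_of_sameAtom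

end CountsToMatrix

end LasserreGI

theorem theorem3 (t : ℕ) (ht : 1 ≤ t) :
    -- the class contains the smaller class generated with atomic parallel compositions only
    (∀ B : LasserreGI.BiGraph t, LasserreGI.LClass t B → LasserreGI.LPlus t B) ∧
    -- it is minor-closed and of treewidth at most `3t - 1`
    LasserreGI.MinorClosed (LasserreGI.underlying (LasserreGI.LPlus t)) ∧
    (∀ F ∈ LasserreGI.underlying (LasserreGI.LPlus t), F.TreewidthLE (3 * t - 1)) ∧
    -- the characterisations, for all finite simple graphs `G` and `H`
    ∀ (V W : Type*) [Fintype V] [Fintype W] [DecidableEq V] [DecidableEq W]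
      (G : SimpleGraph V) (H : SimpleGraph W),
      List.TFAE [
        LasserreGI.LasserrePlusFeasible t G H,
        LasserreGI.DNNIsomorphic t G H,
        ∃ Φ : LasserreGI.Tensor t V →ₗ[ℂ] LasserreGI.Tensor t W, LasserreGI.IsDNNIsoMap t G H Φ,
        LasserreGI.TEquivalent t G H,
        LasserreGI.HomIndist (LasserreGI.underlying (LasserreGI.LPlus t)) G H] := by
  refine ⟨fun _ h => h.lPlus, LasserreGI.minorClosed_underlying_LPlus t,
    fun _ hF => LasserreGI.treewidthLE_of_mem_underlying_LPlus ht hF, ?_⟩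
  intro V W _ _ _ _ G H
  tfae_have 1 → 2 := fun h => h.dnnIsomorphic ht
  tfae_have 2 → 1 := fun h => h.lasserrePlusFeasible ht
  tfae_have 2 → 3 := fun h => h.exists_isDNNIsoMap
  tfae_have 3 → 4 := fun ⟨_, h⟩ => h.tEquivalent ht
  tfae_have 4 → 5 := fun h => h.homIndist ht
  tfae_have 5 → 2 := fun h => h.dnnIsomorphic
  tfae_finish
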